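/- Let $H$ be a complex Hilbert space. A *nest* $\mathcal N$ on $H$ is a chain of closed subspaces of $H$ containing $\{0\}$ and $H$ and closed under arbitrary intersections and closed spans; the *nest algebra* $\mathcal T(\mathcal N)$ is the algebra of all bounded operators on $H$ leaving every member of $\mathcal N$ invariant, and the *quasi-triangular algebra* is $\mathcal{QT}(\mathcal N)=\mathcal T(\mathcal N)+\mathcal K(H)$, where $\mathcal K(H)$ is the set of compact operators. A *flow* on a Banach algebra $\mathfrak B$ is a homomorphism $t\mapsto\alpha_t$ from $(\mathbb R,+)$ to the group of bounded algebra automorphisms of $\mathfrak B$ such that $t\mapsto\alpha_t(b)$ is norm continuous for each $b\in\mathfrak B$. Its *generator* is $\delta_\alpha(b)=\lim_{t\to0}(\alpha_t(b)-b)/t$, with domain $D(\delta_\alpha)$ the set of all $b$ for which this norm limit exists. For flows $\alpha,\beta$ on $\mathfrak B$, $\alpha$ is an *inner perturbation* of $\beta$ if $D(\delta_\alpha)=D(\delta_\beta)$ and there is $h\in\mathfrak B$ with $\delta_\alpha(b)=\delta_\beta(b)+i(hb-bh)$ for all $b$ in this domain. **Proposition 3.3.** Let $\mathfrak B$ be $\mathcal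 T(\mathcal N)$ or $\mathcal{QT}(\mathcal N)$ for a nest $\mathcal N$ on $H$, and let $\alpha,\beta$ be two flows on $\mathfrak B$ with $\|\alpha_t-\beta_t\|=O(t)$ as $t\to0$ (operator norm on $\mathfrak B$). Then $\alpha$ is an inner perturbation of $\beta$. Concretely, there are $h\in\mathfrak B$ and a norm-differentiable family $(u_t)_{t\in\mathbb R}$ of invertible elements of $\mathfrak B$ such that $D(\delta_\alpha)=D(\delta_\beta)$, $\delta_\alpha(b)=\delta_\beta(b)+i(hb-bh)$ for all $b$ in this domain, $u_s\beta_s(u_t)=u_{s+t}$ for all $s,t\in\mathbb R$, $\frac{d}{dt}u_t\big|_{t=0}=ih$, and $$\alpha_t(b)=u_t\,\beta_t(b)\,u_t^{-1}\qquad(t\in\mathbb R,\ b\in\mathfrak B).$$ -/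

import Mathlib

open Filter Topology

section Flows

variable {B : Type*} [NormedRing B] [NormedAlgebra ℂ B]

/-- A flow on a complex normed algebra `B`: a homomorphism `t ↦ α_t` from the additive group of
the reals into the group of bounded (bicontinuous) algebra automorphisms of `B`, such that
`t ↦ α_t b` is norm continuous for each `b`. -/
structure AlgFlow (B : Type*) [NormedRing B] [NormedAlgebra ℂ B] where
  /-- The automorphism `α_t`. -/
  aut : ℝ → (B ≃A[ℂ] B)
  aut_add : ∀ (s t : ℝ) (b : B), aut (s + t) b = aut s (aut t b)
  continuous_aut : ∀ b : B, Continuous fun t : ℝ => aut t b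

namespace AlgFlow

/-- The bounded linear operator `α_t` on `B`. -/
def op (α : AlgFlow B) (t : ℝ) : B →L[ℂ] B where
  toFun b := α.aut t b
  map_add' b b' := map_add (α.aut t) b b'
  map_smul' c b := map_smul (α.aut t) c b
  cont := (α.aut t).continuous

@[simp] theorem op_apply (α : AlgFlow B) (t : ℝ) (b : B) : α.op t b = α.aut t b := rfl

/-- `a = lim_{t → 0} (α_t b - b) / t`, in norm. -/
def HasGen (α : AlgFlow B) (b a : B) : Prop :=
  Tendsto (fun t : ℝ => ((t : ℂ)⁻¹) • (α.aut t b - b)) (𝓝[≠] 0) (𝓝 a)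

theorem HasGen.unique {α : AlgFlow B} {b a a' : B} (h : α.HasGen b a) (h' : α.HasGen b a') :
    a = a' :=
  tendsto_nhds_unique h h'

theorem HasGen.add {α : AlgFlow B} {b b' a a' : B} (h : α.HasGen b a) (h' : α.HasGen b' a') :
    α.HasGen (b + b') (a + a') := by
  refine (Tendsto.add h h').congr fun t => ?_
  rw [map_add, ← smul_add]
  congr 1
  abel

theorem HasGen.smul {α : AlgFlow B} {b a : B} (c : ℂ) (h : α.HasGen b a) :
    α.HasGen (c • b) (c • a) := by
  refine (Tendsto.const_smul h c).congr fun t => ?_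
  rw [map_smul, ← smul_sub, smul_comm]

theorem HasGen.zero (α : AlgFlow B) : α.HasGen 0 0 := by
  simp [HasGen]

/-- The domain `D(δ_α)` of the infinitesimal generator: all `b` for which the limit of
`(α_t b - b) / t` as `t → 0` exists in `B`. -/
def genDomain (α : AlgFlow B) : Submodule ℂ B where
  carrier := {b | ∃ a, α.HasGen b a}
  add_mem' := fun ⟨a, h⟩ ⟨a', h'⟩ => ⟨a + a', h.add h'⟩
  zero_mem' := ⟨0, HasGen.zero α⟩
  smul_mem' := fun c _ ⟨a, h⟩ => ⟨c • a, h.smul c⟩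

/-- The infinitesimal generator `δ_α`, a linear operator on `B` with domain `D(δ_α)`. -/
noncomputable def generator (α : AlgFlow B) : B →ₗ.[ℂ] B where
  domain := α.genDomain
  toFun :=
    { toFun := fun b => b.2.choose
      map_add' := fun b b' =>
        HasGen.unique (b + b').2.choose_spec (b.2.choose_spec.add b'.2.choose_spec)
      map_smul' := fun c b =>
        HasGen.unique (c • b).2.choose_spec (b.2.choose_spec.smul c) }

/-- The value of the generator is the limit of the difference quotients. -/
theorem hasGen_generator (α : AlgFlow B) (b : α.generator.domain) :
    α.HasGen b (α.generator b) :=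
  b.2.choose_spec

/-- `α` is the inner perturbation of `β` by `h`: the generators have the same domain and
`δ_α = δ_β + ad (i h)` there, where `ad (i h) b = i (h b - b h)`. -/
def IsInnerPerturbationBy (α β : AlgFlow B) (h : B) : Prop :=
  α.generator.domain = β.generator.domain ∧
    ∀ (b : B) (hα : b ∈ α.generator.domain) (hβ : b ∈ β.generator.domain),
      α.generator ⟨b, hα⟩ = β.generator ⟨b, hβ⟩ + Complex.I • (h * b - b * h)

/-- `α` is an inner perturbation of `β`. -/
def IsInnerPerturbation (α β : AlgFlow B) : Prop :=
  ∃ h : B, α.IsInnerPerturbationBy β h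

/-- `u` is a `β`-cocycle: a norm continuous family of invertible elements with
`u_s β_s(u_t) = u_{s+t}`. -/
def IsCocycle (β : AlgFlow B) (u : ℝ → Bˣ) : Prop :=
  Continuous (fun t => (u t : B)) ∧ ∀ s t : ℝ, (u s : B) * β.aut s (u t) = u (s + t)

/-- `α_t = Ad u_t ∘ β_t` for all `t`. -/
def IsAdPerturbationBy (α β : AlgFlow B) (u : ℝ → Bˣ) : Prop :=
  ∀ (t : ℝ) (b : B), α.aut t b = (u t : B) * β.aut t b * ((u t)⁻¹ : Bˣ)

/-- `u` is norm differentiable on the real line, with derivative `P` at `0`. -/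
def IsDifferentiableFamily (u : ℝ → Bˣ) (P : B) : Prop :=
  Differentiable ℝ (fun t => (u t : B)) ∧ HasDerivAt (fun t => (u t : B)) P 0

end AlgFlow

end Flows

section NestAlgebras

variable {H : Type*} [NormedAddCommGroup H] [InnerProductSpace ℂ H]

/-- A nest: a chain of closed subspaces containing `0` and `H`, closed under arbitrary
intersections and closed spans. -/
structure IsNest (N : Set (Submodule ℂ H)) : Prop where
  isClosed : ∀ M ∈ N, IsClosed (M : Set H)
  isChain : IsChain (· ≤ ·) N
  bot_mem : ⊥ ∈ N
  top_mem : ⊤ ∈ N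
  sInf_mem : ∀ S ⊆ N, sInf S ∈ N
  closure_sSup_mem : ∀ S ⊆ N, (sSup S).topologicalClosure ∈ N

/-- The nest algebra: all bounded operators leaving each member of `N` invariant. -/
def nestAlgebra (N : Set (Submodule ℂ H)) : Subalgebra ℂ (H →L[ℂ] H) where
  carrier := {T | ∀ M ∈ N, ∀ x ∈ M, T x ∈ M}
  mul_mem' := fun {S T} hS hT M hM x hx => hS M hM (T x) (hT M hM x hx)
  add_mem' := fun hS hT M hM x hx => M.add_mem (hS M hM x hx) (hT M hM x hx)
  algebraMap_mem' := fun c M _ x hx => by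
    simpa [Algebra.algebraMap_eq_smul_one] using M.smul_mem c hx

/-- The quasi-triangular algebra: all sums `T + K` with `T` in the nest algebra and `K` a compact
operator on `H`. -/
def quasiTriangularAlgebra (N : Set (Submodule ℂ H)) : Subalgebra ℂ (H →L[ℂ] H) where
  carrier := {A | ∃ T ∈ nestAlgebra N, ∃ K : H →L[ℂ] H, IsCompactOperator K ∧ A = T + K}
  mul_mem' := by
    rintro _ _ ⟨S, hS, K, hK, rfl⟩ ⟨T, hT, L, hL, rfl⟩
    refine ⟨S * T, mul_mem hS hT, S * L + K * (T + L), ?_, by noncomm_ring⟩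
    exact (hL.clm_comp S).add (hK.comp_clm (T + L))
  add_mem' := by
    rintro _ _ ⟨S, hS, K, hK, rfl⟩ ⟨T, hT, L, hL, rfl⟩
    exact ⟨S + T, add_mem hS hT, K + L, hK.add hL, by abel⟩
  algebraMap_mem' := fun c =>
    ⟨algebraMap ℂ _ c, Subalgebra.algebraMap_mem _ c, 0, isCompactOperator_zero, by simp⟩

end NestAlgebras

/-! If `α_t = Ad u_t ∘ β_t` with `u_0 = 1` and `u'_0 = ih`, differentiation at `0` gives `δ_α = δ_β
+ ad (ih)` with equal domains, so it suffices to find the cocycle. Every `k ∈ 𝔅` generates one, the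
solution of `u' = u β_t(k)`, `u_0 = 1`; the problem is to find `k` and to prove that its cocycle
turns `β` into `α`.

The quotients `(α_s - β_s)/s` are bounded by hypothesis. Their weak operator limit along an
ultrafilter `s ↓ 0` is a bounded derivation `Δ : 𝔅 → B(H)`, and the rank one operators in `𝔅` force
`Δ = ad k` for a bounded `k` (`HasRankOnes.exists_eq_commutator`). Suppose `k ∈ 𝔅` and put `α'_t =
Ad u_t ∘ β_t`. Then `(α_s - α'_s)/s → 0` weakly along the ultrafilter. Rank one operators also make
each `α_t` weakly continuous at `0` on bounded sets (`HasRankOnes.tendstoWOT_aut`), so the matrix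
coefficients of `t ↦ α_t(α'_{T-t} b)` have vanishing right derivative along the ultrafilter. They
are therefore constant and `α = α'` (`AlgFlow.aut_eq_of_slope`).

It remains to see that `Δ` takes values in `𝔅` and that `k ∈ 𝔅`. For the nest algebra both are
short: it is weakly closed, and `(1-P)kP = (1-P)[k,P]P` for the projections `P` of the nest.

The quasi-triangular algebra need not be weakly closed, and both points need work. For `k`: an
operator whose commutators with the nest algebra are quasi-triangular cannot have infinitely many
large lower blocks in disjoint intervals of the nest. Locally it is thus nearly triangular,
Arveson's distance formula (through Parrott's theorem) corrects it with small norm, and norm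
closedness of the algebra finishes the argument. For `Δ`: each flow is uniformly continuous. The
operators `U_t x = α_t(x ⊗ e) e` intertwine, `α_t(b) U_t = U_t b`, and `U_t - 1` is strong-* null
and commutes asymptotically with the nest algebra; a gliding hump argument makes it norm null. The
generators are then everywhere defined, so `(α_s - β_s) b / s` converges in norm inside `𝔅`.

Local statements about a nest become global through `IsNest.induction_top`, which expresses order
compactness. -/

/-! ### Linear differential equations in Banach spaces -/

section LinearODE

variable {E : Type*} [NormedAddCommGroup E] [NormedSpace ℝ E]

/-- The Picard iterates of the linear differential equation `y' = L y`, `y 0 = y₀`: the series of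
these iterates is the solution. -/
noncomputable def picardTerm (L : ℝ → E →L[ℝ] E) (y₀ : E) : ℕ → ℝ → E
  | 0 => fun _ => y₀
  | n + 1 => fun t => ∫ s in (0 : ℝ)..t, L s (picardTerm L y₀ n s)

variable {L : ℝ → E →L[ℝ] E}

theorem picardTerm_continuous (hL : Continuous L) (y₀ : E) (n : ℕ) :
    Continuous (picardTerm L y₀ n) := by
  induction n with
  | zero => exact continuous_const
  | succ n ih =>
    have : Continuous fun s => L s (picardTerm L y₀ n s) := hL.clm_apply ih
    exact intervalIntegral.continuous_primitive (fun a b => this.intervalIntegrable a b) 0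

theorem picardTerm_hasDerivAt [CompleteSpace E] (hL : Continuous L) (y₀ : E) (n : ℕ) (t : ℝ) :
    HasDerivAt (picardTerm L y₀ (n + 1)) (L t (picardTerm L y₀ n t)) t := by
  have : Continuous fun s => L s (picardTerm L y₀ n s) :=
    hL.clm_apply (picardTerm_continuous hL y₀ n)
  exact intervalIntegral.integral_hasDerivAt_right (this.intervalIntegrable _ _)
    (this.stronglyMeasurableAtFilter _ _) this.continuousAt

theorem picardTerm_norm_le (hL : Continuous L) (y₀ : E) {T K : ℝ}
    (hK : ∀ t, |t| ≤ T → ‖L t‖ ≤ K) (n : ℕ) (t : ℝ) (ht : |t| ≤ T) :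
    ‖picardTerm L y₀ n t‖ ≤ ‖y₀‖ * ((K * |t|) ^ n / n.factorial) := by
  induction n generalizing t with
  | zero => simp [picardTerm]
  | succ n ih =>
    have hc : Continuous fun s => L s (picardTerm L y₀ n s) :=
      hL.clm_apply (picardTerm_continuous hL y₀ n)
    have hK0 : 0 ≤ K := (norm_nonneg _).trans (hK t ht)
    calc ‖picardTerm L y₀ (n + 1) t‖
        ≤ ∫ s in Set.uIoc 0 t, ‖L s (picardTerm L y₀ n s)‖ :=
          intervalIntegral.norm_integral_le_integral_norm_uIoc
      _ ≤ ∫ s in Set.uIoc 0 t, (‖y₀‖ * K ^ (n + 1) / n.factorial) * |s - 0| ^ n := by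
          refine MeasureTheory.setIntegral_mono_on ?_ ?_ measurableSet_uIoc fun s hs => ?_
          · exact (hc.norm.intervalIntegrable 0 t).def'
          · exact ((by fun_prop : Continuous fun s : ℝ =>
              (‖y₀‖ * K ^ (n + 1) / n.factorial) * |s - 0| ^ n).intervalIntegrable 0 t).def'
          · have hst : |s| ≤ |t| := by
              have := Set.abs_sub_left_of_mem_uIcc (Set.uIoc_subset_uIcc hs)
              simpa using this
            have hsT := hst.trans ht
            calc ‖L s (picardTerm L y₀ n s)‖ ≤ ‖L s‖ * ‖picardTerm L y₀ n s‖ :=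
                  (L s).le_opNorm _
              _ ≤ K * (‖y₀‖ * ((K * |s|) ^ n / n.factorial)) :=
                  mul_le_mul (hK s hsT) (ih s hsT) (norm_nonneg _) hK0
              _ = _ := by rw [sub_zero]; ring
      _ = ‖y₀‖ * ((K * |t|) ^ (n + 1) / (n + 1).factorial) := by
          rw [MeasureTheory.integral_const_mul, integral_pow_abs_sub_uIoc, sub_zero,
            Nat.factorial_succ]
          push_cast
          have : (n.factorial : ℝ) ≠ 0 := by positivity
          have : (n + 1 : ℝ) ≠ 0 := by positivity
          field_simp
          ring

theorem exists_bound_of_continuous (hL : Continuous L) (T : ℝ) :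
    ∃ K, ∀ t, |t| ≤ T → ‖L t‖ ≤ K := by
  obtain ⟨K, hK⟩ := (isCompact_Icc (a := -T) (b := T)).exists_bound_of_continuousOn
    hL.continuousOn
  exact ⟨K, fun t ht => hK t (abs_le.1 ht)⟩

/-- A linear differential equation with continuous coefficients in a Banach space has a solution
on the whole real line. -/
theorem exists_linearODE_solution [CompleteSpace E] (hL : Continuous L) (y₀ : E) :
    ∃ y : ℝ → E, y 0 = y₀ ∧ ∀ t, HasDerivAt y (L t (y t)) t := by
  refine ⟨fun t => ∑' n, picardTerm L y₀ n t, ?_, fun t => ?_⟩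
  · refine (tsum_eq_single 0 ?_).trans ?_
    · rintro (_ | n) hn
      · exact absurd rfl hn
      · simp [picardTerm]
    · rfl
  -- Termwise differentiation needs a summable bound on an open interval around `t` that also
  -- contains `0`; hence the radius `|t| + 1`.
  · obtain ⟨K, hK⟩ := exists_bound_of_continuous hL (|t| + 1)
    have hK0 : 0 ≤ K := (norm_nonneg _).trans (hK t (by linarith))
    set T := |t| + 1 with hT
    have hT0 : 0 ≤ T := by positivity
    have hsum : Summable fun n : ℕ => ‖y₀‖ * ((K * T) ^ n / n.factorial) :=
      (Real.summable_pow_div_factorial _).mul_left _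
    have hb : ∀ n : ℕ, ∀ s ∈ Set.Ioo (-T) T,
        ‖picardTerm L y₀ n s‖ ≤ ‖y₀‖ * ((K * T) ^ n / n.factorial) := fun n s hs => by
      have hs' : |s| ≤ T := (abs_lt.2 hs).le
      refine (picardTerm_norm_le hL y₀ hK n s hs').trans ?_
      gcongr
    have ht : t ∈ Set.Ioo (-T) T := abs_lt.1 (by linarith)
    have hs : ∀ s ∈ Set.Ioo (-T) T, Summable fun n => picardTerm L y₀ n s := fun s hs =>
      .of_norm_bounded hsum fun n => hb n s hs
    have key := hasDerivAt_tsum_of_isPreconnected (g := fun n s => picardTerm L y₀ (n + 1) s)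
      (g' := fun n s => L s (picardTerm L y₀ n s)) (hsum.mul_left K) isOpen_Ioo isPreconnected_Ioo
      (fun n s _ => picardTerm_hasDerivAt hL y₀ n s)
      (fun n s hs => ((L s).le_opNorm _).trans
        (mul_le_mul (hK s (abs_lt.2 hs).le) (hb n s hs) (norm_nonneg _) hK0)) ht
      ((summable_nat_add_iff 1).2 (hs t ht)) ht
    have h2 : HasDerivAt (fun s => y₀ + ∑' n, picardTerm L y₀ (n + 1) s)
        (L t (∑' n, picardTerm L y₀ n t)) t := by
      rw [(L t).map_tsum (hs t ht)]
      exact key.const_add y₀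
    refine h2.congr_of_eventuallyEq ?_
    filter_upwards [isOpen_Ioo.mem_nhds ht] with s hs'
    rw [(hs s hs').tsum_eq_zero_add]
    rfl

theorem linearODE_solution_unique (hL : Continuous L) {y z : ℝ → E}
    (hy : ∀ t, HasDerivAt y (L t (y t)) t) (hz : ∀ t, HasDerivAt z (L t (z t)) t)
    (h0 : y 0 = z 0) : y = z := by
  funext t
  obtain ⟨K, hK⟩ := exists_bound_of_continuous hL (|t| + 1)
  have hK0 : 0 ≤ K := (norm_nonneg _).trans (hK t (by linarith))
  have := ODE_solution_unique_of_mem_Ioo (v := fun t x => L t x) (s := fun _ => Set.univ)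
    (K := K.toNNReal) (a := -(|t| + 1)) (b := |t| + 1) (t₀ := 0) (f := y) (g := z)
    (fun s hs => ((L s).lipschitz.weaken (by
      rw [← NNReal.coe_le_coe, Real.coe_toNNReal _ hK0]
      exact hK s (abs_lt.2 hs).le)).lipschitzOnWith)
    (by constructor <;> have := abs_nonneg t <;> linarith)
    (fun s _ => ⟨hy s, trivial⟩) (fun s _ => ⟨hz s, trivial⟩) h0
  exact this (abs_lt.1 (by linarith))

end LinearODE

/-! ### Differentiable cocycles and the perturbations they define -/

section Cocycle

variable {A : Type*} [NormedRing A] [NormedAlgebra ℂ A]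

/-- The fundamental solution of `u' = u a` in a Banach algebra, for continuous `a`. -/
theorem exists_units_hasDerivAt_mul [CompleteSpace A] {a : ℝ → A} (ha : Continuous a) :
    ∃ u : ℝ → Aˣ, u 0 = 1 ∧ (∀ t, HasDerivAt (fun s => (u s : A)) (u t * a t) t) ∧
      ∀ t, HasDerivAt (fun s => ((u s)⁻¹ : Aˣ).1) (-(a t * ((u t)⁻¹ : Aˣ))) t := by
  have hR : Continuous fun t => (ContinuousLinearMap.mul ℝ A).flip (a t) :=
    (ContinuousLinearMap.continuous _).comp ha
  have hLm : Continuous fun t => (ContinuousLinearMap.mul ℝ A) (-a t) :=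
    (ContinuousLinearMap.continuous _).comp ha.neg
  obtain ⟨u, hu0, hu⟩ := exists_linearODE_solution hR (1 : A)
  obtain ⟨v, hv0, hv⟩ := exists_linearODE_solution hLm (1 : A)
  simp only [ContinuousLinearMap.flip_apply, ContinuousLinearMap.mul_apply'] at hu hv
  have huv : ∀ t, u t * v t = 1 := fun t => by
    have hd : ∀ t, HasDerivAt (fun s => u s * v s) 0 t := fun t => by
      refine ((hu t).fun_mul (hv t)).congr_deriv ?_
      rw [neg_mul, mul_neg, mul_assoc, add_neg_cancel]
    have := is_const_of_deriv_eq_zero (fun t => (hd t).differentiableAt)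
      (fun t => (hd t).deriv) t 0
    simpa [hu0, hv0] using this
  -- The derivative of `v u` is not visibly zero. But `v u` solves `w' = w a - a w`, as does the
  -- constant `1`, and the initial values agree.
  have hvu : ∀ t, v t * u t = 1 := fun t => by
    have hM : Continuous fun t => (ContinuousLinearMap.mul ℝ A).flip (a t)
        - (ContinuousLinearMap.mul ℝ A) (a t) :=
      hR.sub ((ContinuousLinearMap.continuous _).comp ha)
    have := linearODE_solution_unique hM (y := fun s => v s * u s) (z := fun _ => 1)
      (fun t => by
        refine ((hv t).fun_mul (hu t)).congr_deriv ?_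
        simp only [sub_apply, ContinuousLinearMap.flip_apply, ContinuousLinearMap.mul_apply']
        noncomm_ring)
      (fun t => by simpa using hasDerivAt_const t (1 : A)) (by simp [hu0, hv0])
    exact congrFun this t
  refine ⟨fun t => ⟨u t, v t, huv t, hvu t⟩, Units.ext hu0, hu, fun t => ?_⟩
  simpa using hv t

namespace AlgFlow

@[simp] theorem aut_zero_apply (β : AlgFlow A) (b : A) : β.aut 0 b = b := by
  refine (β.aut 0).injective ?_
  have := β.aut_add 0 0 b
  rw [add_zero] at this
  exact this.symm

theorem op_add (β : AlgFlow A) (s t : ℝ) : β.op (s + t) = (β.op s).comp (β.op t) :=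
  ContinuousLinearMap.ext fun b => β.aut_add s t b

/-- Every element `k` of a Banach algebra integrates to a differentiable cocycle of a flow. -/
theorem exists_cocycle [CompleteSpace A] (β : AlgFlow A) (k : A) :
    ∃ u : ℝ → Aˣ, u 0 = 1 ∧ β.IsCocycle u ∧ IsDifferentiableFamily u k := by
  obtain ⟨u, hu0, hu, hv⟩ := exists_units_hasDerivAt_mul (β.continuous_aut k)
  have hdiff : Differentiable ℝ fun t => (u t : A) := fun t => (hu t).differentiableAt
  refine ⟨u, hu0, ⟨hdiff.continuous, fun s t => ?_⟩, hdiff, ?_⟩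
  · have hβ : ∀ t, HasDerivAt (fun t => (u s : A) * β.aut s (u t))
        ((u s : A) * β.aut s (u t) * β.aut (s + t) k) t := fun t => by
      have h1 : HasDerivAt (fun t => β.aut s (u t)) (β.aut s (u t * β.aut t k)) t :=
        ((β.op s).restrictScalars ℝ).hasFDerivAt.comp_hasDerivAt t (hu t)
      convert h1.const_mul (u s : A) using 1
      rw [map_mul, β.aut_add, mul_assoc]
    have hw : ∀ t, HasDerivAt (fun t => ((u (s + t))⁻¹ : Aˣ).1)
        (-(β.aut (s + t) k * ((u (s + t))⁻¹ : Aˣ))) t := fun t =>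
      HasDerivAt.comp_const_add s t (hv (s + t))
    -- In `t`, both `u_s β_s(u_t)` and `u_{s+t}` solve `w' = w β_{s+t}(k)`, so the first times the
    -- inverse of the second is constant.
    have hd : ∀ t, HasDerivAt
        (fun t => (u s : A) * β.aut s (u t) * ((u (s + t))⁻¹ : Aˣ).1) 0 t := fun t => by
      refine ((hβ t).fun_mul (hw t)).congr_deriv ?_
      rw [mul_neg, mul_assoc _ (β.aut (s + t) k), add_neg_cancel]
    have := is_const_of_deriv_eq_zero (fun t => (hd t).differentiableAt)
      (fun t => (hd t).deriv) t 0
    simp only [hu0, Units.val_one, map_one, mul_one, add_zero, Units.mul_inv] at this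
    rwa [Units.mul_inv_eq_one] at this
  · have := hu 0
    simpa [hu0] using this

/-- The difference quotient of a derivative, with complex scalars. -/
theorem tendsto_slope_zero_complex {f : ℝ → A} {f' : A} (h : HasDerivAt f f' 0) :
    Tendsto (fun t : ℝ => ((t : ℂ)⁻¹) • (f t - f 0)) (𝓝[≠] 0) (𝓝 f') := by
  have := h.tendsto_slope_zero
  refine this.congr fun t => ?_
  rw [zero_add, ← Complex.ofReal_inv, Complex.coe_smul]

theorem hasDerivAt_inv_of_units [CompleteSpace A] {u : ℝ → Aˣ} {k : A} (hu0 : u 0 = 1)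
    (hu : HasDerivAt (fun t => (u t : A)) k 0) :
    HasDerivAt (fun t => ((u t)⁻¹ : Aˣ).1) (-k) 0 := by
  have h1 := hasFDerivAt_ringInverse (𝕜 := ℝ) (u 0)
  have h2 := HasFDerivAt.comp_hasDerivAt (0 : ℝ) h1 hu
  refine (h2.congr_deriv ?_).congr_of_eventuallyEq (.of_forall fun t => ?_)
  · simp [hu0]
  · simp

/-- Product rule for `u_t β_t(b) u_t⁻¹`. Only the difference of the two quotients is claimed to
converge, so `b` need not lie in either domain. This yields both inclusions of domains, and later a
comparison valid on the whole algebra. -/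
theorem hasGen_add_of_isAdPerturbationBy {α β : AlgFlow A} {u : ℝ → Aˣ} {k : A}
    (hu0 : u 0 = 1) (hu : HasDerivAt (fun t => (u t : A)) k 0)
    (hv : HasDerivAt (fun t => ((u t)⁻¹ : Aˣ).1) (-k) 0) (h : α.IsAdPerturbationBy β u) (b : A) :
    Tendsto (fun t : ℝ => ((t : ℂ)⁻¹) • (α.aut t b - b) - ((t : ℂ)⁻¹) • (β.aut t b - b))
      (𝓝[≠] 0) (𝓝 (k * b - b * k)) := by
  have h1 := tendsto_slope_zero_complex hu
  have h2 := tendsto_slope_zero_complex hv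
  simp only [hu0, inv_one, Units.val_one] at h1 h2
  have hb : Tendsto (fun t => β.aut t b) (𝓝[≠] 0) (𝓝 b) := by
    have := (β.continuous_aut b).tendsto 0
    rw [aut_zero_apply] at this
    exact this.mono_left nhdsWithin_le_nhds
  have hvc : Tendsto (fun t => ((u t)⁻¹ : Aˣ).1) (𝓝[≠] 0) (𝓝 1) := by
    have := hv.continuousAt.tendsto
    simp only [hu0, inv_one, Units.val_one] at this
    exact this.mono_left nhdsWithin_le_nhds
  have := ((h1.mul hb).mul hvc).add (hb.mul h2)
  simp only [mul_one, mul_neg, ← sub_eq_add_neg] at this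
  refine this.congr fun t => ?_
  rw [h t b, ← smul_sub]
  simp only [smul_mul_assoc, mul_smul_comm, ← smul_add]
  congr 1
  noncomm_ring

theorem HasGen.add_of_tendsto_sub {α β : AlgFlow A} {b c a : A}
    (h : Tendsto (fun t : ℝ => ((t : ℂ)⁻¹) • (α.aut t b - b) - ((t : ℂ)⁻¹) • (β.aut t b - b))
      (𝓝[≠] 0) (𝓝 c)) (hb : β.HasGen b a) : α.HasGen b (a + c) :=
  (Tendsto.add hb h).congr fun t => by abel

/-- If `α_t = Ad u_t ∘ β_t` with a family `u` having derivative `i h` at `0`, then `α` is the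
inner perturbation of `β` by `h`. -/
theorem IsAdPerturbationBy.isInnerPerturbationBy [CompleteSpace A] {α β : AlgFlow A} {u : ℝ → Aˣ} {h : A}
    (hu0 : u 0 = 1) (hu : HasDerivAt (fun t => (u t : A)) (Complex.I • h) 0)
    (H : α.IsAdPerturbationBy β u) : α.IsInnerPerturbationBy β h := by
  have hv := hasDerivAt_inv_of_units hu0 hu
  have key := hasGen_add_of_isAdPerturbationBy hu0 hu hv H
  have hab : ∀ b a, β.HasGen b a →
      α.HasGen b (a + ((Complex.I • h) * b - b * (Complex.I • h))) := fun b a hb =>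
    hb.add_of_tendsto_sub (key b)
  have hba : ∀ b a, α.HasGen b a →
      β.HasGen b (a + -((Complex.I • h) * b - b * (Complex.I • h))) := fun b a hb =>
    hb.add_of_tendsto_sub ((key b).neg.congr fun t => by abel)
  refine ⟨le_antisymm (fun b ⟨a, hb⟩ => ⟨_, hba b a hb⟩) (fun b ⟨a, hb⟩ => ⟨_, hab b a hb⟩),
    fun b hα hβ => ?_⟩
  refine (α.hasGen_generator ⟨b, hα⟩).unique ?_
  convert hab b _ (β.hasGen_generator ⟨b, hβ⟩) using 2
  rw [smul_mul_assoc, mul_smul_comm, ← smul_sub]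

end AlgFlow

end Cocycle

/-! ### Weak operator limits and their compactness -/

section WOT

variable {H : Type*} [NormedAddCommGroup H] [InnerProductSpace ℂ H]

/-- Convergence of a family of operators in the weak operator topology. -/
def TendstoWOT {ι : Type*} (f : ι → H →L[ℂ] H) (l : Filter ι) (T : H →L[ℂ] H) : Prop :=
  ∀ x y : H, Tendsto (fun i => inner ℂ (f i x) y) l (𝓝 (inner ℂ (T x) y))

namespace TendstoWOT

variable {ι : Type*} {l : Filter ι} {f g : ι → H →L[ℂ] H} {S T : H →L[ℂ] H}

theorem unique [l.NeBot] (hS : TendstoWOT f l S) (hT : TendstoWOT f l T) : S = T :=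
  ContinuousLinearMap.ext fun x => ext_inner_right ℂ fun y =>
    tendsto_nhds_unique (hS x y) (hT x y)

theorem of_tendsto (h : Tendsto f l (𝓝 T)) : TendstoWOT f l T := fun x y => by
  have hx : Tendsto (fun i => f i x) l (𝓝 (T x)) :=
    ((ContinuousLinearMap.apply ℂ H x).continuous.tendsto T).comp h
  exact hx.inner tendsto_const_nhds

theorem congr' (h : TendstoWOT f l T) (hfg : f =ᶠ[l] g) : TendstoWOT g l T := fun x y =>
  (h x y).congr' (hfg.mono fun i hi => by rw [hi])

theorem add (hf : TendstoWOT f l S) (hg : TendstoWOT g l T) :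
    TendstoWOT (fun i => f i + g i) l (S + T) := fun x y => by
  simpa only [add_apply, inner_add_left] using (hf x y).add (hg x y)

theorem sub (hf : TendstoWOT f l S) (hg : TendstoWOT g l T) :
    TendstoWOT (fun i => f i - g i) l (S - T) := fun x y => by
  simpa only [sub_apply, inner_sub_left] using (hf x y).sub (hg x y)

theorem const_smul (c : ℂ) (hf : TendstoWOT f l S) :
    TendstoWOT (fun i => c • f i) l (c • S) := fun x y => by
  simpa only [smul_apply, inner_smul_left] using (hf x y).const_mul _

theorem mul_const (hf : TendstoWOT f l S) (A : H →L[ℂ] H) :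
    TendstoWOT (fun i => f i * A) l (S * A) := fun x y => hf (A x) y

theorem const_mul [CompleteSpace H] (hf : TendstoWOT f l S) (A : H →L[ℂ] H) :
    TendstoWOT (fun i => A * f i) l (A * S) := fun x y => by
  simpa only [mul_apply_eq_comp, ContinuousLinearMap.adjoint_inner_right] using
    hf x (ContinuousLinearMap.adjoint A y)

/-- Multiplication is not jointly continuous in the weak operator topology. One bounded weakly
convergent factor and one norm convergent factor suffice for passing to the limit in the Leibniz
rule. -/
theorem mul_tendsto {C : ℝ} (hf : TendstoWOT f l S) (hC : ∀ᶠ i in l, ‖f i‖ ≤ C)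
    (hg : Tendsto g l (𝓝 T)) : TendstoWOT (fun i => f i * g i) l (S * T) := by
  have h0 : Tendsto (fun i => f i * (g i - T)) l (𝓝 0) := by
    have hg' : Tendsto (fun i => C * ‖g i - T‖) l (𝓝 0) := by
      simpa using (tendsto_iff_norm_sub_tendsto_zero.1 hg).const_mul C
    refine squeeze_zero_norm' (hC.mono fun i hi => (norm_mul_le _ _).trans ?_) hg'
    gcongr
  simpa [mul_sub] using (of_tendsto h0).add (hf.mul_const T)

theorem norm_le {C : ℝ} [l.NeBot] (hf : TendstoWOT f l T) (hC : ∀ᶠ i in l, ‖f i‖ ≤ C) :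
    ‖T‖ ≤ C := by
  have hC0 : 0 ≤ C := by
    obtain ⟨i, hi⟩ := hC.exists
    exact (norm_nonneg _).trans hi
  refine T.opNorm_le_bound hC0 fun x => ?_
  have h1 : ‖(inner ℂ (T x) (T x) : ℂ)‖ ≤ C * ‖x‖ * ‖T x‖ := by
    refine le_of_tendsto (hf x (T x)).norm (hC.mono fun i hi => ?_)
    refine (norm_inner_le_norm _ _).trans ?_
    gcongr
    exact (f i).le_of_opNorm_le hi x
  rw [inner_self_eq_norm_sq_to_K] at h1
  rcases (norm_nonneg (T x)).eq_or_lt with h0 | h0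
  · rw [← h0]; positivity
  · refine le_of_mul_le_mul_right ?_ h0
    simpa [sq] using h1

end TendstoWOT

/-- Bounded families of operators have limits in the weak operator topology along ultrafilters. -/
theorem exists_tendstoWOT [CompleteSpace H] {ι : Type*} (U : Ultrafilter ι)
    {f : ι → H →L[ℂ] H} {C : ℝ} (hC : ∀ᶠ i in U, ‖f i‖ ≤ C) :
    ∃ T : H →L[ℂ] H, ‖T‖ ≤ C ∧ TendstoWOT f U T := by
  have hlim : ∀ x y : H, ∃ z : ℂ, Tendsto (fun i => inner ℂ (f i x) y) U (𝓝 z) ∧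
      ‖z‖ ≤ C * ‖x‖ * ‖y‖ := fun x y => by
    have hb : ∀ᶠ i in U, inner ℂ (f i x) y ∈ Metric.closedBall (0 : ℂ) (C * ‖x‖ * ‖y‖) :=
      hC.mono fun i hi => by
        rw [mem_closedBall_zero_iff]
        refine (norm_inner_le_norm _ _).trans ?_
        gcongr
        exact (f i).le_of_opNorm_le hi x
    obtain ⟨z, hz, hz'⟩ := (isCompact_closedBall (0 : ℂ) (C * ‖x‖ * ‖y‖)).ultrafilter_le_nhds
      (U.map fun i => inner ℂ (f i x) y) (le_principal_iff.2 hb)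
    exact ⟨z, hz', mem_closedBall_zero_iff.1 hz⟩
  choose B hB hBn using hlim
  let B' : H →L⋆[ℂ] H →L[ℂ] ℂ := LinearMap.mkContinuous₂
    (LinearMap.mk₂'ₛₗ (starRingEnd ℂ) (RingHom.id ℂ) B
      (fun x x' y => tendsto_nhds_unique (hB _ _) (by
        simpa only [map_add, inner_add_left] using (hB x y).add (hB x' y)))
      (fun c x y => tendsto_nhds_unique (hB _ _) (by
        simpa only [map_smul, inner_smul_left, smul_eq_mul] using (hB x y).const_mul _))
      (fun x y y' => tendsto_nhds_unique (hB _ _) (by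
        simpa only [inner_add_right] using (hB x y).add (hB x y')))
      (fun c x y => tendsto_nhds_unique (hB _ _) (by
        simpa only [inner_smul_right, smul_eq_mul, RingHom.id_apply] using
          (hB x y).const_mul c))) C hBn
  have hT : TendstoWOT f U (InnerProductSpace.continuousLinearMapOfBilin B') := fun x y => by
    rw [InnerProductSpace.continuousLinearMapOfBilin_apply]
    exact hB x y
  exact ⟨_, hT.norm_le hC, hT⟩

end WOT

/-! ### The limit derivation of two flows at distance `O(t)` -/

section LimitDerivation

variable {H : Type*} [NormedAddCommGroup H] [InnerProductSpace ℂ H]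
  {𝔅 : Subalgebra ℂ (H →L[ℂ] H)}

namespace AlgFlow

/-- The difference quotient `(α_s b - β_s b) / s`. -/
noncomputable def diffQuot (α β : AlgFlow 𝔅) (s : ℝ) (b : 𝔅) : 𝔅 :=
  ((s : ℂ)⁻¹) • (α.aut s b - β.aut s b)

theorem norm_diffQuot_le {α β : AlgFlow 𝔅} {C s : ℝ} (hs : ‖α.op s - β.op s‖ ≤ C * |s|)
    (hC : 0 ≤ C) (b : 𝔅) : ‖diffQuot α β s b‖ ≤ C * ‖b‖ := by
  have h1 : ‖α.aut s b - β.aut s b‖ ≤ C * |s| * ‖b‖ := (α.op s - β.op s).le_of_opNorm_le hs b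
  change ‖((s : ℂ)⁻¹) • ((α.aut s b - β.aut s b : 𝔅) : H →L[ℂ] H)‖ ≤ _
  rw [norm_smul, norm_inv, Complex.norm_real, Real.norm_eq_abs]
  change |s|⁻¹ * ‖α.aut s b - β.aut s b‖ ≤ _
  rcases eq_or_ne s 0 with rfl | h0
  · simp; positivity
  · have : 0 < |s| := abs_pos.2 h0
    rw [inv_mul_le_iff₀ this]
    linarith

theorem tendsto_aut (α : AlgFlow 𝔅) {l : Filter ℝ} (hl : l ≤ 𝓝 0) (b : 𝔅) :
    Tendsto (fun s => α.aut s b) l (𝓝 b) := by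
  have := (α.continuous_aut b).tendsto 0
  rw [aut_zero_apply] at this
  exact this.mono_left hl

/-- If `‖α_s - β_s‖ = O(s)`, then the difference quotients `(α_s - β_s) / s` converge pointwise in
the weak operator topology along ultrafilters tending to `0`, and the limit is a bounded
derivation. -/
theorem exists_limit_derivation [CompleteSpace H] (α β : AlgFlow 𝔅) (U : Ultrafilter ℝ)
    (hU : (U : Filter ℝ) ≤ 𝓝 0) {C : ℝ} (hC : 0 ≤ C)
    (h : ∀ᶠ s in (U : Filter ℝ), ‖α.op s - β.op s‖ ≤ C * |s|) :
    ∃ Δ : 𝔅 →ₗ[ℂ] (H →L[ℂ] H), (∀ b, ‖Δ b‖ ≤ C * ‖b‖) ∧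
      (∀ b, TendstoWOT (fun s => (diffQuot α β s b : H →L[ℂ] H)) U (Δ b)) ∧
      ∀ b c : 𝔅, Δ (b * c) = Δ b * c + b * Δ c := by
  have hb : ∀ b : 𝔅, ∀ᶠ s in (U : Filter ℝ), ‖(diffQuot α β s b : H →L[ℂ] H)‖ ≤ C * ‖b‖ :=
    fun b => h.mono fun s hs => norm_diffQuot_le hs hC b
  choose Δ hΔn hΔ using fun b => exists_tendstoWOT U (hb b)
  refine ⟨⟨⟨Δ, fun b c => ?_⟩, fun a b => ?_⟩, hΔn, hΔ, fun b c => ?_⟩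
  · refine (hΔ _).unique (((hΔ b).add (hΔ c)).congr' (.of_forall fun s => ?_))
    simp only [diffQuot, map_add, ← Subalgebra.coe_add, ← smul_add]
    congr 2
    abel
  · refine (hΔ _).unique (((hΔ b).const_smul a).congr' (.of_forall fun s => ?_))
    simp only [diffQuot, map_smul, ← Subalgebra.coe_smul, ← smul_sub, smul_comm a]
  · have hα : Tendsto (fun s => (α.aut s c : H →L[ℂ] H)) U (𝓝 c) :=
      (continuous_subtype_val.tendsto c).comp (α.tendsto_aut hU c)
    have hβ : Tendsto (fun s => (β.aut s b : H →L[ℂ] H) - b) U (𝓝 0) := by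
      rw [← sub_self (b : H →L[ℂ] H)]
      exact ((continuous_subtype_val.tendsto b).comp (β.tendsto_aut hU b)).sub_const _
    -- With `D_s = (α_s - β_s)/s`, multiplicativity gives `D_s(bc) = D_s(b) α_s(c) + b D_s(c) +
    -- (β_s(b) - b) D_s(c)`, and the last summand tends to zero in norm.
    have h1 := (hΔ b).mul_tendsto (hb b) hα
    have h2 := (hΔ c).const_mul (b : H →L[ℂ] H)
    have h3 : Tendsto (fun s => ((β.aut s b : H →L[ℂ] H) - b) * (diffQuot α β s c : H →L[ℂ] H))
        U (𝓝 0) := by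
      refine squeeze_zero_norm' ((hb c).mono fun s hs => (norm_mul_le _ _).trans
        (mul_le_mul_of_nonneg_left hs (norm_nonneg _))) ?_
      simpa using hβ.norm.mul_const (C * ‖c‖)
    have h4 := (h1.add h2).add (.of_tendsto h3)
    rw [add_zero] at h4
    refine (hΔ _).unique (h4.congr' (.of_forall fun s => ?_))
    simp only [diffQuot, map_mul, Subalgebra.coe_smul, Subalgebra.coe_mul, Subalgebra.coe_sub,
      smul_mul_assoc, mul_smul_comm, sub_mul, mul_sub, ← smul_add]
    congr 1
    abel

end AlgFlow

end LimitDerivation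

/-! ### Derivations and automorphisms of algebras with rank one operators -/

section RankOne

variable {H : Type*} [NormedAddCommGroup H] [InnerProductSpace ℂ H]

open InnerProductSpace

/-- The orthogonal projection onto the closure of a subspace. -/
noncomputable def closureProj [CompleteSpace H] (M : Submodule ℂ H) : H →L[ℂ] H :=
  M.topologicalClosure.starProjection

theorem closureProj_apply_of_mem [CompleteSpace H] {M : Submodule ℂ H} {x : H} (hx : x ∈ M) :
    closureProj M x = x :=
  Submodule.starProjection_eq_self_iff.2 (M.le_topologicalClosure hx)

theorem closureProj_apply_mem [CompleteSpace H] {M : Submodule ℂ H} (hM : IsClosed (M : Set H))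
    (x : H) : closureProj M x ∈ M := by
  have := M.topologicalClosure.starProjection_apply_mem x
  exact hM.submodule_topologicalClosure_eq.le this

theorem norm_closureProj_le [CompleteSpace H] (M : Submodule ℂ H) : ‖closureProj M‖ ≤ 1 :=
  Submodule.starProjection_norm_le _

/-- An operator algebra with enough rank one operators: an increasing family of invariant
subspaces `M`, with dense union, each of which carries all the operators `x ⊗ y` with `x ∈ M` for
some fixed unit vector `y`, and in addition rank one operators annihilating any given proper
closed invariant subspace. -/
structure HasRankOnes (𝔅 : Subalgebra ℂ (H →L[ℂ] H)) (𝓜 : Set (Submodule ℂ H)) : Prop where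
  nonempty : 𝓜.Nonempty
  isChain : IsChain (· ≤ ·) 𝓜
  isClosed : ∀ M ∈ 𝓜, IsClosed (M : Set H)
  dense : Dense {x : H | ∃ M ∈ 𝓜, x ∈ M}
  invariant : ∀ M ∈ 𝓜, ∀ b ∈ 𝔅, ∀ x ∈ M, b x ∈ M
  exists_rankOne : ∀ M ∈ 𝓜, ∃ y : H, ‖y‖ = 1 ∧ ∀ x ∈ M, rankOne ℂ x y ∈ 𝔅
  exists_annihilator : ∀ L : Submodule ℂ H, IsClosed (L : Set H) → L ≠ ⊤ →
    (∀ b ∈ 𝔅, ∀ x ∈ L, b x ∈ L) → ∃ x y : H, x ≠ 0 ∧ y ≠ 0 ∧ y ∈ Lᗮ ∧ rankOne ℂ x y ∈ 𝔅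

variable {𝔅 : Subalgebra ℂ (H →L[ℂ] H)} {𝓜 : Set (Submodule ℂ H)}

/-- Bounded derivations of an operator algebra with enough rank one operators are implemented by
bounded operators. -/
theorem HasRankOnes.exists_eq_commutator [CompleteSpace H] (h𝓜 : HasRankOnes 𝔅 𝓜)
    {Δ : 𝔅 →ₗ[ℂ] (H →L[ℂ] H)} {C : ℝ} (hC : 0 ≤ C) (hΔC : ∀ b, ‖Δ b‖ ≤ C * ‖b‖)
    (hΔ : ∀ b c : 𝔅, Δ (b * c) = Δ b * c + b * Δ c) :
    ∃ k : H →L[ℂ] H, ∀ b : 𝔅, Δ b = k * b - b * k := by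
  choose y hy1 hy using h𝓜.exists_rankOne
  let R (M : 𝓜) (x : H) : 𝔅 := ⟨rankOne ℂ (closureProj M.1 x) (y M.1 M.2),
    hy M.1 M.2 _ (closureProj_apply_mem (h𝓜.isClosed M.1 M.2) x)⟩
  have hRn : ∀ M x, ‖R M x‖ ≤ ‖x‖ := fun M x => by
    change ‖rankOne ℂ (closureProj M.1 x) (y M.1 M.2)‖ ≤ ‖x‖
    rw [norm_rankOne, hy1, mul_one]
    exact ((closureProj M.1).le_of_opNorm_le (norm_closureProj_le _) x).trans (by simp)
  -- If `Δ = ad k`, then evaluating `Δ(x ⊗ y)` at the unit vector `y` gives `k x` up to a term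
  -- proportional to `x`. This suggests the definition; the projection onto `M` extends it to all of
  -- `H`.
  let T (M : 𝓜) : H →L[ℂ] H := LinearMap.mkContinuous
    { toFun := fun x => Δ (R M x) (y M.1 M.2)
      map_add' := fun x x' => by
        have : R M (x + x') = R M x + R M x' := Subtype.ext (by simp [R])
        rw [this, map_add, add_apply]
      map_smul' := fun c x => by
        have : R M (c • x) = c • R M x := Subtype.ext (by simp [R])
        rw [this, map_smul, smul_apply, RingHom.id_apply] } C (fun x => by
    refine ((Δ (R M x)).le_opNorm _).trans ?_
    rw [hy1, mul_one]
    exact (hΔC _).trans (mul_le_mul_of_nonneg_left (hRn M x) hC))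
  have hTn : ∀ M, ‖T M‖ ≤ C := fun M => LinearMap.mkContinuous_norm_le _ hC _
  have hTb : ∀ (M : 𝓜) (b : 𝔅) (x : H), x ∈ M.1 →
      T M ((b : H →L[ℂ] H) x) = Δ b x + (b : H →L[ℂ] H) (T M x) := fun M b x hx => by
    have h1 : R M ((b : H →L[ℂ] H) x) = b * R M x := Subtype.ext (by
      ext z
      simp only [R, Subalgebra.coe_mul, mul_apply_eq_comp, rankOne_apply, map_smul,
        closureProj_apply_of_mem hx,
        closureProj_apply_of_mem (h𝓜.invariant M.1 M.2 b b.2 x hx)])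
    change Δ (R M ((b : H →L[ℂ] H) x)) (y M.1 M.2) = _
    rw [h1, hΔ, add_apply]
    congr 1
    simp only [R, mul_apply_eq_comp, rankOne_apply, closureProj_apply_of_mem hx,
      inner_self_eq_norm_sq_to_K, hy1]
    simp
  have : Nonempty 𝓜 := h𝓜.nonempty.to_subtype
  have : IsDirectedOrder 𝓜 := directedOn_iff_isDirectedOrder.1 h𝓜.isChain.directedOn
  -- `T M` implements `Δ` only on vectors of `M`. A given vector of the dense union lies in all
  -- sufficiently large `M`, so the limit along increasing `M` implements `Δ` on that union.
  let U : Ultrafilter 𝓜 := Ultrafilter.of atTop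
  have hUle : (U : Filter 𝓜) ≤ atTop := Ultrafilter.of_le _
  obtain ⟨k, -, hk⟩ := exists_tendstoWOT U (f := T) (.of_forall hTn)
  refine ⟨k, fun b => ?_⟩
  have hd : ∀ x, (∃ M ∈ 𝓜, x ∈ M) → Δ b x = (k * b - b * k) x := fun x ⟨M, hM, hx⟩ => by
    refine ext_inner_right ℂ fun z => tendsto_nhds_unique
      (l := (U : Filter 𝓜)) (f := fun _ => inner ℂ (Δ b x) z) tendsto_const_nhds ?_
    refine (((hk.mul_const b).sub (hk.const_mul b)) x z).congr' ?_
    filter_upwards [hUle (eventually_ge_atTop (⟨M, hM⟩ : 𝓜))] with M' hM'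
    have := hTb M' b x (hM' hx)
    simp only [sub_apply, mul_apply_eq_comp, this, add_sub_cancel_right]
  refine ContinuousLinearMap.ext fun x => ?_
  exact congrFun ((Δ b).continuous.ext_on h𝓜.dense (k * b - b * k).continuous hd) x

/-- Automorphisms of an operator algebra with enough rank one operators are continuous at `0` on
bounded sets for the weak operator topology. -/
theorem HasRankOnes.tendstoWOT_aut [CompleteSpace H] (h𝓜 : HasRankOnes 𝔅 𝓜) (φ : 𝔅 ≃A[ℂ] 𝔅)
    {ι : Type*} {l : Filter ι} {f : ι → 𝔅} {C : ℝ} (hC : ∀ᶠ i in l, ‖f i‖ ≤ C)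
    (hf : TendstoWOT (fun i => (f i : H →L[ℂ] H)) l 0) :
    TendstoWOT (fun i => (φ (f i) : H →L[ℂ] H)) l 0 := by
  obtain ⟨K, hK0, hK⟩ : ∃ K, 0 ≤ K ∧ ∀ b, ‖φ b‖ ≤ K * ‖b‖ := by
    let φ' : 𝔅 →L[ℂ] 𝔅 := ⟨φ.toAlgEquiv.toLinearMap, φ.continuous⟩
    exact ⟨‖φ'‖, φ'.opNorm_nonneg, φ'.le_opNorm⟩
  choose y hy1 hy using h𝓜.exists_rankOne
  -- On vectors `φ(x ⊗ y) w` one has `φ(f_i) φ(x ⊗ y) w = φ(f_i x ⊗ y) w`, which depends on `f_i`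
  -- only through `f_i x`. It remains to show that such vectors span a dense subspace.
  let L₀ : Submodule ℂ H := Submodule.span ℂ {v | ∃ (M : Submodule ℂ H) (hM : M ∈ 𝓜) (x : H)
    (hx : x ∈ M) (w : H), v = (φ ⟨rankOne ℂ x (y M hM), hy M hM x hx⟩ : H →L[ℂ] H) w}
  have hinv : ∀ b ∈ 𝔅, ∀ v ∈ L₀, b v ∈ L₀ := fun b hb v hv => by
    induction hv using Submodule.span_induction with
    | zero => simp
    | add v w _ _ hv hw => rw [map_add]; exact add_mem hv hw
    | smul c v _ hv => rw [map_smul]; exact L₀.smul_mem c hv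
    | mem v hv =>
      obtain ⟨M, hM, x, hx, w, rfl⟩ := hv
      obtain ⟨c, hc⟩ := φ.surjective ⟨b, hb⟩
      refine Submodule.subset_span ⟨M, hM, (c : H →L[ℂ] H) x, h𝓜.invariant M hM c c.2 x hx, w, ?_⟩
      have h1 : (⟨rankOne ℂ ((c : H →L[ℂ] H) x) (y M hM), hy M hM _
          (h𝓜.invariant M hM c c.2 x hx)⟩ : 𝔅) = c * ⟨rankOne ℂ x (y M hM), hy M hM x hx⟩ :=
        Subtype.ext (by ext z; simp)
      rw [h1, map_mul, hc]
      rfl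
  -- Otherwise some nonzero rank one operator `p ⊗ q` of the algebra kills `L₀`. Its preimage under
  -- `φ` then annihilates every `x ⊗ y`, hence a dense set of vectors, and so vanishes.
  have htop : L₀.topologicalClosure = ⊤ := by
    by_contra hne
    obtain ⟨p, q, hp, hq, hqL, hpq⟩ := h𝓜.exists_annihilator _ L₀.isClosed_topologicalClosure hne
      (fun b hb x hx => map_mem_closure b.continuous hx fun v hv => hinv b hb v hv)
    obtain ⟨c, hc⟩ := φ.surjective ⟨_, hpq⟩
    have hc0 : ∀ x, (∃ M ∈ 𝓜, x ∈ M) → (c : H →L[ℂ] H) x = 0 := fun x ⟨M, hM, hx⟩ => by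
      have h1 : c * ⟨rankOne ℂ x (y M hM), hy M hM x hx⟩ = 0 := by
        refine φ.injective (?_ : φ _ = φ _)
        rw [map_mul, hc, map_zero]
        refine Subtype.ext (ContinuousLinearMap.ext fun w => ?_)
        have hw : inner ℂ q ((φ ⟨rankOne ℂ x (y M hM), hy M hM x hx⟩ : H →L[ℂ] H) w) = 0 := by
          rw [inner_eq_zero_symm]
          exact hqL _ (L₀.le_topologicalClosure (Submodule.subset_span ⟨M, hM, x, hx, w, rfl⟩))
        simp [hw]
      have h2 := congrArg (fun T : 𝔅 => (T : H →L[ℂ] H) (y M hM)) h1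
      simpa [inner_self_eq_norm_sq_to_K, hy1] using h2
    have hcz : c = 0 := Subtype.ext (ContinuousLinearMap.ext fun x =>
      congrFun ((c : H →L[ℂ] H).continuous.ext_on h𝓜.dense (0 : H →L[ℂ] H).continuous hc0) x)
    rw [hcz, map_zero] at hc
    have h3 := congrArg (fun T : 𝔅 => (T : H →L[ℂ] H) q) hc
    simp only [ZeroMemClass.coe_zero, zero_apply, rankOne_apply] at h3
    exact smul_ne_zero (inner_self_ne_zero.2 hq) hp h3.symm
  intro x z
  simp only [zero_apply, inner_zero_left]
  have hspan : ∀ v ∈ L₀, Tendsto (fun i => inner ℂ ((φ (f i) : H →L[ℂ] H) v) z) l (𝓝 0) :=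
    fun v hv => by
    induction hv using Submodule.span_induction with
    | zero => simpa using tendsto_const_nhds
    | add v w _ _ hv hw => simpa only [map_add, inner_add_left, add_zero] using hv.add hw
    | smul c v _ hv =>
      simpa only [map_smul, inner_smul_left, mul_zero] using hv.const_mul (starRingEnd ℂ c)
    | mem v hv =>
      obtain ⟨M, hM, x, hx, w, rfl⟩ := hv
      let R (p : H) : 𝔅 := ⟨rankOne ℂ (closureProj M p) (y M hM),
        hy M hM _ (closureProj_apply_mem (h𝓜.isClosed M hM) p)⟩
      have hRn : ∀ p, ‖R p‖ ≤ ‖p‖ := fun p => by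
        change ‖rankOne ℂ (closureProj M p) (y M hM)‖ ≤ ‖p‖
        rw [norm_rankOne, hy1, mul_one]
        exact ((closureProj M).le_of_opNorm_le (norm_closureProj_le _) p).trans (by simp)
      -- A bounded operator independent of `i` with `φ(f_i) φ(x ⊗ y) w = A (f_i x)`; bounded
      -- operators preserve weak convergence.
      let A : H →L[ℂ] H := LinearMap.mkContinuous
        { toFun := fun p => (φ (R p) : H →L[ℂ] H) w
          map_add' := fun p p' => by
            have : R (p + p') = R p + R p' := Subtype.ext (by simp [R])
            rw [this, map_add, Subalgebra.coe_add, add_apply]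
          map_smul' := fun c p => by
            have : R (c • p) = c • R p := Subtype.ext (by simp [R])
            rw [this, map_smul, Subalgebra.coe_smul, smul_apply, RingHom.id_apply] }
        (K * ‖w‖) (fun p => by
          refine ((φ (R p) : H →L[ℂ] H).le_opNorm w).trans ?_
          calc ‖(φ (R p) : H →L[ℂ] H)‖ * ‖w‖ ≤ (K * ‖p‖) * ‖w‖ := by
                gcongr
                exact (hK _).trans (mul_le_mul_of_nonneg_left (hRn p) hK0)
            _ = _ := by ring)
      have hA := (hf.const_mul A) x z
      rw [mul_zero, zero_apply, inner_zero_left] at hA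
      refine hA.congr fun i => ?_
      congr 1
      change (φ (R ((f i : H →L[ℂ] H) x)) : H →L[ℂ] H) w = _
      have h1 : R ((f i : H →L[ℂ] H) x) = f i * ⟨rankOne ℂ x (y M hM), hy M hM x hx⟩ :=
        Subtype.ext (by
          ext v
          simp [R, closureProj_apply_of_mem (h𝓜.invariant M hM _ (f i).2 x hx)])
      rw [h1, map_mul]
      rfl
  have hx : x ∈ closure (L₀ : Set H) := by
    have : x ∈ L₀.topologicalClosure := htop ▸ Submodule.mem_top
    exact this
  rw [Metric.tendsto_nhds]
  intro ε hε
  -- The summand `1` keeps the divisor positive when `z = 0`, `C = 0` or `K = 0`.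
  set c : ℝ := K * |C| * ‖z‖ + 1 with hcdef
  have hc : 0 < c := by positivity
  obtain ⟨v, hv, hxv⟩ := Metric.mem_closure_iff.1 hx (ε / 2 / c) (by positivity)
  filter_upwards [hC, Metric.tendsto_nhds.1 (hspan v hv) (ε / 2) (by positivity)] with i hi hi2
  rw [dist_zero_right] at hi2 ⊢
  have hb : ‖(φ (f i) : H →L[ℂ] H)‖ ≤ K * |C| :=
    (hK _).trans (mul_le_mul_of_nonneg_left (hi.trans (le_abs_self C)) hK0)
  have h1 : ‖inner ℂ ((φ (f i) : H →L[ℂ] H) (x - v)) z‖ ≤ ε / 2 := by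
    calc ‖inner ℂ ((φ (f i) : H →L[ℂ] H) (x - v)) z‖
        ≤ ‖(φ (f i) : H →L[ℂ] H) (x - v)‖ * ‖z‖ := norm_inner_le_norm _ _
      _ ≤ (K * |C| * (ε / 2 / c)) * ‖z‖ := by
          gcongr
          refine ((φ (f i) : H →L[ℂ] H).le_of_opNorm_le hb _).trans ?_
          gcongr
          rw [← dist_eq_norm]
          exact hxv.le
      _ = (K * |C| * ‖z‖) * (ε / 2 / c) := by ring
      _ ≤ c * (ε / 2 / c) := by
          gcongr
          linarith
      _ = ε / 2 := by field_simp
  calc ‖inner ℂ ((φ (f i) : H →L[ℂ] H) x) z‖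
      = ‖inner ℂ ((φ (f i) : H →L[ℂ] H) (x - v)) z + inner ℂ ((φ (f i) : H →L[ℂ] H) v) z‖ := by
        rw [← inner_add_left, ← map_add, sub_add_cancel]
    _ ≤ _ := norm_add_le _ _
    _ < ε := by linarith

end RankOne

/-! ### Recovering a flow from its infinitesimal behaviour along an ultrafilter -/

namespace AlgFlow

variable {A : Type*} [NormedRing A] [NormedAlgebra ℂ A]

/-- The perturbation `Ad u_t ∘ β_t` of a flow `β` by a cocycle `u`. -/
noncomputable def conj [CompleteSpace A] (β : AlgFlow A) (u : ℝ → Aˣ) (hu : β.IsCocycle u) : AlgFlow A where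
  aut t :=
    { toFun := fun b => u t * β.aut t b * ((u t)⁻¹ : Aˣ)
      invFun := fun b => (β.aut t).symm (((u t)⁻¹ : Aˣ) * b * u t)
      left_inv := fun b => by simp [mul_assoc]
      right_inv := fun b => by simp [mul_assoc]
      map_mul' := fun b c => by simp [mul_assoc]
      map_add' := fun b c => by simp [mul_add, add_mul]
      commutes' := fun c => by
        rw [AlgHomClass.commutes, ← Algebra.commutes, mul_assoc, Units.mul_inv, mul_one]
      continuous_toFun :=
        (continuous_const.mul (β.aut t).continuous).mul continuous_const
      continuous_invFun :=
        (β.aut t).symm.continuous.comp ((continuous_const.mul continuous_id).mul continuous_const) }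
  aut_add s t b := by
    have hinv : (((u (s + t))⁻¹ : Aˣ) : A) = β.aut s ((u t)⁻¹ : Aˣ) * ((u s)⁻¹ : Aˣ) := by
      refine Units.inv_eq_of_mul_eq_one_right ?_
      rw [← hu.2, mul_assoc, ← mul_assoc (β.aut s (u t)), ← map_mul, Units.mul_inv, map_one,
        one_mul, Units.mul_inv]
    change (u (s + t) : A) * β.aut (s + t) b * ((u (s + t))⁻¹ : Aˣ)
      = u s * β.aut s (u t * β.aut t b * ((u t)⁻¹ : Aˣ)) * ((u s)⁻¹ : Aˣ)
    rw [hinv, ← hu.2, β.aut_add, map_mul, map_mul]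
    simp only [mul_assoc]
  continuous_aut b := by
    refine (hu.1.mul (β.continuous_aut b)).mul (continuous_iff_continuousAt.2 fun t => ?_)
    have h1 : ContinuousAt (fun t => Ring.inverse (u t : A)) t :=
      ContinuousAt.comp (f := fun t => (u t : A)) (NormedRing.inverse_continuousAt (u t))
        hu.1.continuousAt
    simpa using h1

theorem conj_isAdPerturbationBy [CompleteSpace A] (β : AlgFlow A) (u : ℝ → Aˣ)
    (hu : β.IsCocycle u) : (β.conj u hu).IsAdPerturbationBy β u := fun _ _ => rfl

/-- Flows are bounded on bounded intervals. -/
theorem exists_norm_aut_le [CompleteSpace A] (α : AlgFlow A) (T : ℝ) :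
    ∃ K, 0 ≤ K ∧ ∀ t, |t| ≤ T → ∀ b, ‖α.aut t b‖ ≤ K * ‖b‖ := by
  obtain ⟨K, hK⟩ := banach_steinhaus (g := fun t : Set.Icc (-T) T => α.op t) fun b => by
    obtain ⟨C, hC⟩ := (isCompact_Icc (a := -T) (b := T)).exists_bound_of_continuousOn
      (α.continuous_aut b).continuousOn
    exact ⟨C, fun t => hC t t.2⟩
  refine ⟨max K 0, le_max_right _ _, fun t ht b => (α.op t).le_of_opNorm_le ?_ b⟩
  exact (hK ⟨t, abs_le.1 ht⟩).trans (le_max_left _ _)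

/-- Local boundedness of `‖α_t‖`, from the uniform boundedness principle, upgrades strong continuity
to joint continuity. This makes `t ↦ α_t(α'_{T-t} b)` continuous. -/
theorem continuous_aut_comp [CompleteSpace A] (α : AlgFlow A) {f : ℝ → A} (hf : Continuous f) :
    Continuous fun t => α.aut t (f t) := by
  refine continuous_iff_continuousAt.2 fun t₀ => ?_
  obtain ⟨K, hK0, hK⟩ := α.exists_norm_aut_le (|t₀| + 1)
  have h1 : Tendsto (fun t => α.aut t (f t - f t₀)) (𝓝 t₀) (𝓝 0) := by
    have h2 : Tendsto (fun t => K * ‖f t - f t₀‖) (𝓝 t₀) (𝓝 0) := by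
      simpa using (tendsto_iff_norm_sub_tendsto_zero.1 (hf.tendsto t₀)).const_mul K
    refine squeeze_zero_norm' ?_ h2
    filter_upwards [Metric.ball_mem_nhds t₀ one_pos] with t ht
    refine hK t ?_ _
    have := abs_sub_abs_le_abs_sub t t₀
    rw [Metric.mem_ball, Real.dist_eq] at ht
    linarith
  have h3 := h1.add ((α.continuous_aut (f t₀)).tendsto t₀)
  rw [zero_add] at h3
  refine h3.congr fun t => ?_
  rw [map_sub, sub_add_cancel]

theorem aut_neg_aut (α : AlgFlow A) (t : ℝ) (b : A) : α.aut (-t) (α.aut t b) = b := by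
  rw [← α.aut_add, neg_add_cancel, aut_zero_apply]

/-- Two flows with `‖α_s - α'_s‖ = O(s)`, such that `α_t ((α_s - α'_s) / s)` tends to zero along an
ultrafilter, pointwise with respect to a separating set of functionals, are equal. -/
theorem aut_eq_of_slope [CompleteSpace A] {α α' : AlgFlow A} {Λ : Set (A →L[ℂ] ℂ)}
    (hΛ : ∀ a, (∀ ℓ ∈ Λ, ℓ a = 0) → a = 0) {U : Filter ℝ} [U.NeBot] (hU : U ≤ 𝓝[>] 0) {C : ℝ}
    (hC : ∀ᶠ s in U, ∀ b, ‖α.aut s b - α'.aut s b‖ ≤ C * |s| * ‖b‖)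
    (h : ∀ (t : ℝ) (b : A), ∀ ℓ ∈ Λ,
      Tendsto (fun s : ℝ => ℓ (α.aut t (((s : ℂ)⁻¹) • (α.aut s b - α'.aut s b)))) U (𝓝 0))
    (t : ℝ) (b : A) : α.aut t b = α'.aut t b := by
  have hU0 : ∀ᶠ s in U, 0 < s := hU self_mem_nhdsWithin
  have hpos : ∀ T : ℝ, 0 ≤ T → ∀ b : A, α.aut T b = α'.aut T b := by
    intro T hT b
    rw [← sub_eq_zero]
    refine hΛ _ fun ℓ hℓ => ?_
    -- This interpolates between `α'_T b` at `t = 0` and `α_T b` at `t = T`. Its increment over `[x,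
    -- x + s]` is `ℓ` applied to `α_x (α_s - α'_s)(α'_{T-x-s} b)`.
    set g : ℝ → ℂ := fun t => ℓ (α.aut t (α'.aut (T - t) b)) with hg
    have hgc : Continuous g := ℓ.continuous.comp
      (α.continuous_aut_comp ((α'.continuous_aut b).comp (continuous_const.sub continuous_id)))
    have hslope : ∀ x, Tendsto (fun s => ‖g (x + s) - g x‖ / s) U (𝓝 0) := fun x => by
      set c : ℝ → A := fun s => α'.aut (T - x - s) b with hc
      have hcc : Tendsto c U (𝓝 (c 0)) :=
        (((α'.continuous_aut b).comp (continuous_const.sub continuous_id)).tendsto 0).mono_left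
          (hU.trans nhdsWithin_le_nhds)
      have h1 := h x (c 0) ℓ hℓ
      -- The vector `c s` varies with `s`, while the hypothesis concerns fixed vectors. The `O(s)`
      -- bound makes the error from replacing `c s` by `c 0` negligible.
      have h2 : Tendsto (fun s : ℝ => ℓ (α.aut x (((s : ℂ)⁻¹) •
          (α.aut s (c s - c 0) - α'.aut s (c s - c 0))))) U (𝓝 0) := by
        have h3 : Tendsto (fun s => ‖ℓ‖ * (‖α.op x‖ * (C * ‖c s - c 0‖))) U (𝓝 0) := by
          simpa using
            (((tendsto_iff_norm_sub_tendsto_zero.1 hcc).const_mul C).const_mul _).const_mul _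
        refine squeeze_zero_norm' ?_ h3
        filter_upwards [hC, hU0] with s hs hs0
        refine (ℓ.le_opNorm _).trans (mul_le_mul_of_nonneg_left ?_ (norm_nonneg _))
        refine ((α.op x).le_opNorm _).trans (mul_le_mul_of_nonneg_left ?_ (norm_nonneg _))
        rw [norm_smul, norm_inv, Complex.norm_real, Real.norm_eq_abs,
          inv_mul_le_iff₀ (abs_pos.2 hs0.ne')]
        refine (hs _).trans_eq (by ring)
      have h4 := (h1.add h2).norm
      rw [add_zero, norm_zero] at h4
      refine h4.congr' ?_
      filter_upwards [hU0] with s hs0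
      have e1 : g (x + s) - g x = ℓ (α.aut x (α.aut s (c s) - α'.aut s (c s))) := by
        have : T - x = s + (T - x - s) := by ring
        simp only [hg, hc, map_sub]
        rw [α.aut_add, ← α'.aut_add, ← this, sub_add_eq_sub_sub]
      rw [← map_add, ← map_add, ← smul_add, map_smul, map_smul, smul_eq_mul, norm_mul, norm_inv,
        Complex.norm_real, Real.norm_of_nonneg hs0.le, e1, div_eq_inv_mul]
      congr 4
      simp only [map_sub]
      abel
    have key : ∀ ε : ℝ, 0 < ε → ‖g T - g 0‖ ≤ ε * T := fun ε hε => by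
      refine image_norm_le_of_liminf_right_slope_norm_lt_deriv_boundary (a := 0) (b := T)
        (f := fun t => g t - g 0) (f' := fun _ => 0) (B := fun t => ε * t) (B' := fun _ => ε)
        (hgc.sub continuous_const).continuousOn (fun x _ r hr => ?_) (by simp)
        (by fun_prop) (fun x _ => ?_) (fun _ _ _ => hε) ⟨hT, le_rfl⟩
      -- Slopes are controlled only along `U`, but the mean value inequality asks for small slopes
      -- at arbitrarily small `s`, not at all of them.
      · have h1 : ∃ᶠ s in 𝓝[>] (0 : ℝ), slope (norm ∘ fun t => g t - g 0) x (x + s) < r := by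
          refine Frequently.filter_mono (Eventually.frequently ?_) hU
          filter_upwards [(hslope x).eventually (gt_mem_nhds hr), hU0] with s hs hs0
          refine lt_of_le_of_lt ?_ hs
          rw [slope_def_field, add_sub_cancel_left]
          gcongr
          simpa using norm_sub_norm_le (g (x + s) - g 0) (g x - g 0)
        have h2 : Tendsto (fun s : ℝ => x + s) (𝓝[>] 0) (𝓝[>] x) := by
          refine tendsto_nhdsWithin_iff.2 ⟨?_, ?_⟩
          · have : Tendsto (fun s : ℝ => x + s) (𝓝 0) (𝓝 (x + 0)) :=
              (continuous_const.add continuous_id).tendsto 0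
            rw [add_zero] at this
            exact this.mono_left nhdsWithin_le_nhds
          · filter_upwards [self_mem_nhdsWithin] with s hs
            simpa using hs
        exact h2.frequently h1
      · simpa using ((hasDerivAt_id x).const_mul ε).hasDerivWithinAt
    have h0 : g T - g 0 = 0 := by
      refine norm_le_zero_iff.1 (le_of_forall_pos_le_add fun ε hε => ?_)
      refine (key (ε / (T + 1)) (by positivity)).trans ?_
      rw [zero_add, div_mul_eq_mul_div, div_le_iff₀ (by positivity)]
      nlinarith
    simpa [hg, map_sub] using h0
  rcases le_total 0 t with ht | ht
  · exact hpos t ht b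
  · have h1 := hpos (-t) (by linarith) (α'.aut t b)
    rw [aut_neg_aut] at h1
    refine (α.aut (-t)).injective ((α.aut_neg_aut t b).trans h1.symm)

/-- If `(α_s - β_s) / s` tends to the inner derivation `ad k` along an ultrafilter, in the sense
of `aut_eq_of_slope`, then `α` is the perturbation of `β` by the cocycle generated by `k`. -/
theorem exists_cocycle_of_slope [CompleteSpace A] {α β : AlgFlow A} {Λ : Set (A →L[ℂ] ℂ)}
    (hΛ : ∀ a, (∀ ℓ ∈ Λ, ℓ a = 0) → a = 0) {U : Filter ℝ} [U.NeBot] (hU : U ≤ 𝓝[>] 0) {C : ℝ}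
    (hC : ∀ᶠ s in U, ∀ b, ‖α.aut s b - β.aut s b‖ ≤ C * |s| * ‖b‖) (k : A)
    (h : ∀ (t : ℝ) (b : A), ∀ ℓ ∈ Λ, Tendsto (fun s : ℝ => ℓ (α.aut t
      (((s : ℂ)⁻¹) • (α.aut s b - β.aut s b) - (k * b - b * k)))) U (𝓝 0)) :
    ∃ u : ℝ → Aˣ, u 0 = 1 ∧ β.IsCocycle u ∧ IsDifferentiableFamily u k ∧
      α.IsAdPerturbationBy β u := by
  obtain ⟨u, hu0, hu, hd⟩ := β.exists_cocycle k
  have hv : HasDerivAt (fun t => ((u t)⁻¹ : Aˣ).1) (-k) 0 := hasDerivAt_inv_of_units hu0 hd.2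
  refine ⟨u, hu0, hu, hd, fun t b => ?_⟩
  have hUne : U ≤ 𝓝[≠] 0 := hU.trans (nhdsGT_le_nhdsNE 0)
  have hU0 : ∀ᶠ s in U, 0 < s := hU self_mem_nhdsWithin
  have hgen := hasGen_add_of_isAdPerturbationBy hu0 hd.2 hv (β.conj_isAdPerturbationBy u hu)
  obtain ⟨C', hC'⟩ : ∃ C', ∀ᶠ s in U, ∀ b,
      ‖(β.conj u hu).aut s b - β.aut s b‖ ≤ C' * |s| * ‖b‖ := by
    obtain ⟨K, hK0, hK⟩ := β.exists_norm_aut_le 1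
    have h1 : ∀ᶠ s : ℝ in U, ‖((s : ℂ)⁻¹) • ((u s : A) - 1)‖ ≤ ‖k‖ + 1 := by
      have := (tendsto_slope_zero_complex hd.2).mono_left hUne
      simp only [hu0, Units.val_one] at this
      exact this.norm.eventually (ge_mem_nhds (lt_add_one _))
    have h2 : ∀ᶠ s : ℝ in U, ‖((s : ℂ)⁻¹) • ((((u s)⁻¹ : Aˣ) : A) - 1)‖ ≤ ‖k‖ + 1 := by
      have := (tendsto_slope_zero_complex hv).mono_left hUne
      simp only [hu0, inv_one, Units.val_one] at this
      exact this.norm.eventually (ge_mem_nhds (by rw [norm_neg]; exact lt_add_one _))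
    have h3 : ∀ᶠ s in U, ‖(((u s)⁻¹ : Aˣ) : A)‖ ≤ ‖(1 : A)‖ + 1 := by
      have h4 := hv.continuousAt.tendsto
      simp only [hu0, inv_one, Units.val_one] at h4
      exact (h4.mono_left (hU.trans nhdsWithin_le_nhds)).norm.eventually
        (ge_mem_nhds (lt_add_one _))
    have h5 : ∀ᶠ s in U, |s| ≤ 1 := by
      have : ∀ᶠ s in 𝓝 (0 : ℝ), |s| ≤ 1 := by
        filter_upwards [Metric.closedBall_mem_nhds (0 : ℝ) one_pos] with s hs
        simpa using hs
      exact (hU.trans nhdsWithin_le_nhds) this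
    refine ⟨(‖k‖ + 1) * K * (‖(1 : A)‖ + 1) + K * (‖k‖ + 1), ?_⟩
    filter_upwards [h1, h2, h3, h5, hU0] with s h1 h2 h3 h5 hs0 b
    rw [norm_smul, norm_inv, Complex.norm_real, Real.norm_eq_abs,
      inv_mul_le_iff₀ (abs_pos.2 hs0.ne')] at h1 h2
    have hb := hK s h5 b
    have e : (β.conj u hu).aut s b - β.aut s b = ((u s : A) - 1) * β.aut s b * ((u s)⁻¹ : Aˣ)
        + β.aut s b * ((((u s)⁻¹ : Aˣ) : A) - 1) := by
      rw [β.conj_isAdPerturbationBy u hu s b]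
      noncomm_ring
    rw [e]
    calc _ ≤ ‖(u s : A) - 1‖ * ‖β.aut s b‖ * ‖(((u s)⁻¹ : Aˣ) : A)‖
          + ‖β.aut s b‖ * ‖(((u s)⁻¹ : Aˣ) : A) - 1‖ := by
          refine (norm_add_le _ _).trans (add_le_add ?_ (norm_mul_le _ _))
          exact (norm_mul_le _ _).trans (mul_le_mul_of_nonneg_right (norm_mul_le _ _)
            (norm_nonneg _))
      _ ≤ (|s| * (‖k‖ + 1)) * (K * ‖b‖) * (‖(1 : A)‖ + 1)
          + (K * ‖b‖) * (|s| * (‖k‖ + 1)) := by gcongr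
      _ = _ := by ring
  refine aut_eq_of_slope (α' := β.conj u hu) (C := C + C') hΛ hU ?_ (fun t b ℓ hℓ => ?_) t b
  · filter_upwards [hC, hC'] with s h1 h2 b
    have e : α.aut s b - (β.conj u hu).aut s b
        = (α.aut s b - β.aut s b) - ((β.conj u hu).aut s b - β.aut s b) := by abel
    rw [e]
    refine (norm_sub_le _ _).trans ((add_le_add (h1 b) (h2 b)).trans_eq (by ring))
  · have h1 := h t b ℓ hℓ
    have h2 : Tendsto (fun s : ℝ => ℓ (α.aut t (((s : ℂ)⁻¹) • ((β.conj u hu).aut s b - β.aut s b)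
        - (k * b - b * k)))) U (𝓝 0) := by
      have h3 : Tendsto (fun s : ℝ => ((s : ℂ)⁻¹) • ((β.conj u hu).aut s b - β.aut s b)
          - (k * b - b * k)) U (𝓝 0) := by
        rw [← sub_self (k * b - b * k)]
        refine (((hgen b).mono_left hUne).congr fun s => ?_).sub_const _
        rw [← smul_sub]
        congr 1
        abel
      have h4 := ((ℓ.comp (α.op t)).continuous.tendsto 0).comp h3
      rw [map_zero] at h4
      exact h4
    have h5 := h1.sub h2
    rw [sub_zero] at h5
    refine h5.congr fun s => ?_
    rw [← map_sub, ← map_sub]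
    congr 2
    rw [sub_sub_sub_cancel_right, ← smul_sub]
    congr 1
    abel

theorem isInnerPerturbation_of_cocycle [CompleteSpace A] {α β : AlgFlow A} {k : A}
    (H : ∃ u : ℝ → Aˣ, u 0 = 1 ∧ β.IsCocycle u ∧ IsDifferentiableFamily u k ∧
      α.IsAdPerturbationBy β u) :
    α.IsInnerPerturbation β ∧
      ∃ (h : A) (u : ℝ → Aˣ), α.IsInnerPerturbationBy β h ∧ β.IsCocycle u ∧
        IsDifferentiableFamily u (Complex.I • h) ∧ α.IsAdPerturbationBy β u := by
  obtain ⟨u, hu0, hu, hd, hα⟩ := H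
  have hk : Complex.I • (-Complex.I • k) = k := by
    rw [smul_smul, mul_neg, Complex.I_mul_I, neg_neg, one_smul]
  have hinner : α.IsInnerPerturbationBy β (-Complex.I • k) :=
    IsAdPerturbationBy.isInnerPerturbationBy hu0 (by rw [hk]; exact hd.2) hα
  exact ⟨⟨_, hinner⟩, _, u, hinner, hu, by rwa [hk], hα⟩

end AlgFlow

/-! ### The criterion for inner perturbation -/

section

variable {H : Type*} [NormedAddCommGroup H] [InnerProductSpace ℂ H] [CompleteSpace H]
  {𝔅 : Subalgebra ℂ (H →L[ℂ] H)} {𝓜 : Set (Submodule ℂ H)}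

/-- Flows at distance `O(t)` on a closed operator algebra with enough rank one operators are inner
perturbations of each other, provided that the algebra contains the weak limits of
`(α_t - β_t) / t` and that bounded operators inducing derivations of the algebra belong to it. -/
theorem HasRankOnes.isInnerPerturbation (h𝓜 : HasRankOnes 𝔅 𝓜)
    (hcl : IsClosed (𝔅 : Set (H →L[ℂ] H))) (α β : AlgFlow 𝔅)
    (hαβ : (fun t : ℝ => ‖α.op t - β.op t‖) =O[𝓝 0] (fun t : ℝ => t))
    (hlim : ∀ (U : Ultrafilter ℝ), (U : Filter ℝ) ≤ 𝓝[>] 0 → ∀ (b : 𝔅) (T : H →L[ℂ] H),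
      TendstoWOT (fun s => (AlgFlow.diffQuot α β s b : H →L[ℂ] H)) U T → T ∈ 𝔅)
    (hder : ∀ k : H →L[ℂ] H, (∀ b ∈ 𝔅, k * b - b * k ∈ 𝔅) → k ∈ 𝔅) :
    α.IsInnerPerturbation β ∧
      ∃ (h : 𝔅) (u : ℝ → 𝔅ˣ), α.IsInnerPerturbationBy β h ∧ β.IsCocycle u ∧
        AlgFlow.IsDifferentiableFamily u (Complex.I • h) ∧ α.IsAdPerturbationBy β u := by
  have : CompleteSpace 𝔅 := hcl.completeSpace_coe
  obtain ⟨C, hC0, hC⟩ := hαβ.exists_nonneg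
  rw [Asymptotics.isBigOWith_iff] at hC
  have hC : ∀ᶠ s in 𝓝 (0 : ℝ), ‖α.op s - β.op s‖ ≤ C * |s| :=
    hC.mono fun s hs => by simpa using hs
  let U : Ultrafilter ℝ := Ultrafilter.of (𝓝[>] 0)
  have hU : (U : Filter ℝ) ≤ 𝓝[>] 0 := Ultrafilter.of_le _
  have hU0 : (U : Filter ℝ) ≤ 𝓝 0 := hU.trans nhdsWithin_le_nhds
  obtain ⟨Δ, hΔn, hΔ, hΔm⟩ := AlgFlow.exists_limit_derivation α β U hU0 hC0 (hU0 hC)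
  obtain ⟨k, hk⟩ := h𝓜.exists_eq_commutator hC0 hΔn hΔm
  have hk𝔅 : k ∈ 𝔅 := hder k fun b hb => by
    have := hk ⟨b, hb⟩
    rw [← this]
    exact hlim U hU _ _ (hΔ _)
  -- Matrix coefficients separate points, and they are the functionals for which the limit defining
  -- `Δ` exists.
  let Λ : Set (𝔅 →L[ℂ] ℂ) := {ℓ | ∃ x y : H, ∀ b, ℓ b = inner ℂ y ((b : H →L[ℂ] H) x)}
  have hmem : ∀ x y : H, ∃ ℓ ∈ Λ, ∀ b, ℓ b = inner ℂ y ((b : H →L[ℂ] H) x) := fun x y =>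
    ⟨((innerSL ℂ y).comp (ContinuousLinearMap.apply ℂ H x)).comp (Subalgebra.toSubmodule 𝔅).subtypeL,
      ⟨x, y, fun b => rfl⟩, fun b => rfl⟩
  refine AlgFlow.isInnerPerturbation_of_cocycle (k := ⟨k, hk𝔅⟩)
    (AlgFlow.exists_cocycle_of_slope (Λ := Λ) (fun a ha => ?_) hU (C := C) ?_ _
      fun t b ℓ hℓ => ?_)
  · refine Subtype.ext (ContinuousLinearMap.ext fun x => ext_inner_left ℂ fun y => ?_)
    obtain ⟨ℓ, hℓ, hℓb⟩ := hmem x y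
    rw [← hℓb, ha ℓ hℓ]
    simp
  · filter_upwards [hU0 hC] with s hs b using (α.op s - β.op s).le_of_opNorm_le hs b
  · obtain ⟨x, y, hxy⟩ := hℓ
    have h1 : TendstoWOT (fun s : ℝ => ((((s : ℂ)⁻¹) • (α.aut s b - β.aut s b)
        - (⟨k, hk𝔅⟩ * b - b * ⟨k, hk𝔅⟩) : 𝔅) : H →L[ℂ] H)) U 0 := by
      have h2 := (hΔ b).sub (.of_tendsto (tendsto_const_nhds (x := Δ b)))
      rw [sub_self] at h2
      refine h2.congr' (.of_forall fun s => ?_)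
      rw [hk b]
      rfl
    have h3 : ∀ᶠ s : ℝ in (U : Filter ℝ), ‖((s : ℂ)⁻¹) • (α.aut s b - β.aut s b)
        - (⟨k, hk𝔅⟩ * b - b * ⟨k, hk𝔅⟩)‖ ≤ C * ‖b‖ + ‖(⟨k, hk𝔅⟩ : 𝔅) * b - b * ⟨k, hk𝔅⟩‖ := by
      filter_upwards [hU0 hC] with s hs
      refine (norm_sub_le _ _).trans (add_le_add (AlgFlow.norm_diffQuot_le hs hC0 b) le_rfl)
    have h4 := (h𝓜.tendstoWOT_aut (α.aut t) h3 h1) x y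
    simp only [zero_apply, inner_zero_left] at h4
    have h5 := (Complex.continuous_conj.tendsto 0).comp h4
    rw [map_zero] at h5
    refine h5.congr fun s => ?_
    rw [Function.comp_apply, inner_conj_symm, hxy]

end

/-! ### Projections onto closed subspaces and their monotone limits -/

section Projections

variable {H : Type*} [NormedAddCommGroup H] [InnerProductSpace ℂ H] [CompleteSpace H]
  {M M' : Submodule ℂ H}

theorem closureProj_mul_of_le (h : M ≤ M') : closureProj M * closureProj M' = closureProj M :=
  Submodule.starProjection_comp_starProjection_of_le (Submodule.topologicalClosure_mono h)

theorem adjoint_closureProj (M : Submodule ℂ H) :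
    ContinuousLinearMap.adjoint (closureProj M) = closureProj M :=
  (isSelfAdjoint_starProjection M.topologicalClosure).adjoint_eq

theorem closureProj_inner (M : Submodule ℂ H) (x y : H) :
    inner ℂ (closureProj M x) y = inner ℂ x (closureProj M y) :=
  Submodule.inner_starProjection_left_eq_right _ x y

theorem mul_closureProj_of_le (h : M ≤ M') : closureProj M' * closureProj M = closureProj M := by
  have := congrArg ContinuousLinearMap.adjoint (closureProj_mul_of_le h)
  change ContinuousLinearMap.adjoint ((closureProj M).comp (closureProj M')) = _ at this
  rwa [ContinuousLinearMap.adjoint_comp, adjoint_closureProj, adjoint_closureProj] at this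

theorem closureProj_mul_self (M : Submodule ℂ H) :
    closureProj M * closureProj M = closureProj M :=
  closureProj_mul_of_le le_rfl

theorem closureProj_bot : closureProj (⊥ : Submodule ℂ H) = 0 := by
  ext x
  have : IsClosed ((⊥ : Submodule ℂ H) : Set H) := by simp
  simpa using closureProj_apply_mem this x

theorem closureProj_top : closureProj (⊤ : Submodule ℂ H) = 1 := by
  ext x
  exact closureProj_apply_of_mem trivial

theorem sub_closureProj_mem_orthogonal (M : Submodule ℂ H) (x : H) : x - closureProj M x ∈ Mᗮ :=
  Submodule.orthogonal_le M.le_topologicalClosure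
    (M.topologicalClosure.sub_starProjection_mem_orthogonal x)

theorem closureProj_apply_eq_zero {x : H} (hx : x ∈ Mᗮ) : closureProj M x = 0 := by
  refine (Submodule.starProjection_apply_eq_zero_iff _).2 ?_
  rwa [Submodule.orthogonal_closure]

theorem norm_closureProj_apply_le (M : Submodule ℂ H) (x : H) : ‖closureProj M x‖ ≤ ‖x‖ := by
  simpa using (closureProj M).le_of_opNorm_le (norm_closureProj_le M) x

theorem closureProj_congr (h : M.topologicalClosure = M'.topologicalClosure) :
    closureProj M = closureProj M' := by
  unfold closureProj
  congr 1

theorem closureProj_orthogonal (M : Submodule ℂ H) : closureProj Mᗮ = 1 - closureProj M := by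
  ext x
  have h1 : closureProj Mᗮ (x - closureProj M x) = x - closureProj M x :=
    closureProj_apply_of_mem (sub_closureProj_mem_orthogonal M x)
  have h2 : closureProj Mᗮ (closureProj M x) = 0 := by
    refine closureProj_apply_eq_zero ?_
    rw [Submodule.orthogonal_orthogonal_eq_closure]
    exact M.topologicalClosure.starProjection_apply_mem x
  rw [map_sub, h2, sub_zero] at h1
  exact h1

theorem tendsto_closureProj_iSup {ι : Type*} [Preorder ι] {V : ι → Submodule ℂ H}
    (hV : Monotone V) (x : H) :
    Tendsto (fun i => closureProj (V i) x) atTop (𝓝 (closureProj (⨆ i, V i) x)) := by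
  have h1 := Submodule.starProjection_tendsto_closure_iSup (fun i => (V i).topologicalClosure)
    (fun i j h => Submodule.topologicalClosure_mono (hV h)) x
  have h2 : closureProj (⨆ i, V i) = closureProj (⨆ i, (V i).topologicalClosure) := by
    refine closureProj_congr (le_antisymm (Submodule.topologicalClosure_mono
      (iSup_mono fun i => Submodule.le_topologicalClosure _))
      (Submodule.topologicalClosure_minimal _ (iSup_le fun i =>
        Submodule.topologicalClosure_mono (le_iSup V i)) (Submodule.isClosed_topologicalClosure _)))
  rw [h2]
  exact h1

/-- Orthogonal complements turn intersections into closed spans, and projections `P` into `1 - P`.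
Closedness ensures that taking complements twice returns each `V i`. -/
theorem tendsto_closureProj_iInf {ι : Type*} [Preorder ι] {V : ι → Submodule ℂ H}
    (hV : Monotone V) (hcl : ∀ i, IsClosed (V i : Set H)) (x : H) :
    Tendsto (fun i => closureProj (V i) x) atBot (𝓝 (closureProj (⨅ i, V i) x)) := by
  have h1 := tendsto_closureProj_iSup (V := fun i : ιᵒᵈ => (V (OrderDual.ofDual i))ᗮ)
    (fun i j h => Submodule.orthogonal_le (hV h)) x
  have h2 : closureProj (⨆ i : ιᵒᵈ, (V (OrderDual.ofDual i))ᗮ) = 1 - closureProj (⨅ i, V i) := by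
    rw [← closureProj_orthogonal]
    refine closureProj_congr ?_
    rw [← Submodule.orthogonal_orthogonal_eq_closure, ← Submodule.orthogonal_orthogonal_eq_closure,
      ← Submodule.iInf_orthogonal, Submodule.triorthogonal_eq_orthogonal]
    congr 1
    refine iInf_congr fun i => ?_
    exact (Submodule.orthogonal_orthogonal_eq_closure _).trans
      (hcl _).submodule_topologicalClosure_eq
  rw [h2] at h1
  simp only [closureProj_orthogonal, sub_apply, one_apply_eq_self] at h1
  have h3 := (tendsto_const_nhds (x := x)).sub h1
  simp only [sub_sub_cancel] at h3
  exact h3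

end Projections

/-! ### Nests: order compactness, rank one operators, weak closedness -/

section Nest

variable {H : Type*} [NormedAddCommGroup H] [InnerProductSpace ℂ H] {N : Set (Submodule ℂ H)}

open InnerProductSpace

namespace IsNest

theorem le_total (hN : IsNest N) {M M' : Submodule ℂ H} (hM : M ∈ N) (hM' : M' ∈ N) :
    M ≤ M' ∨ M' ≤ M := hN.isChain.total hM hM'

theorem le_of_not_lt (hN : IsNest N) {M M' : Submodule ℂ H} (hM : M ∈ N) (hM' : M' ∈ N)
    (h : ¬ M < M') : M' ≤ M := by
  rcases hN.le_total hM hM' with h' | h'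
  · exact (h'.eq_or_lt.resolve_right h).ge
  · exact h'

theorem lt_of_not_le (hN : IsNest N) {M M' : Submodule ℂ H} (hM : M ∈ N) (hM' : M' ∈ N)
    (h : ¬ M ≤ M') : M' < M :=
  lt_of_le_not_ge ((hN.le_total hM hM').resolve_left h) h

/-- An induction principle for nests, expressing their compactness in the order topology. -/
theorem induction_top (hN : IsNest N) {Φ : Submodule ℂ H → Prop} (h0 : Φ ⊥)
    (hL : ∀ s ∈ N, s ≠ ⊥ → ∃ a ∈ N, a < s ∧ ∀ a' ∈ N, a ≤ a' → a' < s → Φ a' → Φ s)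
    (hR : ∀ s ∈ N, s ≠ ⊤ → Φ s → ∃ b ∈ N, s < b ∧ Φ b) : Φ ⊤ := by
  set s := (sSup {M | M ∈ N ∧ Φ M}).topologicalClosure with hs
  have hsN : s ∈ N := hN.closure_sSup_mem _ fun M hM => hM.1
  have hle : ∀ M ∈ N, Φ M → M ≤ s := fun M hM hΦ =>
    (le_sSup (show M ∈ {M | M ∈ N ∧ Φ M} from ⟨hM, hΦ⟩)).trans (Submodule.le_topologicalClosure _)
  have hΦs : Φ s := by
    by_cases hs0 : s = ⊥
    · rwa [hs0]
    · obtain ⟨a, ha, has, h⟩ := hL s hsN hs0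
      -- If every member satisfying `Φ` lay below the closed subspace `a`, then so would their
      -- closed span `s`.
      obtain ⟨a', ha', hΦa', haa'⟩ : ∃ a' ∈ N, Φ a' ∧ a ≤ a' := by
        by_contra! hcon
        refine has.not_ge (Submodule.topologicalClosure_minimal _ (sSup_le fun M hM => ?_)
          (hN.isClosed a ha))
        exact (hN.le_total ha hM.1).resolve_left (hcon M hM.1 hM.2)
      rcases (hle a' ha' hΦa').eq_or_lt with h' | h'
      · rwa [← h']
      · exact h a' ha' haa' h' hΦa'
  by_cases hst : s = ⊤
  · rwa [← hst]
  · obtain ⟨b, hb, hsb, hΦb⟩ := hR s hsN hst hΦs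
    exact absurd (hle b hb hΦb) hsb.not_ge

theorem isDirectedOrder (hN : IsNest N) (p : Submodule ℂ H → Prop) :
    IsDirectedOrder {M // M ∈ N ∧ p M} := ⟨fun M M' => by
  rcases hN.le_total M.2.1 M'.2.1 with h | h
  · exact ⟨M', h, le_rfl⟩
  · exact ⟨M, le_rfl, h⟩⟩

theorem isCodirectedOrder (hN : IsNest N) (p : Submodule ℂ H → Prop) :
    IsCodirectedOrder {M // M ∈ N ∧ p M} := ⟨fun M M' => by
  rcases hN.le_total M.2.1 M'.2.1 with h | h
  · exact ⟨M, le_rfl, h⟩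
  · exact ⟨M', h, le_rfl⟩⟩

theorem isClosed_nestAlgebra (hN : IsNest N) :
    IsClosed (nestAlgebra N : Set (H →L[ℂ] H)) := by
  have : (nestAlgebra N : Set (H →L[ℂ] H)) = ⋂ M ∈ N, ⋂ x ∈ M, {T | T x ∈ M} := by
    ext T
    simp only [Set.mem_iInter]
    rfl
  rw [this]
  exact isClosed_biInter fun M hM => isClosed_biInter fun x _ =>
    (hN.isClosed M hM).preimage (ContinuousLinearMap.apply ℂ H x).continuous

theorem rankOne_mem_nestAlgebra {x y : H} (h : ∀ M ∈ N, x ∈ M ∨ y ∈ Mᗮ) :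
    rankOne ℂ x y ∈ nestAlgebra N := fun M hM z hz => by
  rw [rankOne_apply]
  rcases h M hM with hx | hy
  · exact M.smul_mem _ hx
  · rw [inner_eq_zero_symm.1 (hy z hz), zero_smul]
    exact M.zero_mem

variable [CompleteSpace H]

/-- A nonzero element of a nest has an immediate predecessor or is the limit from below of the
smaller elements. -/
theorem exists_pred_or_tendsto (hN : IsNest N) {s : Submodule ℂ H} (hs : s ∈ N) :
    (∃ p ∈ N, p < s ∧ ∀ M ∈ N, M < s → M ≤ p) ∨
      ∀ x, Tendsto (fun M : {M // M ∈ N ∧ M < s} => closureProj M.1 x) atTop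
        (𝓝 (closureProj s x)) := by
  set p := (⨆ M : {M // M ∈ N ∧ M < s}, M.1).topologicalClosure with hp
  have hp' : p = (sSup {M | M ∈ N ∧ M < s}).topologicalClosure := by
    rw [hp, sSup_eq_iSup']
    rfl
  have hpN : p ∈ N := hp' ▸ hN.closure_sSup_mem _ fun M hM => hM.1
  have hle : ∀ M ∈ N, M < s → M ≤ p := fun M hM hMs =>
    (le_iSup (fun M : {M // M ∈ N ∧ M < s} => M.1) ⟨M, hM, hMs⟩).trans
      (Submodule.le_topologicalClosure _)
  have hps : p ≤ s :=
    Submodule.topologicalClosure_minimal _ (iSup_le fun M => M.2.2.le) (hN.isClosed s hs)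
  rcases hps.eq_or_lt with h | h
  · right
    intro x
    have e : closureProj s = closureProj (⨆ M : {M // M ∈ N ∧ M < s}, M.1) := by
      refine closureProj_congr ?_
      rw [← hp, h, (hN.isClosed s hs).submodule_topologicalClosure_eq]
    rw [e]
    exact tendsto_closureProj_iSup (V := fun M : {M // M ∈ N ∧ M < s} => M.1) (fun M M' h => h) x
  · exact .inl ⟨p, hpN, h, hle⟩

/-- A proper element of a nest has an immediate successor or is the limit from above of the larger
elements. -/
theorem exists_succ_or_tendsto (hN : IsNest N) (s : Submodule ℂ H) :
    (∃ p ∈ N, s < p ∧ ∀ M ∈ N, s < M → p ≤ M) ∨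
      ∀ x, Tendsto (fun M : {M // M ∈ N ∧ s < M} => closureProj M.1 x) atBot
        (𝓝 (closureProj s x)) := by
  have hpN : sInf {M | M ∈ N ∧ s < M} ∈ N := hN.sInf_mem _ fun M hM => hM.1
  have hps : s ≤ sInf {M | M ∈ N ∧ s < M} := le_sInf fun M hM => hM.2.le
  rcases hps.eq_or_lt with h | h
  · right
    intro x
    have e : s = ⨅ M : {M // M ∈ N ∧ s < M}, M.1 := by
      conv_lhs => rw [h, sInf_eq_iInf']
      rfl
    have h1 := tendsto_closureProj_iInf (V := fun M : {M // M ∈ N ∧ s < M} => M.1)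
      (fun M M' h => h) (fun M => hN.isClosed _ M.2.1) x
    rwa [← e] at h1
  · exact .inl ⟨_, hpN, h, fun M hM hMs => sInf_le ⟨hM, hMs⟩⟩

theorem closureProj_mem_nestAlgebra (hN : IsNest N) {M : Submodule ℂ H} (hM : M ∈ N) :
    closureProj M ∈ nestAlgebra N := fun M' hM' x hx => by
  rcases hN.le_total hM hM' with h | h
  · exact h (closureProj_apply_mem (hN.isClosed M hM) x)
  · rwa [closureProj_apply_of_mem (h hx)]

theorem mem_nestAlgebra_iff (hN : IsNest N) {T : H →L[ℂ] H} :
    T ∈ nestAlgebra N ↔ ∀ M ∈ N, (1 - closureProj M) * T * closureProj M = 0 := by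
  refine ⟨fun hT M hM => ?_, fun h M hM x hx => ?_⟩
  · ext x
    have := closureProj_apply_of_mem
      (hT M hM (closureProj M x) (closureProj_apply_mem (hN.isClosed M hM) x))
    simp [this]
  · have := congrArg (fun S : H →L[ℂ] H => S x) (h M hM)
    simp only [mul_apply_eq_comp, sub_apply, one_apply_eq_self, zero_apply,
      closureProj_apply_of_mem hx] at this
    rw [sub_eq_zero] at this
    rw [this]
    exact closureProj_apply_mem (hN.isClosed M hM) _

/-- Membership is the system of equations `(1-P) T P = 0`, each weakly continuous in `T`. -/
theorem mem_nestAlgebra_of_tendstoWOT (hN : IsNest N) {ι : Type*} {l : Filter ι} [l.NeBot]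
    {f : ι → H →L[ℂ] H} {T : H →L[ℂ] H} (h : TendstoWOT f l T)
    (hf : ∀ᶠ i in l, f i ∈ nestAlgebra N) : T ∈ nestAlgebra N := by
  refine hN.mem_nestAlgebra_iff.2 fun M hM => ?_
  refine (((h.const_mul (1 - closureProj M)).mul_const (closureProj M)).unique ?_)
  exact (TendstoWOT.of_tendsto tendsto_const_nhds).congr'
    (hf.mono fun i hi => (hN.mem_nestAlgebra_iff.1 hi M hM).symm)

theorem exists_unit_mem_orthogonal {M : Submodule ℂ H} (hM : IsClosed (M : Set H)) (h : M ≠ ⊤) :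
    ∃ y ∈ Mᗮ, ‖y‖ = 1 := by
  have h1 : Mᗮ ≠ ⊥ := fun h' => h (by
    have := Submodule.orthogonal_orthogonal_eq_closure M
    rw [h', Submodule.bot_orthogonal_eq_top, hM.submodule_topologicalClosure_eq] at this
    exact this.symm)
  obtain ⟨y, hy, hy0⟩ := Submodule.exists_mem_ne_zero_of_ne_bot h1
  exact ⟨_, Mᗮ.smul_mem ((‖y‖⁻¹ : ℝ) : ℂ) hy, by
    rw [norm_smul, Complex.norm_real, norm_inv, norm_norm, inv_mul_cancel₀ (norm_ne_zero_iff.2 hy0)]⟩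

/-- Every closed invariant subspace of a nest algebra other than the whole space is annihilated
by some rank one operator of the algebra. -/
theorem exists_rankOne_annihilator (hN : IsNest N) {L : Submodule ℂ H} (hL : IsClosed (L : Set H))
    (hL' : L ≠ ⊤) (hinv : ∀ b ∈ nestAlgebra N, ∀ x ∈ L, b x ∈ L) :
    ∃ x y : H, x ≠ 0 ∧ y ≠ 0 ∧ y ∈ Lᗮ ∧ rankOne ℂ x y ∈ nestAlgebra N := by
  obtain ⟨y, hy, hy1⟩ := exists_unit_mem_orthogonal hL hL'
  have hy0 : y ≠ 0 := fun h => by simp [h] at hy1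
  -- If `y` lies in every nonzero member, `y ⊗ y` works. If a nonzero `M` omits `y`, use `x ⊗ (1 -
  -- P_M) y` with `x ∈ M`. Here `(1 - P_M) y` is still orthogonal to `L`, because `P_M` belongs to
  -- the algebra and so preserves `L`.
  by_cases hall : ∀ M ∈ N, M ≠ ⊥ → y ∈ M
  · refine ⟨y, y, hy0, hy0, hy, rankOne_mem_nestAlgebra fun M hM => ?_⟩
    by_cases hM0 : M = ⊥
    · right
      rw [hM0, Submodule.bot_orthogonal_eq_top]
      trivial
    · exact .inl (hall M hM hM0)
  · push Not at hall
    obtain ⟨M, hM, hM0, hyM⟩ := hall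
    obtain ⟨x, hx, hx0⟩ := Submodule.exists_mem_ne_zero_of_ne_bot hM0
    refine ⟨x, y - closureProj M y, hx0, fun h => hyM ?_, ?_,
      rankOne_mem_nestAlgebra fun M' hM' => ?_⟩
    · rw [sub_eq_zero.1 h]
      exact closureProj_apply_mem (hN.isClosed M hM) y
    · intro z hz
      rw [inner_sub_right, ← closureProj_inner, hy z hz,
        hy _ (hinv _ (hN.closureProj_mem_nestAlgebra hM) z hz), sub_zero]
    · rcases hN.le_total hM hM' with h | h
      · exact .inl (h hx)
      · exact .inr (Submodule.orthogonal_le h (sub_closureProj_mem_orthogonal M y))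

/-- The operator `x ⊗ y` is in the algebra when some member contains `x` and all strictly smaller
members are orthogonal to `y`, or more simply when `x ∈ M` and `y ⊥ M`. If the proper members have
dense union, they form the family, with `y ⊥ M`. If not, one `y` orthogonal to all proper members
serves every `x`, and `⊤` alone suffices. -/
theorem exists_hasRankOnes [Nontrivial H] (hN : IsNest N) :
    ∃ 𝓜, HasRankOnes (nestAlgebra N) 𝓜 := by
  by_cases hd : (sSup {M | M ∈ N ∧ M ≠ ⊤}).topologicalClosure = ⊤
  · have hchain : IsChain (· ≤ ·) {M | M ∈ N ∧ M ≠ ⊤} :=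
      hN.isChain.mono fun M hM => hM.1
    have hne : ({M | M ∈ N ∧ M ≠ ⊤} : Set (Submodule ℂ H)).Nonempty := ⟨⊥, hN.bot_mem, bot_ne_top⟩
    refine ⟨{M | M ∈ N ∧ M ≠ ⊤}, hne, hchain, fun M hM => hN.isClosed M hM.1, ?_,
      fun M hM b hb => hb M hM.1, fun M hM => ?_, fun L hL hL' hinv =>
      hN.exists_rankOne_annihilator hL hL' hinv⟩
    · have h1 : {x : H | ∃ M ∈ {M | M ∈ N ∧ M ≠ ⊤}, x ∈ M}
          = (sSup {M | M ∈ N ∧ M ≠ ⊤} : Submodule ℂ H) := by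
        ext x
        exact (Submodule.mem_sSup_of_directed hne hchain.directedOn).symm
      rw [h1]
      intro x
      exact hd.ge (Submodule.mem_top (x := x))
    · obtain ⟨y, hy, hy1⟩ := exists_unit_mem_orthogonal (hN.isClosed M hM.1) hM.2
      refine ⟨y, hy1, fun x hx => rankOne_mem_nestAlgebra fun M' hM' => ?_⟩
      rcases hN.le_total hM.1 hM' with h | h
      · exact .inl (h hx)
      · exact .inr (Submodule.orthogonal_le h hy)
  · have hmem := hN.closure_sSup_mem {M | M ∈ N ∧ M ≠ ⊤} fun M hM => hM.1
    obtain ⟨y, hy, hy1⟩ := exists_unit_mem_orthogonal (hN.isClosed _ hmem) hd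
    refine ⟨{⊤}, Set.singleton_nonempty _, Set.subsingleton_singleton.isChain, ?_, ?_, ?_, ?_,
      fun L hL hL' hinv => hN.exists_rankOne_annihilator hL hL' hinv⟩
    · rintro M rfl
      exact isClosed_univ
    · simp
    · rintro M rfl b hb x -
      trivial
    · rintro M rfl
      refine ⟨y, hy1, fun x _ => rankOne_mem_nestAlgebra fun M hM => ?_⟩
      by_cases hMt : M = ⊤
      · exact .inl (hMt ▸ trivial)
      · exact .inr (Submodule.orthogonal_le
          ((le_sSup (show M ∈ {M | M ∈ N ∧ M ≠ ⊤} from ⟨hM, hMt⟩)).trans (Submodule.le_topologicalClosure _)) hy)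

/-- A bounded operator inducing a derivation of a nest algebra belongs to it. -/
theorem mem_nestAlgebra_of_commutator (hN : IsNest N) {k : H →L[ℂ] H}
    (hk : ∀ b ∈ nestAlgebra N, k * b - b * k ∈ nestAlgebra N) : k ∈ nestAlgebra N := by
  refine hN.mem_nestAlgebra_iff.2 fun M hM => ?_
  have h1 := hN.mem_nestAlgebra_iff.1 (hk _ (hN.closureProj_mem_nestAlgebra hM)) M hM
  have h2 := closureProj_mul_self M
  calc (1 - closureProj M) * k * closureProj M
      = (1 - closureProj M) * k * (closureProj M * closureProj M)
        - (closureProj M - closureProj M * closureProj M) * k * closureProj M := by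
        rw [h2, sub_self, zero_mul, zero_mul, sub_zero]
    _ = (1 - closureProj M) * (k * closureProj M - closureProj M * k) * closureProj M := by
        noncomm_ring
    _ = 0 := h1

end IsNest

theorem isCompactOperator_rankOne (x y : H) : IsCompactOperator (rankOne ℂ x y) := by
  have h : IsCompactOperator (ContinuousLinearMap.toSpanSingleton ℂ x) := by
    refine ⟨_, (isCompact_closedBall (0 : ℂ) 1).image
      (ContinuousLinearMap.toSpanSingleton ℂ x).continuous, ?_⟩
    filter_upwards [Metric.closedBall_mem_nhds (0 : ℂ) one_pos] with c hc
    exact Set.mem_image_of_mem _ hc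
  rw [rankOne_def']
  exact h.comp_clm (innerSL ℂ y)

theorem nestAlgebra_le_quasiTriangularAlgebra : nestAlgebra N ≤ quasiTriangularAlgebra N :=
  fun T hT => ⟨T, hT, 0, isCompactOperator_zero, (add_zero T).symm⟩

theorem IsCompactOperator.mem_quasiTriangularAlgebra {K : H →L[ℂ] H} (hK : IsCompactOperator K) :
    K ∈ quasiTriangularAlgebra N :=
  ⟨0, zero_mem _, K, hK, (zero_add K).symm⟩

theorem hasRankOnes_quasiTriangularAlgebra [CompleteSpace H] [Nontrivial H] :
    HasRankOnes (quasiTriangularAlgebra N) {⊤} where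
  nonempty := Set.singleton_nonempty _
  isChain := Set.subsingleton_singleton.isChain
  isClosed := by
    rintro M rfl
    exact isClosed_univ
  dense := by simp
  invariant := by
    rintro M rfl b hb x -
    trivial
  exists_rankOne M _ := by
    obtain ⟨y, hy⟩ := exists_norm_eq H zero_le_one
    exact ⟨y, hy, fun x _ => (isCompactOperator_rankOne x y).mem_quasiTriangularAlgebra⟩
  exists_annihilator L hL hL' _ := by
    obtain ⟨y, hy, hy1⟩ := IsNest.exists_unit_mem_orthogonal hL hL'
    have hy0 : y ≠ 0 := fun h => by simp [h] at hy1
    exact ⟨y, y, hy0, hy0, hy, (isCompactOperator_rankOne y y).mem_quasiTriangularAlgebra⟩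

end Nest

/-! ### Parrott's completion theorem -/

section Parrott

variable {H : Type*} [NormedAddCommGroup H] [InnerProductSpace ℂ H] [CompleteSpace H]

open ContinuousLinearMap

theorem norm_sq_eq_add_closureProj (M : Submodule ℂ H) (x : H) :
    ‖x‖ ^ 2 = ‖closureProj M x‖ ^ 2 + ‖x - closureProj M x‖ ^ 2 := by
  have h : inner ℂ (closureProj M x) (x - closureProj M x) = 0 := by
    rw [closureProj_inner, map_sub]
    have := congrArg (fun S : H →L[ℂ] H => S x) (closureProj_mul_self M)
    simp only [mul_apply_eq_comp] at this
    rw [this, sub_self, inner_zero_right]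
  have := norm_add_sq_eq_norm_sq_add_norm_sq_of_inner_eq_zero _ _ h
  rw [add_sub_cancel] at this
  nlinarith

/-- Parrott's completion theorem: the missing corner of a partially defined operator, whose
specified row and column have norm at most `r`, can be filled in without increasing the norm.
Here `R` is the specified column, `B` is the rest of the specified row. -/
theorem exists_parrott_completion {M Q : Submodule ℂ H} {R B : H →L[ℂ] H} {r : ℝ}
    (hR : R * closureProj M = R) (hQB : closureProj Q * B = 0) (hBM : B * closureProj M = 0)
    (hRr : ‖R‖ ≤ r) (hLr : ‖(1 - closureProj Q) * R + B‖ ≤ r)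
    (hA : ‖(1 - closureProj Q) * R‖ < r) :
    ∃ X : H →L[ℂ] H, (1 - closureProj Q) * X = 0 ∧ X * closureProj M = 0 ∧ ‖R + B + X‖ ≤ r ∧
      (IsCompactOperator R → IsCompactOperator X) := by
  have hr : 0 < r := (norm_nonneg _).trans_lt hA
  set A := (1 - closureProj Q) * R with hAdef
  set C := closureProj Q * R with hCdef
  have hAM : A * closureProj M = A := by rw [hAdef, mul_assoc, hR]
  -- `D = (r² - A*A)⁻¹`, from a Neumann series; this is where `‖A‖ < r` must be strict. The explicit
  -- corner `-C D A* B` inherits compactness from `C`, which a weak limit argument would not give.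
  obtain ⟨D, hD⟩ : ∃ D : H →L[ℂ] H, ∀ v, (r ^ 2 : ℂ) • D v - adjoint A (A (D v)) = v := by
    have h1 : ‖((r : ℂ) ^ 2)⁻¹ • (adjoint A * A)‖ < 1 := by
      rw [norm_smul, norm_inv, norm_pow, Complex.norm_real, Real.norm_of_nonneg hr.le,
        inv_mul_lt_iff₀ (by positivity), mul_one]
      refine (norm_mul_le _ _).trans_lt ?_
      rw [LinearIsometryEquiv.norm_map]
      nlinarith [norm_nonneg A]
    obtain ⟨u, hu⟩ := isUnit_one_sub_of_norm_lt_one h1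
    have hr2 : (r : ℂ) ^ 2 ≠ 0 := pow_ne_zero _ (Complex.ofReal_ne_zero.2 hr.ne')
    refine ⟨((r : ℂ) ^ 2)⁻¹ • ((u⁻¹ : (H →L[ℂ] H)ˣ) : H →L[ℂ] H), fun v => ?_⟩
    have h2 := congrArg (fun S : H →L[ℂ] H => S v) u.mul_inv
    rw [hu] at h2
    simp only [mul_apply_eq_comp, sub_apply, one_apply_eq_self, smul_apply] at h2
    simp only [smul_apply, map_smul, smul_smul, mul_inv_cancel₀ hr2, one_smul]
    exact h2
  have hQQ : ∀ v, closureProj Q (closureProj Q v) = closureProj Q v := fun v =>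
    congrArg (fun S : H →L[ℂ] H => S v) (closureProj_mul_self Q)
  refine ⟨-(C * D * adjoint A * B), ?_, ?_, ?_, fun hc => ?_⟩
  · ext v
    simp [hCdef, hQQ]
  · rw [neg_mul, mul_assoc, hBM, mul_zero, neg_zero]
  · refine ContinuousLinearMap.opNorm_le_bound _ hr.le fun x => ?_
    set h := closureProj M x with hh
    set k := x - h with hk
    -- The completed operator sends `h + k` to `(A h + B k) + C (h - k')`, an orthogonal sum. The
    -- column bound at `h - k'` then controls the second summand.
    set k' := D (adjoint A (B k)) with hk'
    set g := B k + A k' with hg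
    have hQA : ∀ v, closureProj Q (A v) = 0 := fun v => by simp [hAdef, hQQ]
    have hQBv : ∀ v, closureProj Q (B v) = 0 := fun v =>
      congrArg (fun S : H →L[ℂ] H => S v) hQB
    have hQC : ∀ v, closureProj Q (C v) = C v := fun v => by simp [hCdef, hQQ]
    have hRAC : ∀ v, R v = A v + C v := fun v => by simp [hAdef, hCdef]
    have hRx : R x = R h := (congrArg (fun S : H →L[ℂ] H => S x) hR).symm
    have hBx : B x = B k := by
      have : B h = 0 := congrArg (fun S : H →L[ℂ] H => S x) hBM
      rw [hk, map_sub, this, sub_zero]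
    have hval : (R + B + -(C * D * adjoint A * B)) x = (A h + B k) + C (h - k') := by
      simp only [add_apply, _root_.neg_apply, mul_apply_eq_comp, hRx, hBx, hRAC h,
        map_sub]
      rw [← hk']
      abel
    have hQval : closureProj Q ((A h + B k) + C (h - k')) = C (h - k') := by
      rw [map_add, map_add, hQA, hQBv, hQC, zero_add, zero_add]
    have hn1 : ‖(A h + B k) + C (h - k')‖ ^ 2 = ‖A h + B k‖ ^ 2 + ‖C (h - k')‖ ^ 2 := by
      rw [norm_sq_eq_add_closureProj Q, hQval, add_sub_cancel_right, add_comm]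
    have hn2 : ‖A (h - k')‖ ^ 2 + ‖C (h - k')‖ ^ 2 ≤ r ^ 2 * ‖h - k'‖ ^ 2 := by
      have h1 : ‖R (h - k')‖ ^ 2 = ‖C (h - k')‖ ^ 2 + ‖A (h - k')‖ ^ 2 := by
        rw [norm_sq_eq_add_closureProj Q, hRAC, map_add, hQA, hQC, zero_add, add_sub_cancel_right]
      have h2 := R.le_of_opNorm_le hRr (h - k')
      rw [add_comm, ← h1, ← mul_pow]
      gcongr
    have hDk : (r ^ 2 : ℂ) • k' - adjoint A (A k') = adjoint A (B k) := hD _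
    have hcross : inner ℂ (A h) (B k) = (r ^ 2 : ℂ) * inner ℂ h k' - inner ℂ (A h) (A k') := by
      rw [← adjoint_inner_right, ← hDk, inner_sub_right, inner_smul_right, adjoint_inner_right]
    have hAg : adjoint A g = (r ^ 2 : ℂ) • k' := by
      rw [hg, map_add, ← hDk, sub_add_cancel]
    have hs : (inner ℂ g (B k)).re = ‖B k‖ ^ 2 + r ^ 2 * ‖k'‖ ^ 2 - ‖A k'‖ ^ 2 := by
      have h1 : inner ℂ (A k') (B k) = (r ^ 2 : ℂ) * inner ℂ k' k' - inner ℂ (A k') (A k') := by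
        rw [← adjoint_inner_right, ← hDk, inner_sub_right, inner_smul_right, adjoint_inner_right]
      rw [hg, inner_add_left, h1]
      simp only [inner_self_eq_norm_sq_to_K]
      norm_cast
      simp only [Complex.coe_algebraMap, ← Complex.ofReal_mul,
        Complex.ofReal_re, ← Complex.ofReal_sub, ← Complex.ofReal_add]
      ring
    -- The adjoint form of the row bound: `A* g` and `B* g` are orthogonal, and `A* g = r² k'` by
    -- the choice of `D`. Together with Cauchy-Schwarz this bounds `Re ⟨g, B k⟩` by `r² ‖k‖²`.
    have hBg : ‖adjoint B g‖ ^ 2 ≤ r ^ 2 * (inner ℂ g (B k)).re := by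
      have h1 : ‖adjoint (A + B) g‖ ≤ r * ‖g‖ :=
        le_of_opNorm_le _ (by rw [LinearIsometryEquiv.norm_map]; exact hLr) g
      have hPA : closureProj M (adjoint A g) = adjoint A g := by
        have := congrArg adjoint hAM
        change adjoint (A.comp (closureProj M)) = _ at this
        rw [adjoint_comp, adjoint_closureProj] at this
        exact congrArg (fun S : H →L[ℂ] H => S g) this
      have hPB : closureProj M (adjoint B g) = 0 := by
        have := congrArg adjoint hBM
        change adjoint (B.comp (closureProj M)) = _ at this
        rw [adjoint_comp, adjoint_closureProj, map_zero] at this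
        exact congrArg (fun S : H →L[ℂ] H => S g) this
      have h2 : ‖adjoint (A + B) g‖ ^ 2 = ‖adjoint A g‖ ^ 2 + ‖adjoint B g‖ ^ 2 := by
        have e : adjoint (A + B) g = adjoint A g + adjoint B g := by rw [map_add adjoint A B]; rfl
        rw [norm_sq_eq_add_closureProj M, e, map_add, hPA, hPB, add_zero, add_sub_cancel_left]
      have h3 : ‖adjoint A g‖ ^ 2 = r ^ 2 * (inner ℂ g (A k')).re := by
        have : inner ℂ (adjoint A g) (adjoint A g) = (r ^ 2 : ℂ) * inner ℂ g (A k') := by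
          calc inner ℂ (adjoint A g) (adjoint A g) = inner ℂ (adjoint A g) ((r ^ 2 : ℂ) • k') :=
                congrArg _ hAg
            _ = _ := by rw [inner_smul_right, adjoint_inner_left]
        rw [inner_self_eq_norm_sq_to_K] at this
        have h4 := congrArg Complex.re this
        rw [← Complex.ofReal_pow, Complex.re_ofReal_mul] at h4
        rw [← h4]
        norm_cast
      have h5 : ‖g‖ ^ 2 = (inner ℂ g (B k)).re + (inner ℂ g (A k')).re := by
        rw [← Complex.add_re, ← inner_add_right, ← hg, inner_self_eq_norm_sq_to_K]
        norm_cast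
      have h6 : ‖adjoint (A + B) g‖ ^ 2 ≤ r ^ 2 * ‖g‖ ^ 2 := by
        rw [← mul_pow]
        gcongr
      rw [h2, h3, h5] at h6
      linarith
    have hs0 : 0 ≤ (inner ℂ g (B k)).re := by
      by_contra hneg
      push Not at hneg
      nlinarith [sq_nonneg ‖adjoint B g‖, mul_pos (pow_pos hr 2) (neg_pos.2 hneg)]
    have hsk : (inner ℂ g (B k)).re ≤ r ^ 2 * ‖k‖ ^ 2 := by
      have h1 : (inner ℂ g (B k)).re ≤ ‖adjoint B g‖ * ‖k‖ := by
        rw [← adjoint_inner_left]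
        exact (Complex.re_le_norm _).trans (norm_inner_le_norm _ _)
      have h2 : (inner ℂ g (B k)).re ^ 2 ≤ r ^ 2 * (inner ℂ g (B k)).re * ‖k‖ ^ 2 := by
        calc (inner ℂ g (B k)).re ^ 2 ≤ (‖adjoint B g‖ * ‖k‖) ^ 2 := by gcongr
          _ = ‖adjoint B g‖ ^ 2 * ‖k‖ ^ 2 := by ring
          _ ≤ _ := by gcongr
      rcases hs0.eq_or_lt with h0 | h0
      · rw [← h0]; positivity
      · nlinarith
    -- The mixed terms in `h` and `k'` cancel; this is the purpose of the choice of `k'`.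
    have hsum : ‖A h + B k‖ ^ 2 + (r ^ 2 * ‖h - k'‖ ^ 2 - ‖A (h - k')‖ ^ 2)
        = r ^ 2 * ‖h‖ ^ 2 + (inner ℂ g (B k)).re := by
      have e1 := congrArg Complex.re hcross
      rw [← Complex.ofReal_pow, Complex.sub_re, Complex.re_ofReal_mul] at e1
      rw [map_sub A h k', @norm_add_sq ℂ _ _ _ _ (A h) (B k), @norm_sub_sq ℂ _ _ _ _ h k',
        @norm_sub_sq ℂ _ _ _ _ (A h) (A k'), hs]
      simp only [RCLike.re_to_complex]
      rw [e1]
      ring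
    have hfin : ‖(R + B + -(C * D * adjoint A * B)) x‖ ^ 2 ≤ (r * ‖x‖) ^ 2 := by
      rw [hval, hn1, mul_pow, norm_sq_eq_add_closureProj M x]
      nlinarith
    exact le_of_sq_le_sq hfin (by positivity)
  · have h1 : IsCompactOperator C := hc.clm_comp (closureProj Q)
    exact ((h1.comp_clm (D * adjoint A * B))).neg

end Parrott

/-! ### Arveson's distance formula, its compact version, and norm closedness -/

section Distance

variable {H : Type*} [NormedAddCommGroup H] [InnerProductSpace ℂ H] [CompleteSpace H]

theorem one_sub_mul_of_le {M M' : Submodule ℂ H} (h : M ≤ M') :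
    (1 - closureProj M') * (1 - closureProj M) = 1 - closureProj M' := by
  have := mul_closureProj_of_le h
  rw [mul_sub, mul_one, sub_mul, one_mul, this, sub_self, sub_zero]

theorem one_sub_mul_closureProj_of_le {M M' : Submodule ℂ H} (h : M ≤ M') :
    (1 - closureProj M') * closureProj M = 0 := by
  rw [sub_mul, one_mul, mul_closureProj_of_le h, sub_self]

theorem norm_one_sub_closureProj_le (M : Submodule ℂ H) : ‖1 - closureProj M‖ ≤ 1 := by
  rw [← closureProj_orthogonal]
  exact norm_closureProj_le _

theorem norm_mul_closureProj_le (T : H →L[ℂ] H) (M : Submodule ℂ H) :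
    ‖T * closureProj M‖ ≤ ‖T‖ :=
  (norm_mul_le _ _).trans (mul_le_of_le_one_right (norm_nonneg _) (norm_closureProj_le M))

theorem norm_one_sub_closureProj_mul_le (T : H →L[ℂ] H) (M : Submodule ℂ H) :
    ‖(1 - closureProj M) * T‖ ≤ ‖T‖ :=
  (norm_mul_le _ _).trans
    (mul_le_of_le_one_left (norm_nonneg _) (norm_one_sub_closureProj_le M))

/-- `K` has a correction of norm at most `r`, living on `b`, which makes it leave all members of
`F` inside `b` invariant. -/
def HasCorrection (F : Set (Submodule ℂ H)) (K : H →L[ℂ] H) (r : ℝ) (b : Submodule ℂ H) : Prop :=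
  ∃ C : H →L[ℂ] H, C * closureProj b = C ∧ ‖C‖ ≤ r ∧
    (∀ M ∈ F, (1 - closureProj M) * (K - C) * (closureProj b * closureProj M) = 0) ∧
    (IsCompactOperator K → IsCompactOperator C)

theorem hasCorrection_bot (F : Set (Submodule ℂ H)) (K : H →L[ℂ] H) {r : ℝ} (hr : 0 ≤ r) :
    HasCorrection F K r ⊥ :=
  ⟨0, zero_mul _, by simpa using hr, fun M _ => by rw [closureProj_bot, zero_mul, mul_zero],
    fun _ => isCompactOperator_zero⟩

/-- Parrott's theorem with the old correction as column. The rest of the row is dictated by the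
requirement that `K - C` map `b'` into `q`, which settles all members of `F` above `b`. The bound
`r` does not grow. Across a jump one takes `q = b'`; at a limit, `q = b`. -/
theorem HasCorrection.extend {F : Set (Submodule ℂ H)} (hF : IsChain (· ≤ ·) F) {K : H →L[ℂ] H}
    {r : ℝ} {b q b' : Submodule ℂ H} (hb : b ∈ F) (hbb' : b ≤ b') (hbq : b ≤ q)
    (hq : ∀ M ∈ F, b < M → q ≤ M) (h1 : ‖(1 - closureProj q) * K * closureProj b'‖ ≤ r)
    (h2 : ‖(1 - closureProj q) * K * closureProj b‖ < r) (h : HasCorrection F K r b) :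
    HasCorrection F K r b' := by
  obtain ⟨C, hC, hCr, hCF, hCc⟩ := h
  set P := closureProj b with hP
  set P' := closureProj b' with hP'
  set Q := closureProj q with hQ
  have hPP : P * P = P := closureProj_mul_self b
  have hP'P : P' * P = P := mul_closureProj_of_le hbb'
  have hP'P' : P' * P' = P' := closureProj_mul_self b'
  have hQQ : Q * Q = Q := closureProj_mul_self q
  have hPP' : P * P' = P := closureProj_mul_of_le hbb'
  have e1 : (1 - Q) * C = (1 - Q) * K * P := by
    have h3 := hCF b hb
    rw [← hP, hPP, mul_assoc] at h3
    have h4 : (1 - Q) * (K - C) * P = 0 := by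
      rw [← one_sub_mul_of_le hbq, ← hP, mul_assoc, mul_assoc, h3, mul_zero]
    rw [mul_sub, sub_mul, mul_assoc (1 - Q) C, hC, sub_eq_zero] at h4
    exact h4.symm
  have hQ1 : Q * (1 - Q) = 0 := by rw [mul_sub, mul_one, hQQ, sub_self]
  have e2 : (1 - Q) * C + (1 - Q) * K * (P' - P) = (1 - Q) * K * P' := by
    rw [e1, mul_sub]
    abel
  have hBP : (1 - Q) * K * (P' - P) * P = 0 := by
    rw [mul_assoc, sub_mul P' P P, hP'P, hPP, sub_self, mul_zero]
  obtain ⟨X, hX1, hX2, hX3, hX4⟩ := exists_parrott_completion (M := b) (Q := q) (R := C)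
    (B := (1 - Q) * K * (P' - P)) (r := r) hC (by rw [← hQ, ← mul_assoc, ← mul_assoc, hQ1, zero_mul, zero_mul])
    hBP hCr (by rw [← hQ, e2]; exact h1) (by rw [← hQ, e1]; exact h2)
  refine ⟨(C + (1 - Q) * K * (P' - P) + X) * P', ?_, (norm_mul_closureProj_le _ _).trans hX3,
    fun M hM => ?_, fun hK => ?_⟩
  · rw [mul_assoc, hP'P']
  · have h3 : (C + (1 - Q) * K * (P' - P) + X) * P' * P = C := by
      rw [mul_assoc, hP'P, add_mul, add_mul, hC, hBP, hX2, add_zero, add_zero]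
    by_cases hMb : M ≤ b
    · have hPM : P * closureProj M = closureProj M := mul_closureProj_of_le hMb
      have h4 : (C + (1 - Q) * K * (P' - P) + X) * P' * closureProj M = C * closureProj M := by
        rw [← hPM, ← mul_assoc, h3, ← mul_assoc C, hC]
      have h5 := hCF M hM
      rw [hPM, mul_assoc, sub_mul K, ← h4, ← sub_mul K, ← mul_assoc] at h5
      rw [mul_closureProj_of_le (hMb.trans hbb')]
      exact h5
    · have hqM : q ≤ M := hq M hM (lt_of_le_not_ge ((hF.total hM hb).resolve_left hMb) hMb)
      have h4 : (1 - Q) * (K - (C + (1 - Q) * K * (P' - P) + X) * P') * P' = 0 := by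
        have h5 : (1 - Q) * (C + (1 - Q) * K * (P' - P) + X) = (1 - Q) * K * P' := by
          have : (1 - Q) * ((1 - Q) * K * (P' - P)) = (1 - Q) * K * (P' - P) := by
            rw [← mul_assoc, ← mul_assoc, one_sub_mul_of_le le_rfl]
          rw [mul_add, mul_add, hX1, add_zero, this, e2]
        rw [mul_sub, ← mul_assoc, h5, sub_mul]
        simp only [mul_assoc, hP'P', sub_self]
      rw [← one_sub_mul_of_le hqM, ← hQ, mul_assoc, mul_assoc, ← mul_assoc (K - _), ← mul_assoc (1 - Q),
        ← mul_assoc (1 - Q), h4, zero_mul, mul_zero]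
  · exact (((hCc hK).add ((hK.clm_comp (1 - Q)).comp_clm (P' - P))).add (hX4 (hCc hK))).comp_clm P'

theorem norm_one_sub_mul_closureProj_anti {K : H →L[ℂ] H} {b b' q : Submodule ℂ H} (h : b ≤ b') :
    ‖(1 - closureProj q) * K * closureProj b‖ ≤ ‖(1 - closureProj q) * K * closureProj b'‖ := by
  rw [← mul_closureProj_of_le h, ← mul_assoc]
  exact norm_mul_closureProj_le _ _

/-- Climb the finite chain from each member to the next. The gap between `ε` and `r` supplies the
strict inequality in Parrott's theorem. -/
theorem hasCorrection_of_finset {F : Finset (Submodule ℂ H)} (hF : IsChain (· ≤ ·) (F : Set (Submodule ℂ H)))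
    (h0 : ⊥ ∈ F) {K : H →L[ℂ] H} {ε r : ℝ} (hε : 0 ≤ ε) (hr : ε < r)
    (hK : ∀ M ∈ F, ‖(1 - closureProj M) * K * closureProj M‖ ≤ ε) (b : Submodule ℂ H) (hb : b ∈ F) :
    HasCorrection (F : Set (Submodule ℂ H)) K r b := by
  classical
  induction hn : (F.filter (· < b)).card using Nat.strong_induction_on generalizing b with
  | _ n ih =>
  by_cases hb0 : b = ⊥
  · rw [hb0]
    exact hasCorrection_bot _ _ (hε.trans hr.le)
  · have hne : (F.filter (· < b)).Nonempty := ⟨⊥, by simp [h0, bot_lt_iff_ne_bot, hb0]⟩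
    obtain ⟨p, hp⟩ := (F.filter (· < b)).exists_maximal hne
    obtain ⟨hpF, hpb⟩ := Finset.mem_filter.1 hp.1
    have hlt : (F.filter (· < p)).card < n := by
      rw [← hn]
      refine Finset.card_lt_card ⟨fun M hM => ?_, fun hsub => ?_⟩
      · rw [Finset.mem_filter] at hM ⊢
        exact ⟨hM.1, hM.2.trans hpb⟩
      · exact (Finset.mem_filter.1 (hsub hp.1)).2.ne rfl
    have h2 : ‖(1 - closureProj b) * K * closureProj b‖ ≤ ε := hK b hb
    refine (ih _ hlt p hpF rfl).extend hF (q := b) hpF hpb.le hpb.le (fun M hM hpM => ?_)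
      (h2.trans hr.le) ((norm_one_sub_mul_closureProj_anti hpb.le).trans_lt (h2.trans_lt hr))
    rcases hF.total hb hM with h | h
    · exact h
    · rcases h.eq_or_lt with h | h
      · exact h.ge
      · exact absurd (hp.2 (Finset.mem_filter.2 ⟨hM, h⟩) hpM.le) hpM.not_ge

/-- Arveson's distance formula. -/
theorem IsNest.exists_norm_le_sub_mem_nestAlgebra {N : Set (Submodule ℂ H)} (hN : IsNest N)
    {T : H →L[ℂ] H} {ε r : ℝ} (hr : ε < r)
    (hT : ∀ M ∈ N, ‖(1 - closureProj M) * T * closureProj M‖ ≤ ε) :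
    ∃ C : H →L[ℂ] H, ‖C‖ ≤ r ∧ T - C ∈ nestAlgebra N := by
  classical
  have hε : 0 ≤ ε := (norm_nonneg _).trans (hT ⊥ hN.bot_mem)
  have h1 : ∀ F : Finset N, ∃ C : H →L[ℂ] H, ‖C‖ ≤ r ∧
      ∀ M ∈ F, (1 - closureProj M.1) * (T - C) * closureProj M.1 = 0 := by
    intro F
    set G : Finset (Submodule ℂ H) := insert ⊥ (insert ⊤ (F.image Subtype.val)) with hG
    have hGN : ∀ M ∈ G, M ∈ N := by
      intro M hM
      simp only [hG, Finset.mem_insert, Finset.mem_image] at hM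
      rcases hM with rfl | rfl | ⟨M', -, rfl⟩
      exacts [hN.bot_mem, hN.top_mem, M'.2]
    obtain ⟨C, -, hC, hCG, -⟩ := hasCorrection_of_finset (F := G) (hN.isChain.mono hGN)
      (by simp [hG]) hε hr (fun M hM => hT M (hGN M hM)) ⊤ (by simp [hG])
    refine ⟨C, hC, fun M hM => ?_⟩
    have := hCG M.1 (by simp [hG, hM])
    rwa [closureProj_top, one_mul] at this
  choose C hC hCF using h1
  -- Along growing finite subsets of the nest, the equation for each fixed `M` holds eventually, so
  -- it survives in the weak limit.
  obtain ⟨D, hD, hlim⟩ := exists_tendstoWOT (Ultrafilter.of (atTop : Filter (Finset N)))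
    (f := C) (Eventually.of_forall hC)
  refine ⟨D, hD, hN.mem_nestAlgebra_iff.2 fun M hM => ?_⟩
  have h2 := (((TendstoWOT.of_tendsto (tendsto_const_nhds (x := T))).sub hlim).const_mul
    (1 - closureProj M)).mul_const (closureProj M)
  refine h2.unique ((TendstoWOT.of_tendsto tendsto_const_nhds).congr' ?_)
  refine (Ultrafilter.of_le (atTop : Filter (Finset N))) ?_
  filter_upwards [eventually_ge_atTop ({⟨M, hM⟩} : Finset N)] with F hF
  exact (hCF F ⟨M, hM⟩ (hF (Finset.mem_singleton_self _))).symm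

/-- A compact operator maps bounded nets of self-adjoint operators tending strongly to zero to
nets tending to zero in norm. -/
theorem IsCompactOperator.tendsto_norm_mul {K : H →L[ℂ] H} (hK : IsCompactOperator K) {ι : Type*}
    {l : Filter ι} {E : ι → H →L[ℂ] H} (hsa : ∀ i x y, inner ℂ (E i x) y = inner ℂ x (E i y))
    (hE : ∀ i, ‖E i‖ ≤ 1) (h0 : ∀ x, Tendsto (fun i => E i x) l (𝓝 0)) :
    Tendsto (fun i => ‖K * E i‖) l (𝓝 0) := by
  have hev : ∀ ε > 0, ∀ᶠ i in l, ‖K * E i‖ ≤ ε := by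
    intro ε hε
    by_contra hcon
    have hfr : ∃ᶠ i in l, ε < ‖K * E i‖ := by simpa [Filter.not_eventually] using hcon
    have : (l ⊓ 𝓟 {i | ε < ‖K * E i‖}).NeBot := frequently_mem_iff_neBot.1 hfr
    set U := Ultrafilter.of (l ⊓ 𝓟 {i | ε < ‖K * E i‖}) with hU
    have hUl : (U : Filter ι) ≤ l := (Ultrafilter.of_le _).trans inf_le_left
    have hUε : ∀ᶠ i in U, ε < ‖K * E i‖ :=
      ((Ultrafilter.of_le _).trans inf_le_right) (mem_principal_self _)
    have hx : ∀ i, ∃ x : H, ‖x‖ ≤ 1 ∧ (ε < ‖K * E i‖ → ε < ‖K (E i x)‖) := by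
      intro i
      by_cases hi : ε < ‖K * E i‖
      · obtain ⟨x, hx1, hx2⟩ := (K * E i).exists_lt_apply_of_lt_opNorm hi
        exact ⟨x, hx1.le, fun _ => hx2⟩
      · exact ⟨0, by simp, fun h => absurd h hi⟩
    choose x hx1 hx2 using hx
    obtain ⟨S, hS, hKS⟩ := hK.image_closedBall_subset_compact (f := (K : H →ₗ[ℂ] H)) 1
    have hmem : ∀ i, K (E i (x i)) ∈ S := fun i => hKS ⟨E i (x i), by
      rw [mem_closedBall_zero_iff]
      exact ((E i).le_of_opNorm_le (hE i) (x i)).trans (by simpa using hx1 i), rfl⟩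
    obtain ⟨y, -, hy⟩ := hS.ultrafilter_le_nhds (U.map fun i => K (E i (x i)))
      (tendsto_principal.2 (Eventually.of_forall hmem))
    have hy' : Tendsto (fun i => K (E i (x i))) U (𝓝 y) := hy
    have hεy : ε ≤ ‖y‖ := ge_of_tendsto hy'.norm (hUε.mono fun i hi => (hx2 i hi).le)
    have h1 : Tendsto (fun i => inner ℂ (K (E i (x i))) y) U (𝓝 (inner ℂ y y)) :=
      hy'.inner tendsto_const_nhds
    -- Here `⟨K E_i x_i, y⟩ = ⟨x_i, E_i K* y⟩ → 0`, so the norm limit `y` of `K E_i x_i` is zero,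
    -- although `‖y‖ ≥ ε`.
    have h2 : Tendsto (fun i => inner ℂ (K (E i (x i))) y) U (𝓝 0) := by
      refine squeeze_zero_norm (fun i => ?_)
        ((tendsto_zero_iff_norm_tendsto_zero.1 (h0 (ContinuousLinearMap.adjoint K y))).mono_left hUl)
      rw [← ContinuousLinearMap.adjoint_inner_right, hsa]
      exact (norm_inner_le_norm _ _).trans
        (mul_le_of_le_one_left (norm_nonneg _) (hx1 i))
    have h3 := inner_self_eq_zero.1 (tendsto_nhds_unique h1 h2)
    rw [h3, norm_zero] at hεy
    exact absurd hεy hε.not_ge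
  rw [Metric.tendsto_nhds]
  intro ε hε
  filter_upwards [hev (ε / 2) (half_pos hε)] with i hi
  rw [dist_zero_right, norm_norm]
  linarith

theorem norm_closureProj_sub_le {M M' : Submodule ℂ H} (h : M ≤ M') :
    ‖closureProj M' - closureProj M‖ ≤ 1 := by
  have : closureProj M' - closureProj M = (1 - closureProj M) * closureProj M' := by
    rw [sub_mul, one_mul, closureProj_mul_of_le h]
  rw [this]
  exact (norm_one_sub_closureProj_mul_le _ _).trans (norm_closureProj_le _)

theorem closureProj_sub_inner (M M' : Submodule ℂ H) (x y : H) :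
    inner ℂ ((closureProj M - closureProj M') x) y
      = inner ℂ x ((closureProj M - closureProj M') y) := by
  simp only [sub_apply, inner_sub_left, inner_sub_right, closureProj_inner]

namespace IsNest

variable {N : Set (Submodule ℂ H)}

/-- A compact operator is small in norm on short intervals of the nest next to a limit point. This
replaces the finite chain when `K` is compact. -/
theorem exists_norm_mul_closureProj_sub_lt_of_tendsto_left (hN : IsNest N) {s : Submodule ℂ H}
    (hs : s ≠ ⊥) {K : H →L[ℂ] H} (hK : IsCompactOperator K) {ε : ℝ} (hε : 0 < ε)
    (h : ∀ x, Tendsto (fun M : {M // M ∈ N ∧ M < s} => closureProj M.1 x) atTop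
      (𝓝 (closureProj s x))) :
    ∃ a ∈ N, a < s ∧ ∀ M ∈ N, a ≤ M → M < s → ‖K * (closureProj s - closureProj M)‖ < ε := by
  have := hN.isDirectedOrder (· < s)
  have : Nonempty {M // M ∈ N ∧ M < s} := ⟨⊥, hN.bot_mem, bot_lt_iff_ne_bot.2 hs⟩
  have h1 := hK.tendsto_norm_mul (l := atTop)
    (E := fun M : {M // M ∈ N ∧ M < s} => closureProj s - closureProj M.1)
    (fun M => closureProj_sub_inner _ _) (fun M => norm_closureProj_sub_le M.2.2.le)
    (fun x => by simpa using (tendsto_const_nhds (x := closureProj s x)).sub (h x))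
  obtain ⟨a, ha⟩ := eventually_atTop.1 (h1.eventually_lt_const hε)
  exact ⟨a, a.2.1, a.2.2, fun M hM haM hMs => ha ⟨M, hM, hMs⟩ haM⟩

theorem exists_norm_mul_closureProj_sub_lt_of_tendsto_right (hN : IsNest N) {s : Submodule ℂ H}
    (hs : s ≠ ⊤) {K : H →L[ℂ] H} (hK : IsCompactOperator K) {ε : ℝ} (hε : 0 < ε)
    (h : ∀ x, Tendsto (fun M : {M // M ∈ N ∧ s < M} => closureProj M.1 x) atBot
      (𝓝 (closureProj s x))) :
    ∃ b ∈ N, s < b ∧ ∀ M ∈ N, M ≤ b → s < M → ‖K * (closureProj M - closureProj s)‖ < ε := by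
  have := hN.isCodirectedOrder (s < ·)
  have : Nonempty {M // M ∈ N ∧ s < M} := ⟨⊤, hN.top_mem, lt_top_iff_ne_top.2 hs⟩
  have h1 := hK.tendsto_norm_mul (l := atBot)
    (E := fun M : {M // M ∈ N ∧ s < M} => closureProj M.1 - closureProj s)
    (fun M => closureProj_sub_inner _ _) (fun M => norm_closureProj_sub_le M.2.2.le)
    (fun x => by simpa using (h x).sub (tendsto_const_nhds (x := closureProj s x)))
  obtain ⟨b, hb⟩ := eventually_atBot.1 (h1.eventually_lt_const hε)
  exact ⟨b, b.2.1, b.2.2, fun M hM hMb hsM => hb ⟨M, hM, hsM⟩ hMb⟩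

/-- The compact version of Arveson's distance formula. -/
theorem exists_isCompactOperator_sub_mem_nestAlgebra (hN : IsNest N) {K : H →L[ℂ] H}
    (hK : IsCompactOperator K) {ε r : ℝ} (hr : ε < r)
    (hKN : ∀ M ∈ N, ‖(1 - closureProj M) * K * closureProj M‖ ≤ ε) :
    ∃ C : H →L[ℂ] H, IsCompactOperator C ∧ ‖C‖ ≤ r ∧ K - C ∈ nestAlgebra N := by
  have hε : 0 ≤ ε := (norm_nonneg _).trans (hKN ⊥ hN.bot_mem)
  have hle : ∀ M ∈ N, ∀ b, b ≤ M → ‖(1 - closureProj M) * K * closureProj b‖ ≤ ε :=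
    fun M hM b hb => (norm_one_sub_mul_closureProj_anti hb).trans (hKN M hM)
  -- At a limit point there is no next member, so the row is measured against `b` itself; it exceeds
  -- `ε` only by the norm of `K` on the interval `[b, b']`.
  have hjump : ∀ {b b' : Submodule ℂ H}, b ∈ N → b' ∈ N → b ≤ b' →
      ‖K * (closureProj b' - closureProj b)‖ < r - ε →
      ‖(1 - closureProj b) * K * closureProj b'‖ ≤ r := by
    intro b b' hb hb' h hlt
    have e : (1 - closureProj b) * K * closureProj b' = (1 - closureProj b) * K * closureProj b
        + (1 - closureProj b) * (K * (closureProj b' - closureProj b)) := by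
      rw [mul_sub K, mul_sub (1 - closureProj b), mul_assoc, mul_assoc]
      abel
    rw [e]
    have h1 := (norm_one_sub_closureProj_mul_le (K * (closureProj b' - closureProj b)) b).trans
      hlt.le
    linarith [norm_add_le ((1 - closureProj b) * K * closureProj b)
      ((1 - closureProj b) * (K * (closureProj b' - closureProj b))), hKN b hb]
  have h : HasCorrection N K r ⊤ := by
    refine hN.induction_top (hasCorrection_bot N K (hε.trans hr.le)) (fun s hs hs0 => ?_)
      (fun s hs hst hΦ => ?_)
    · rcases hN.exists_pred_or_tendsto hs with ⟨p, hp, hps, hmax⟩ | hlim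
      · refine ⟨p, hp, hps, fun a' ha' hpa has hΦ => hΦ.extend hN.isChain (q := s) ha' has.le has.le
          (fun M hM haM => ?_) ((hle s hs s le_rfl).trans hr.le) ((hle s hs a' has.le).trans_lt hr)⟩
        exact hN.le_of_not_lt hM hs fun h => ((hmax M hM h).trans hpa).not_gt haM
      · obtain ⟨a, ha, has, hlt⟩ :=
          hN.exists_norm_mul_closureProj_sub_lt_of_tendsto_left hs0 hK (sub_pos.2 hr) hlim
        exact ⟨a, ha, has, fun a' ha' haa has' hΦ => hΦ.extend hN.isChain (q := a') ha' has'.le le_rfl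
          (fun M _ h => h.le) (hjump ha' hs has'.le (hlt a' ha' haa has'))
          ((hle a' ha' a' le_rfl).trans_lt hr)⟩
    · rcases hN.exists_succ_or_tendsto s with ⟨p, hp, hsp, hmin⟩ | hlim
      · exact ⟨p, hp, hsp, hΦ.extend hN.isChain (q := p) hs hsp.le hsp.le hmin
          ((hle p hp p le_rfl).trans hr.le) ((hle p hp s hsp.le).trans_lt hr)⟩
      · obtain ⟨b, hb, hsb, hlt⟩ :=
          hN.exists_norm_mul_closureProj_sub_lt_of_tendsto_right hst hK (sub_pos.2 hr) hlim
        exact ⟨b, hb, hsb, hΦ.extend hN.isChain (q := s) hs hsb.le le_rfl (fun M _ h => h.le)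
          (hjump hs hb hsb.le (hlt b hb le_rfl hsb)) ((hle s hs s le_rfl).trans_lt hr)⟩
  obtain ⟨C, -, hC, hCN, hCK⟩ := h
  refine ⟨C, hCK hK, hC, hN.mem_nestAlgebra_iff.2 fun M hM => ?_⟩
  have := hCN M hM
  rwa [closureProj_top, one_mul] at this

/-- The quasi-triangular algebra of a nest is norm closed. -/
theorem isClosed_quasiTriangularAlgebra (hN : IsNest N) :
    IsClosed (quasiTriangularAlgebra N : Set (H →L[ℂ] H)) := by
  refine isClosed_of_closure_subset fun T hT => ?_
  -- Write `T` as a series of quasi-triangular `v n` with geometrically small norms. The compact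
  -- parts can be chosen comparably small, so they sum to a compact operator and the remainders to a
  -- triangular one. The term `n = 0` has no norm bound.
  obtain ⟨v, hv, hvQ, -, hvb⟩ := controlled_sum_of_mem_closure
    (s := (quasiTriangularAlgebra N).toSubring.toAddSubgroup) (a := T) hT
    (b := fun n => (1 / 2) ^ n) (fun n => by positivity)
  have h1 : ∀ n, ∃ C : H →L[ℂ] H, IsCompactOperator C ∧ (0 < n → ‖C‖ ≤ 2 * (1 / 2) ^ n) ∧
      v n - C ∈ nestAlgebra N := by
    intro n
    obtain ⟨S, hS, K, hK, hSK⟩ := hvQ n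
    have h2 : ∀ M ∈ N, ‖(1 - closureProj M) * K * closureProj M‖ ≤ ‖v n‖ := by
      intro M hM
      have : (1 - closureProj M) * K * closureProj M = (1 - closureProj M) * v n * closureProj M := by
        rw [hSK, mul_add, add_mul, hN.mem_nestAlgebra_iff.1 hS M hM, zero_add]
      rw [this]
      exact (norm_mul_closureProj_le _ _).trans (norm_one_sub_closureProj_mul_le _ _)
    have h3 : 0 < ((1 : ℝ) / 2) ^ n := by positivity
    obtain ⟨C, hC, hCn, hCN⟩ := hN.exists_isCompactOperator_sub_mem_nestAlgebra hK
      (lt_add_of_pos_right ‖v n‖ h3) h2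
    refine ⟨C, hC, fun hn => ?_, ?_⟩
    · linarith [hvb n hn]
    · rw [hSK, add_sub_assoc]
      exact add_mem hS hCN
  choose C hC hCn hCN using h1
  have hsum : Summable C := by
    refine Summable.of_norm_bounded_eventually_nat (g := fun n => 2 * (1 / 2 : ℝ) ^ n)
      (summable_geometric_two.mul_left 2) ?_
    filter_upwards [eventually_gt_atTop 0] with n hn using hCn n hn
  have hlim := hsum.hasSum.tendsto_sum_nat.comp (tendsto_add_atTop_nat 1)
  have hK : IsCompactOperator (∑' n, C n : H →L[ℂ] H) := by
    refine isCompactOperator_of_tendsto hlim (Eventually.of_forall fun n => ?_)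
    exact sum_mem (S := compactOperator (RingHom.id ℂ) H H) (f := C) fun i _ => hC i
  refine ⟨T - ∑' n, C n, ?_, _, hK, (sub_add_cancel _ _).symm⟩
  refine hN.isClosed_nestAlgebra.mem_of_tendsto (hv.sub hlim) (Eventually.of_forall fun n => ?_)
  simp only [Function.comp_apply]
  rw [← Finset.sum_sub_distrib]
  exact sum_mem fun i _ => hCN i

end IsNest

end Distance

/-! ### Disjoint lower blocks and commutators -/

section Humps

variable {H : Type*} [NormedAddCommGroup H] [InnerProductSpace ℂ H]

/-- Lower semicontinuity of the operator norm. -/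
theorem eventually_lt_norm_of_tendsto {ι : Type*} {l : Filter ι} {A : ι → H →L[ℂ] H}
    {B : H →L[ℂ] H} (h : ∀ x, Tendsto (fun i => A i x) l (𝓝 (B x))) {ε : ℝ} (hε : ε < ‖B‖) :
    ∀ᶠ i in l, ε < ‖A i‖ := by
  obtain ⟨x, hx1, hx2⟩ := B.exists_lt_apply_of_lt_opNorm hε
  filter_upwards [(h x).norm.eventually_const_lt hx2] with i hi
  refine hi.trans_le (((A i).le_opNorm x).trans ?_)
  exact mul_le_of_le_one_right (norm_nonneg _) hx1.le

theorem sum_range_mul_of_orthogonal {E : ℕ → H →L[ℂ] H} (hid : ∀ i, E i * E i = E i)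
    (horth : ∀ i j, i ≠ j → E i * E j = 0) (n j : ℕ) :
    (∑ i ∈ Finset.range n, E i) * E j = if j < n then E j else 0 := by
  rw [Finset.sum_mul]
  split_ifs with h
  · rw [Finset.sum_eq_single j (fun i _ hi => horth i j hi) (by simp [h]), hid]
  · exact Finset.sum_eq_zero fun i hi => horth i j (fun e => h (e ▸ Finset.mem_range.1 hi))

theorem norm_sum_range_le_one_of_orthogonal {E : ℕ → H →L[ℂ] H}
    (hsa : ∀ i x y, inner ℂ (E i x) y = inner ℂ x (E i y)) (hid : ∀ i, E i * E i = E i)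
    (horth : ∀ i j, i ≠ j → E i * E j = 0) (n : ℕ) : ‖∑ i ∈ Finset.range n, E i‖ ≤ 1 := by
  set Q := ∑ i ∈ Finset.range n, E i with hQ
  have hQQ : Q * Q = Q := by
    conv_lhs => rw [hQ, Finset.mul_sum]
    refine Finset.sum_congr rfl fun j hj => ?_
    rw [sum_range_mul_of_orthogonal hid horth, if_pos (Finset.mem_range.1 hj)]
  refine ContinuousLinearMap.opNorm_le_bound _ zero_le_one fun x => ?_
  have h1 : inner ℂ (Q x) (Q x) = inner ℂ x (Q x) := by
    have : inner ℂ (Q x) (Q x) = inner ℂ x (Q (Q x)) := by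
      simp only [hQ, sum_apply, sum_inner, hsa, inner_sum, map_sum]
    rw [this]
    exact congrArg (fun S : H →L[ℂ] H => inner ℂ x (S x)) hQQ
  have h2 : ‖Q x‖ * ‖Q x‖ ≤ ‖x‖ * ‖Q x‖ := by
    calc ‖Q x‖ * ‖Q x‖ = ‖inner ℂ (Q x) (Q x)‖ := by
          rw [inner_self_eq_norm_sq_to_K]
          simp [sq]
      _ ≤ _ := by
          rw [h1]
          exact norm_inner_le_norm _ _
  rw [one_mul]
  rcases (norm_nonneg (Q x)).eq_or_lt with h | h
  · rw [← h]
    exact norm_nonneg x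
  · exact le_of_mul_le_mul_right h2 h

/-- Bessel's inequality: the squares `‖E i x‖²` have sum at most `‖x‖²`. -/
theorem tendsto_zero_of_orthogonal {E : ℕ → H →L[ℂ] H}
    (hsa : ∀ i x y, inner ℂ (E i x) y = inner ℂ x (E i y)) (hid : ∀ i, E i * E i = E i)
    (horth : ∀ i j, i ≠ j → E i * E j = 0) (x : H) : Tendsto (fun i => E i x) atTop (𝓝 0) := by
  have h1 : ∀ i, ‖E i x‖ ^ 2 = (inner ℂ x (E i x)).re := fun i => by
    have : inner ℂ (E i x) (E i x) = inner ℂ x (E i x) := by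
      rw [hsa]
      exact congrArg (fun S : H →L[ℂ] H => inner ℂ x (S x)) (hid i)
    rw [← this, inner_self_eq_norm_sq_to_K]
    norm_cast
  have hs : Summable fun i => ‖E i x‖ ^ 2 := by
    refine summable_of_sum_range_le (c := ‖x‖ ^ 2) (fun i => by positivity) fun n => ?_
    have : ∑ i ∈ Finset.range n, ‖E i x‖ ^ 2
        = (inner ℂ x ((∑ i ∈ Finset.range n, E i) x)).re := by
      simp only [h1, sum_apply, inner_sum, Complex.re_sum]
    rw [this]
    refine (Complex.re_le_norm _).trans ((norm_inner_le_norm _ _).trans ?_)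
    rw [sq]
    gcongr
    simpa using ContinuousLinearMap.le_of_opNorm_le _
      (norm_sum_range_le_one_of_orthogonal hsa hid horth n) x
  have h2 := (hs.tendsto_atTop_zero).sqrt
  simp only [Real.sqrt_sq (norm_nonneg _), Real.sqrt_zero] at h2
  exact tendsto_zero_iff_norm_tendsto_zero.2 h2

variable [CompleteSpace H]

theorem closureProj_sub_mul_self {M M' : Submodule ℂ H} (h : M ≤ M') :
    (closureProj M' - closureProj M) * (closureProj M' - closureProj M)
      = closureProj M' - closureProj M := by
  rw [mul_sub, sub_mul, sub_mul, closureProj_mul_self, closureProj_mul_self,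
    closureProj_mul_of_le h, mul_closureProj_of_le h]
  abel

theorem closureProj_sub_mul_sub_eq_zero {a b c d : Submodule ℂ H} (hab : a ≤ b) (hbc : b ≤ c)
    (hcd : c ≤ d) :
    (closureProj b - closureProj a) * (closureProj d - closureProj c) = 0 := by
  rw [mul_sub, sub_mul, sub_mul, closureProj_mul_of_le (hbc.trans hcd),
    closureProj_mul_of_le hbc, closureProj_mul_of_le (hab.trans hbc),
    closureProj_mul_of_le ((hab.trans hbc).trans hcd), sub_self]

theorem closureProj_sub_mul_sub_eq_zero' {a b c d : Submodule ℂ H} (hab : a ≤ b) (hbc : b ≤ c)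
    (hcd : c ≤ d) :
    (closureProj d - closureProj c) * (closureProj b - closureProj a) = 0 := by
  rw [mul_sub, sub_mul, sub_mul, mul_closureProj_of_le (hbc.trans hcd),
    mul_closureProj_of_le hbc, mul_closureProj_of_le (hab.trans hbc),
    mul_closureProj_of_le ((hab.trans hbc).trans hcd), sub_self, sub_self, sub_self]

namespace IsNest

variable {N : Set (Submodule ℂ H)}

/-- An operator commuting with a nest algebra modulo the quasi-triangular algebra cannot have
infinitely many large blocks below the diagonal in mutually disjoint intervals of the nest. -/
theorem not_forall_lt_norm_block (hN : IsNest N) {T : H →L[ℂ] H}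
    (hT : ∀ D ∈ nestAlgebra N, T * D - D * T ∈ quasiTriangularAlgebra N)
    {x y z : ℕ → Submodule ℂ H} (hx : ∀ j, x j ∈ N) (hy : ∀ j, y j ∈ N) (hxy : ∀ j, x j ≤ y j)
    (hyz : ∀ j, y j ≤ z j) (hd : ∀ i j, i ≠ j → z i ≤ x j ∨ z j ≤ x i) {ε : ℝ} (hε : 0 < ε) :
    ¬ ∀ j, ε < ‖(closureProj (z j) - closureProj (y j)) * T
      * (closureProj (y j) - closureProj (x j))‖ := by
  intro hlt
  set E : ℕ → H →L[ℂ] H := fun j => closureProj (y j) - closureProj (x j) with hE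
  have hsa : ∀ i u v, inner ℂ (E i u) v = inner ℂ u (E i v) := fun i => closureProj_sub_inner _ _
  have hid : ∀ i, E i * E i = E i := fun i => closureProj_sub_mul_self (hxy i)
  have horth : ∀ i j, i ≠ j → E i * E j = 0 := fun i j hij => by
    rcases hd i j hij with h | h
    · exact closureProj_sub_mul_sub_eq_zero (hxy i) ((hyz i).trans h) (hxy j)
    · exact closureProj_sub_mul_sub_eq_zero' (hxy j) ((hyz j).trans h) (hxy i)
  have hFE : ∀ i j, (closureProj (z i) - closureProj (y i)) * E j = 0 := fun i j => by
    by_cases hij : i = j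
    · rw [hij]
      exact closureProj_sub_mul_sub_eq_zero' (hxy j) le_rfl (hyz j)
    · rcases hd i j hij with h | h
      · exact closureProj_sub_mul_sub_eq_zero (hyz i) h (hxy j)
      · exact closureProj_sub_mul_sub_eq_zero' (hxy j) ((hyz j).trans (h.trans (hxy i))) (hyz i)
  set U := Ultrafilter.of (atTop : Filter ℕ)
  -- `D` is the sum of the projections `E j`, taken as a weak limit so that it visibly lies in the
  -- nest algebra. It fixes the range of each `E j` and is annihilated on the left by each upper
  -- projection.
  obtain ⟨D, -, hD⟩ := exists_tendstoWOT U
    (Eventually.of_forall (norm_sum_range_le_one_of_orthogonal hsa hid horth))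
  have hDN : D ∈ nestAlgebra N := hN.mem_nestAlgebra_of_tendstoWOT hD (Eventually.of_forall fun n =>
    sum_mem fun i _ => sub_mem (hN.closureProj_mem_nestAlgebra (hy i))
      (hN.closureProj_mem_nestAlgebra (hx i)))
  have hDE : ∀ j, D * E j = E j := fun j => by
    refine (hD.mul_const (E j)).unique ((TendstoWOT.of_tendsto tendsto_const_nhds).congr' ?_)
    refine Ultrafilter.of_le (atTop : Filter ℕ) ?_
    filter_upwards [eventually_gt_atTop j] with n hn
    rw [sum_range_mul_of_orthogonal hid horth, if_pos hn]
  have hFD : ∀ j, (closureProj (z j) - closureProj (y j)) * D = 0 := fun j => by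
    refine (hD.const_mul _).unique ((TendstoWOT.of_tendsto tendsto_const_nhds).congr' ?_)
    refine Eventually.of_forall fun n => ?_
    beta_reduce
    rw [Finset.mul_sum]
    exact (Finset.sum_eq_zero fun i _ => hFE j i).symm
  obtain ⟨S, hS, K, hK, hSK⟩ := hT D hDN
  have hKE := hK.tendsto_norm_mul hsa (fun j => norm_closureProj_sub_le (hxy j))
    (tendsto_zero_of_orthogonal hsa hid horth)
  obtain ⟨j, hj⟩ := (hKE.eventually_lt_const hε).exists
  refine absurd (hlt j) (not_lt.2 ?_)
  have hPE : closureProj (y j) * E j = E j := by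
    rw [hE, mul_sub, closureProj_mul_self, mul_closureProj_of_le (hxy j)]
  have hFS : (closureProj (z j) - closureProj (y j)) * S * E j = 0 := by
    have h1 : closureProj (z j) - closureProj (y j)
        = closureProj (z j) * (1 - closureProj (y j)) := by
      rw [mul_sub, mul_one, mul_closureProj_of_le (hyz j)]
    rw [h1, ← hPE, ← mul_assoc, mul_assoc (closureProj (z j)), mul_assoc (closureProj (z j)),
      hN.mem_nestAlgebra_iff.1 hS _ (hy j), mul_zero, zero_mul]
  -- With `F_j = P_{z_j} - P_{y_j}`: `F_j T E_j = F_j [T, D] E_j = F_j (S + K) E_j = F_j K E_j`,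
  -- since `S` is triangular. The right side tends to zero as `K` is compact.
  have e : (closureProj (z j) - closureProj (y j)) * T * E j
      = (closureProj (z j) - closureProj (y j)) * (K * E j) := by
    calc (closureProj (z j) - closureProj (y j)) * T * E j
        = (closureProj (z j) - closureProj (y j)) * T * (D * E j)
          - (closureProj (z j) - closureProj (y j)) * D * (T * E j) := by
          rw [hDE, hFD, zero_mul, sub_zero]
      _ = (closureProj (z j) - closureProj (y j)) * (T * D - D * T) * E j := by noncomm_ring
      _ = _ := by
          rw [hSK, mul_add, add_mul, hFS, zero_add, mul_assoc]
  rw [e]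
  refine (norm_mul_le _ _).trans ((mul_le_of_le_one_left (norm_nonneg _) ?_).trans hj.le)
  exact norm_closureProj_sub_le (hyz j)

end IsNest

end Humps

/-! ### Operators with quasi-triangular commutators are quasi-triangular -/

section QuasiTriangular

variable {H : Type*} [NormedAddCommGroup H] [InnerProductSpace ℂ H] {N : Set (Submodule ℂ H)}

namespace IsNest

theorem exists_lower_bound (hN : IsNest N) {s : Submodule ℂ H} (hs : s ≠ ⊤) {α : Type*}
    (lo : α → Submodule ℂ H) (S : Finset α) (h : ∀ t ∈ S, lo t ∈ N ∧ s < lo t) :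
    ∃ b ∈ N, s < b ∧ ∀ t ∈ S, b ≤ lo t := by
  classical
  induction S using Finset.induction_on with
  | empty => exact ⟨⊤, hN.top_mem, lt_top_iff_ne_top.2 hs, by simp⟩
  | insert t S ht ih =>
    obtain ⟨b, hb, hsb, hbS⟩ := ih fun t' ht' => h t' (Finset.mem_insert_of_mem ht')
    obtain ⟨htN, hst⟩ := h t (Finset.mem_insert_self t S)
    rcases hN.le_total hb htN with h' | h'
    · exact ⟨b, hb, hsb, Finset.forall_mem_insert _ _ _ |>.2 ⟨h', hbS⟩⟩
    · exact ⟨lo t, htN, hst, Finset.forall_mem_insert _ _ _ |>.2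
        ⟨le_rfl, fun t' ht' => h'.trans (hbS t' ht')⟩⟩

theorem exists_upper_bound (hN : IsNest N) {s : Submodule ℂ H} (hs : s ≠ ⊥) {α : Type*}
    (hi : α → Submodule ℂ H) (S : Finset α) (h : ∀ t ∈ S, hi t ∈ N ∧ hi t < s) :
    ∃ a ∈ N, a < s ∧ ∀ t ∈ S, hi t ≤ a := by
  classical
  induction S using Finset.induction_on with
  | empty => exact ⟨⊥, hN.bot_mem, bot_lt_iff_ne_bot.2 hs, by simp⟩
  | insert t S ht ih =>
    obtain ⟨a, ha, has, haS⟩ := ih fun t' ht' => h t' (Finset.mem_insert_of_mem ht')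
    obtain ⟨htN, hts⟩ := h t (Finset.mem_insert_self t S)
    rcases hN.le_total ha htN with h' | h'
    · exact ⟨hi t, htN, hts, Finset.forall_mem_insert _ _ _ |>.2
        ⟨le_rfl, fun t' ht' => (haS t' ht').trans h'⟩⟩
    · exact ⟨a, ha, has, Finset.forall_mem_insert _ _ _ |>.2 ⟨h', haS⟩⟩

end IsNest

variable [CompleteSpace H]

/-- The two blocks have orthogonal supports and orthogonal ranges, so norms combine as a maximum.
This is why errors do not accumulate when intervals are joined. -/
theorem norm_add_le_of_block {a b : Submodule ℂ H} (hab : a ≤ b) {C C' : H →L[ℂ] H} {ε : ℝ}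
    (hε : 0 ≤ ε) (hC : ‖C‖ ≤ ε) (hC' : ‖C'‖ ≤ ε) (h1 : closureProj a * C * closureProj a = C)
    (h2 : (closureProj b - closureProj a) * C' * (closureProj b - closureProj a) = C') :
    ‖C + C'‖ ≤ ε := by
  refine ContinuousLinearMap.opNorm_le_bound _ hε fun x => ?_
  have hPP : closureProj a * closureProj a = closureProj a := closureProj_mul_self a
  have e1 : closureProj a * C = C := by
    rw [← h1, ← mul_assoc, ← mul_assoc, hPP]
  have e2 : closureProj a * C' = 0 := by
    rw [← h2, ← mul_assoc, ← mul_assoc, mul_sub (closureProj a), closureProj_mul_of_le hab, hPP, sub_self,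
      zero_mul, zero_mul]
  have e3 : ∀ y, closureProj a (C y) = C y := fun y => congrArg (fun S : H →L[ℂ] H => S y) e1
  have e4 : ∀ y, closureProj a (C' y) = 0 := fun y => congrArg (fun S : H →L[ℂ] H => S y) e2
  have e5 : C * closureProj a = C := by rw [← h1, mul_assoc, hPP]
  have e6 : C' * (closureProj b - closureProj a) = C' := by
    rw [← h2, mul_assoc, closureProj_sub_mul_self hab]
  have e7 : C x = C (closureProj a x) := (congrArg (fun S : H →L[ℂ] H => S x) e5).symm
  have e8 : C' x = C' (closureProj b x - closureProj a x) :=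
    (congrArg (fun S : H →L[ℂ] H => S x) e6).symm
  have n1 : ‖(C + C') x‖ ^ 2 = ‖C x‖ ^ 2 + ‖C' x‖ ^ 2 := by
    rw [norm_sq_eq_add_closureProj a, add_apply, map_add, e3, e4, add_zero, add_sub_cancel_left]
  have n2 : ‖closureProj b x‖ ^ 2 = ‖closureProj a x‖ ^ 2
      + ‖closureProj b x - closureProj a x‖ ^ 2 := by
    have : closureProj a (closureProj b x) = closureProj a x :=
      congrArg (fun S : H →L[ℂ] H => S x) (closureProj_mul_of_le hab)
    rw [norm_sq_eq_add_closureProj a, this]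
  have n3 : ‖C x‖ ≤ ε * ‖closureProj a x‖ := by
    rw [e7]
    exact C.le_of_opNorm_le hC _
  have n4 : ‖C' x‖ ≤ ε * ‖closureProj b x - closureProj a x‖ := by
    rw [e8]
    exact C'.le_of_opNorm_le hC' _
  refine le_of_sq_le_sq ?_ (by positivity)
  calc ‖(C + C') x‖ ^ 2 ≤ (ε * ‖closureProj a x‖) ^ 2
        + (ε * ‖closureProj b x - closureProj a x‖) ^ 2 := by
        rw [n1]
        gcongr
    _ = ε ^ 2 * ‖closureProj b x‖ ^ 2 := by
        rw [n2]
        ring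
    _ ≤ ε ^ 2 * ‖x‖ ^ 2 := by
        gcongr
        exact norm_closureProj_apply_le b x
    _ = _ := by ring

namespace IsNest

/-- The part of `T` inside the interval `[a, b]` of the nest is nearly upper triangular. -/
def NearTriangular (N : Set (Submodule ℂ H)) (T : H →L[ℂ] H) (ε : ℝ) (a b : Submodule ℂ H) : Prop :=
  ∀ M ∈ N, a ≤ M → M ≤ b →
    ‖(closureProj b - closureProj M) * T * (closureProj M - closureProj a)‖ ≤ ε

/-- `T` compressed to `b` is within `ε` of the quasi-triangular algebra. -/
def NearQuasiTriangular (N : Set (Submodule ℂ H)) (T : H →L[ℂ] H) (ε : ℝ) (b : Submodule ℂ H) :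
    Prop :=
  ∃ C : H →L[ℂ] H, ‖C‖ ≤ ε ∧ closureProj b * C * closureProj b = C ∧
    closureProj b * T * closureProj b - C ∈ quasiTriangularAlgebra N

theorem mul_mul_sub_mem_nestAlgebra (hN : IsNest N) (T : H →L[ℂ] H) {a b : Submodule ℂ H}
    (ha : a ∈ N) (hab : a ≤ b) :
    closureProj a * T * (closureProj b - closureProj a) ∈ nestAlgebra N := by
  refine hN.mem_nestAlgebra_iff.2 fun M hM => ?_
  rcases hN.le_total hM ha with h | h
  · rw [mul_assoc, mul_assoc _ _ (closureProj M), sub_mul (closureProj b), mul_closureProj_of_le h,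
      mul_closureProj_of_le (h.trans hab), sub_self, mul_zero, mul_zero]
  · rw [← mul_assoc, ← mul_assoc, one_sub_mul_closureProj_of_le h, zero_mul, zero_mul, zero_mul]

/-- Arveson's formula for the compression `E T E`: its lower corners vanish for members outside `[a,
b]` and are the given blocks inside. Compressing the correction back to `E` costs no norm. -/
theorem NearTriangular.exists_correction (hN : IsNest N) {T : H →L[ℂ] H} {ε r : ℝ} (hr : ε < r)
    {a b : Submodule ℂ H} (ha : a ∈ N) (hb : b ∈ N) (hab : a ≤ b)
    (h : NearTriangular N T ε a b) :
    ∃ C : H →L[ℂ] H, ‖C‖ ≤ r ∧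
      (closureProj b - closureProj a) * C * (closureProj b - closureProj a) = C ∧
      (closureProj b - closureProj a) * T * (closureProj b - closureProj a) - C
        ∈ nestAlgebra N := by
  have hε : 0 ≤ ε := (norm_nonneg _).trans (h a ha le_rfl hab)
  set E := closureProj b - closureProj a with hE
  have hEE : E * E = E := closureProj_sub_mul_self hab
  have hEn : ‖E‖ ≤ 1 := norm_closureProj_sub_le hab
  have hEN : E ∈ nestAlgebra N :=
    sub_mem (hN.closureProj_mem_nestAlgebra hb) (hN.closureProj_mem_nestAlgebra ha)
  obtain ⟨C, hC, hCN⟩ := hN.exists_norm_le_sub_mem_nestAlgebra (T := E * T * E) hr fun M hM => by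
    rcases hN.le_total hM ha with hMa | haM
    · rw [mul_assoc, mul_assoc (E * T), hE, sub_mul (closureProj b) _ (closureProj M), mul_closureProj_of_le hMa,
        mul_closureProj_of_le (hMa.trans hab), sub_self, mul_zero, mul_zero, norm_zero]
      exact hε
    · rcases hN.le_total hM hb with hMb | hbM
      · have e1 : (1 - closureProj M) * E = closureProj b - closureProj M := by
          rw [hE, mul_sub, one_sub_mul_closureProj_of_le haM, sub_zero, sub_mul, one_mul,
            closureProj_mul_of_le hMb]
        have e2 : E * closureProj M = closureProj M - closureProj a := by
          rw [hE, sub_mul, mul_closureProj_of_le hMb, closureProj_mul_of_le haM]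
        rw [← mul_assoc, ← mul_assoc, e1, mul_assoc _ E, e2]
        exact h M hM haM hMb
      · have e1 : (1 - closureProj M) * E = 0 := by
          rw [hE, mul_sub, one_sub_mul_closureProj_of_le haM, one_sub_mul_closureProj_of_le hbM,
            sub_zero]
        rw [← mul_assoc, ← mul_assoc, e1, zero_mul, zero_mul, zero_mul, norm_zero]
        exact hε
  refine ⟨E * C * E, ?_, ?_, ?_⟩
  · have hCr : 0 ≤ r := hε.trans hr.le
    calc ‖E * C * E‖ ≤ ‖E‖ * ‖C‖ * ‖E‖ :=
          (norm_mul_le _ _).trans (mul_le_mul_of_nonneg_right (norm_mul_le _ _) (norm_nonneg _))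
      _ ≤ 1 * r * 1 := by gcongr
      _ = r := by ring
  · rw [← mul_assoc, ← mul_assoc, hEE, mul_assoc, mul_assoc, mul_assoc, hEE]
  · have : E * T * E - E * C * E = E * (E * T * E - C) * E := by
      calc E * T * E - E * C * E = E * E * T * (E * E) - E * C * E := by rw [hEE]
        _ = _ := by noncomm_ring
    rw [this]
    exact mul_mem (mul_mem hEN hCN) hEN

/-- Split the compression to `b` into four blocks at `a`. The upper corner is triangular, the lower
one is a compressed commutator with `P_a`, and the corrections of the two diagonal blocks are
combined by `norm_add_le_of_block`. -/
theorem NearQuasiTriangular.extend (hN : IsNest N) {T : H →L[ℂ] H}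
    (hT : ∀ D ∈ nestAlgebra N, T * D - D * T ∈ quasiTriangularAlgebra N) {ε r : ℝ}
    (hr : ε < r) {a b : Submodule ℂ H} (ha : a ∈ N) (hb : b ∈ N) (hab : a ≤ b)
    (h : NearTriangular N T ε a b) (hΦ : NearQuasiTriangular N T r a) :
    NearQuasiTriangular N T r b := by
  have hr0 : 0 ≤ r := ((norm_nonneg _).trans (h a ha le_rfl hab)).trans hr.le
  obtain ⟨C, hC, hCa, hCT⟩ := hΦ
  obtain ⟨C', hC', hC'E, hC'T⟩ := h.exists_correction hN hr ha hb hab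
  have hle := nestAlgebra_le_quasiTriangularAlgebra (N := N)
  have h1 := hle (hN.mul_mul_sub_mem_nestAlgebra T ha hab)
  have h2 : (closureProj b - closureProj a) * T * closureProj a ∈ quasiTriangularAlgebra N := by
    have h3 : closureProj b * (1 - closureProj a) * (T * closureProj a - closureProj a * T)
        * closureProj a ∈ quasiTriangularAlgebra N :=
      mul_mem (mul_mem (hle (mul_mem (hN.closureProj_mem_nestAlgebra hb)
        (sub_mem (one_mem _) (hN.closureProj_mem_nestAlgebra ha))))
        (hT _ (hN.closureProj_mem_nestAlgebra ha))) (hle (hN.closureProj_mem_nestAlgebra ha))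
    have e : closureProj b * (1 - closureProj a) = closureProj b - closureProj a := by
      rw [mul_sub, mul_one, mul_closureProj_of_le hab]
    have e' : (closureProj b - closureProj a) * closureProj a = 0 := by
      rw [sub_mul, closureProj_mul_self, mul_closureProj_of_le hab, sub_self]
    rw [e, mul_sub, ← mul_assoc, ← mul_assoc, e', zero_mul, sub_zero, mul_assoc,
      closureProj_mul_self] at h3
    exact h3
  set P := closureProj a with hP
  set P' := closureProj b with hP'
  have hP'P : P' * P = P := mul_closureProj_of_le hab
  have hPP' : P * P' = P := closureProj_mul_of_le hab
  have hP'E : P' * (P' - P) = P' - P := by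
    rw [mul_sub, hP'P, hP', closureProj_mul_self]
  have hEP' : (P' - P) * P' = P' - P := by
    rw [sub_mul, hPP', hP', closureProj_mul_self]
  refine ⟨C + C', norm_add_le_of_block hab hr0 hC hC' hCa hC'E, ?_, ?_⟩
  · rw [mul_add, add_mul]
    congr 1
    · rw [← hCa, ← mul_assoc, ← mul_assoc, hP'P, mul_assoc, mul_assoc, mul_assoc, hPP']
    · rw [← hC'E, ← mul_assoc, ← mul_assoc, hP'E, mul_assoc, mul_assoc, mul_assoc, hEP']
  · have e : P' * T * P' - (C + C') = (P * T * P - C) + P * T * (P' - P) + (P' - P) * T * P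
        + ((P' - P) * T * (P' - P) - C') := by noncomm_ring
    rw [e]
    exact add_mem (add_mem (add_mem hCT h1) h2) (hle hC'T)

/-- An immediate successor leaves nothing to check. Otherwise failure on every interval `[s, b]`
produces large lower blocks in disjoint intervals descending to `s`, contradicting
`not_forall_lt_norm_block`. -/
theorem exists_nearTriangular_right (hN : IsNest N) {T : H →L[ℂ] H}
    (hT : ∀ D ∈ nestAlgebra N, T * D - D * T ∈ quasiTriangularAlgebra N) {ε : ℝ} (hε : 0 < ε)
    {s : Submodule ℂ H} (hst : s ≠ ⊤) :
    ∃ b ∈ N, s < b ∧ NearTriangular N T ε s b := by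
  rcases hN.exists_succ_or_tendsto s with ⟨p, hp, hsp, hmin⟩ | hlim
  · refine ⟨p, hp, hsp, fun M hM hsM hMp => ?_⟩
    rcases hsM.eq_or_lt with h | h
    · rw [h, sub_self, mul_zero, norm_zero]
      exact hε.le
    · rw [hMp.antisymm (hmin M hM h), sub_self, zero_mul, zero_mul, norm_zero]
      exact hε.le
  · by_contra! hcon
    have := hN.isCodirectedOrder (s < ·)
    have : Nonempty {M // M ∈ N ∧ s < M} := ⟨⊤, hN.top_mem, lt_top_iff_ne_top.2 hst⟩
    obtain ⟨t, ht, hlt⟩ := exists_seq_of_forall_finset_exists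
      (α := Submodule ℂ H × Submodule ℂ H × Submodule ℂ H)
      (fun t => (t.1 ∈ N ∧ s < t.1) ∧ t.2.1 ∈ N ∧ t.1 ≤ t.2.1 ∧ t.2.1 ≤ t.2.2 ∧
        ε < ‖(closureProj t.2.2 - closureProj t.2.1) * T * (closureProj t.2.1 - closureProj t.1)‖)
      (fun t t' => t'.2.2 ≤ t.1) (fun S hS => by
        obtain ⟨b, hb, hsb, hbS⟩ := hN.exists_lower_bound hst Prod.fst S fun t ht => (hS t ht).1
        have h1 := hcon b hb hsb
        unfold NearTriangular at h1
        push Not at h1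
        obtain ⟨M, hM, hsM, hMb, hlt⟩ := h1
        have hsM' : s < M := hsM.lt_of_ne fun h => by
          rw [h, sub_self, mul_zero, norm_zero] at hlt
          exact absurd hlt hε.not_gt
        -- The large block found starts at `s`. Lower semicontinuity moves its lower end to some `M'
        -- > s`, leaving room for the next block between `s` and `M'`.
        have h2 := eventually_lt_norm_of_tendsto (l := atBot)
          (A := fun M' : {M // M ∈ N ∧ s < M} =>
            (closureProj b - closureProj M) * T * (closureProj M - closureProj M'.1))
          (B := (closureProj b - closureProj M) * T * (closureProj M - closureProj s))
          (fun x => (((closureProj b - closureProj M) * T).continuous.tendsto _).comp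
            (tendsto_const_nhds.sub (hlim x))) hlt
        obtain ⟨M', hM', hle⟩ := (h2.and (eventually_le_atBot ⟨M, hM, hsM'⟩)).exists
        exact ⟨(M', M, b), ⟨M'.2, hM, hle, hMb, hM'⟩, hbS⟩)
    refine hN.not_forall_lt_norm_block hT (x := fun j => (t j).1) (y := fun j => (t j).2.1)
      (z := fun j => (t j).2.2) (fun j => (ht j).1.1) (fun j => (ht j).2.1)
      (fun j => (ht j).2.2.1) (fun j => (ht j).2.2.2.1) (fun i j hij => ?_) hε
      fun j => (ht j).2.2.2.2
    rcases lt_or_gt_of_ne hij with h | h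
    · exact .inr (hlt i j h)
    · exact .inl (hlt j i h)

/-- The mirror image at `s` from below. All `a'` close to `s` must be handled, because
`induction_top` does not let one choose which is already reached. -/
theorem exists_nearTriangular_left (hN : IsNest N) {T : H →L[ℂ] H}
    (hT : ∀ D ∈ nestAlgebra N, T * D - D * T ∈ quasiTriangularAlgebra N) {ε : ℝ} (hε : 0 < ε)
    {s : Submodule ℂ H} (hs : s ∈ N) (hsb : s ≠ ⊥) :
    ∃ a ∈ N, a < s ∧ ∀ a' ∈ N, a ≤ a' → a' < s → NearTriangular N T ε a' s := by
  rcases hN.exists_pred_or_tendsto hs with ⟨p, hp, hps, hmax⟩ | hlim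
  · refine ⟨p, hp, hps, fun a ha hpa has M hM haM hMs => ?_⟩
    rcases hMs.eq_or_lt with h | h
    · rw [h, sub_self, zero_mul, zero_mul, norm_zero]
      exact hε.le
    · rw [haM.antisymm ((hmax M hM h).trans hpa), sub_self, mul_zero, norm_zero]
      exact hε.le
  · by_contra! hcon
    have := hN.isDirectedOrder (· < s)
    have : Nonempty {M // M ∈ N ∧ M < s} := ⟨⊥, hN.bot_mem, bot_lt_iff_ne_bot.2 hsb⟩
    obtain ⟨t, ht, hlt⟩ := exists_seq_of_forall_finset_exists
      (α := Submodule ℂ H × Submodule ℂ H × Submodule ℂ H)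
      (fun t => (t.2.2 ∈ N ∧ t.2.2 < s) ∧ t.1 ∈ N ∧ t.2.1 ∈ N ∧ t.1 ≤ t.2.1 ∧ t.2.1 ≤ t.2.2 ∧
        ε < ‖(closureProj t.2.2 - closureProj t.2.1) * T * (closureProj t.2.1 - closureProj t.1)‖)
      (fun t t' => t.2.2 ≤ t'.1) (fun S hS => by
        obtain ⟨a, ha, has, haS⟩ := hN.exists_upper_bound hsb (fun t => t.2.2) S
          fun t ht => (hS t ht).1
        obtain ⟨a', ha', haa', has', h1⟩ := hcon a ha has
        unfold NearTriangular at h1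
        push Not at h1
        obtain ⟨M, hM, haM, hMs, hlt⟩ := h1
        have hMs' : M < s := hMs.lt_of_ne fun h => by
          rw [h, sub_self, zero_mul, zero_mul, norm_zero] at hlt
          exact absurd hlt hε.not_gt
        have h2 := eventually_lt_norm_of_tendsto (l := atTop)
          (A := fun M' : {M // M ∈ N ∧ M < s} =>
            (closureProj M'.1 - closureProj M) * T * (closureProj M - closureProj a'))
          (fun x => (hlim _).sub tendsto_const_nhds) hlt
        obtain ⟨M', hM', hle⟩ := (h2.and (eventually_ge_atTop ⟨M, hM, hMs'⟩)).exists
        exact ⟨(a', M, M'), ⟨M'.2, ha', hM, haM, hle, hM'⟩, fun t ht => (haS t ht).trans haa'⟩)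
    refine hN.not_forall_lt_norm_block hT (x := fun j => (t j).1) (y := fun j => (t j).2.1)
      (z := fun j => (t j).2.2) (fun j => (ht j).2.1) (fun j => (ht j).2.2.1)
      (fun j => (ht j).2.2.2.1) (fun j => (ht j).2.2.2.2.1) (fun i j hij => ?_) hε
      fun j => (ht j).2.2.2.2.2
    rcases lt_or_gt_of_ne hij with h | h
    · exact .inl (hlt i j h)
    · exact .inr (hlt j i h)

/-- An operator which commutes with the nest algebra modulo the quasi-triangular algebra is
quasi-triangular. -/
theorem mem_quasiTriangularAlgebra_of_commutator (hN : IsNest N) {T : H →L[ℂ] H}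
    (hT : ∀ D ∈ nestAlgebra N, T * D - D * T ∈ quasiTriangularAlgebra N) :
    T ∈ quasiTriangularAlgebra N := by
  have h1 : ∀ ε > 0, NearQuasiTriangular N T ε ⊤ := by
    intro ε hε
    refine hN.induction_top ⟨0, by simpa using hε.le, by simp, by simp [closureProj_bot]⟩
      (fun s hs hs0 => ?_) fun s hs hst hΦ => ?_
    · obtain ⟨a, ha, has, h⟩ := hN.exists_nearTriangular_left hT (half_pos hε) hs hs0
      exact ⟨a, ha, has, fun a' ha' haa has' hΦ =>
        hΦ.extend hN hT (half_lt_self hε) ha' hs has'.le (h a' ha' haa has')⟩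
    · obtain ⟨b, hb, hsb, h⟩ := hN.exists_nearTriangular_right hT (half_pos hε) hst
      exact ⟨b, hb, hsb, hΦ.extend hN hT (half_lt_self hε) hs hb hsb.le h⟩
  refine hN.isClosed_quasiTriangularAlgebra.closure_subset (Metric.mem_closure_iff.2 fun ε hε => ?_)
  obtain ⟨C, hC, -, hCT⟩ := h1 (ε / 2) (half_pos hε)
  rw [closureProj_top, one_mul, mul_one] at hCT
  refine ⟨T - C, hCT, ?_⟩
  rw [dist_eq_norm, sub_sub_cancel]
  linarith

end IsNest

end QuasiTriangular

/-! ### The gliding hump -/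

section GlidingHump

variable {H : Type*} [NormedAddCommGroup H] [InnerProductSpace ℂ H]

open InnerProductSpace

/-- The series `∑ ξ_j ⊗ e_j`, for `e` orthonormal and `ξ` orthogonal and bounded by one, converges
weakly to a contraction mapping `e_j` to `ξ_j`. -/
theorem exists_tendstoWOT_sum_rankOne [CompleteSpace H] (U : Ultrafilter ℕ)
    (hU : (U : Filter ℕ) ≤ atTop) {e ξ : ℕ → H} (he : Orthonormal ℂ e) (hξ : ∀ i, ‖ξ i‖ ≤ 1)
    (horth : ∀ i j, i ≠ j → inner ℂ (ξ i) (ξ j) = 0) :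
    ∃ b : H →L[ℂ] H, ‖b‖ ≤ 1 ∧
      TendstoWOT (fun n => ∑ i ∈ Finset.range n, rankOne ℂ (ξ i) (e i)) U b ∧
      ∀ i, b (e i) = ξ i := by
  have hn : ∀ n, ‖∑ i ∈ Finset.range n, rankOne ℂ (ξ i) (e i)‖ ≤ 1 := fun n => by
    refine ContinuousLinearMap.opNorm_le_bound _ zero_le_one fun x => ?_
    rw [one_mul]
    refine le_of_sq_le_sq ?_ (norm_nonneg x)
    simp only [sum_apply, rankOne_apply]
    have h1 : ‖∑ i ∈ Finset.range n, inner ℂ (e i) x • ξ i‖ ^ 2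
        = ∑ i ∈ Finset.range n, ‖inner ℂ (e i) x • ξ i‖ ^ 2 := by
      induction n with
      | zero => simp
      | succ n ih =>
        rw [Finset.sum_range_succ, Finset.sum_range_succ, ← ih, sq, sq, sq]
        refine norm_add_sq_eq_norm_sq_add_norm_sq_of_inner_eq_zero (𝕜 := ℂ) _ _ ?_
        rw [sum_inner (𝕜 := ℂ)]
        refine Finset.sum_eq_zero fun i hi => ?_
        rw [inner_smul_left, inner_smul_right, horth i n (Finset.mem_range.1 hi).ne, mul_zero,
          mul_zero]
    rw [h1]
    refine (Finset.sum_le_sum fun i _ => ?_).trans (he.sum_inner_products_le (s := Finset.range n) x)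
    rw [norm_smul]
    gcongr
    exact mul_le_of_le_one_right (norm_nonneg _) (hξ i)
  obtain ⟨b, hb1, hb⟩ := exists_tendstoWOT U (Eventually.of_forall hn)
  refine ⟨b, hb1, hb, fun j => ext_inner_right ℂ fun y => ?_⟩
  refine tendsto_nhds_unique (hb (e j) y) (tendsto_const_nhds.congr' ?_)
  filter_upwards [hU (eventually_gt_atTop j)] with n hj
  simp only [sum_apply, rankOne_apply]
  rw [Finset.sum_eq_single j (fun i _ hij => by rw [he.inner_eq_zero hij, zero_smul])
    (by simp [hj]), inner_self_eq_norm_sq_to_K, he.norm_eq_one]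
  simp

/-- The gliding hump argument: if the operators `x n` tend strongly to zero and commute
asymptotically with `𝔖`, then there are no large values of `x n` at vectors orthogonal to given
ones, which can be reached from the given ones by rank one operators in `𝔖`. -/
theorem false_of_gliding_hump [CompleteSpace H] {x : ℕ → H →L[ℂ] H}
    (hx : ∀ v, Tendsto (fun n => x n v) atTop (𝓝 0)) {𝔖 : Submodule ℂ (H →L[ℂ] H)}
    (hcl : ∀ (U : Ultrafilter ℕ) (f : ℕ → H →L[ℂ] H) (T : H →L[ℂ] H),
      TendstoWOT f U T → (∀ n, f n ∈ 𝔖) → T ∈ 𝔖)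
    (hcomm : ∀ b ∈ 𝔖, Tendsto (fun n => ‖x n * b - b * x n‖) atTop (𝓝 0))
    {𝒱 : Set H} {ε : ℝ} (hε : 0 < ε)
    (h : ∀ S : Finset H, (∀ ζ ∈ S, ζ ∈ 𝒱) → ∃ᶠ n in atTop, ∃ ξ ∈ 𝒱, ‖ξ‖ ≤ 1 ∧ ε < ‖x n ξ‖ ∧
      ∀ ζ ∈ S, inner ℂ ζ ξ = 0 ∧ rankOne ℂ ξ ζ ∈ 𝔖) : False := by
  classical
  obtain ⟨f, hf, hff⟩ := exists_seq_of_forall_finset_exists (α := ℕ × H)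
    (fun t => t.2 ∈ 𝒱 ∧ ‖t.2‖ ≤ 1 ∧ ε < ‖x t.1 t.2‖)
    (fun t t' => t.1 < t'.1 ∧ inner ℂ t.2 t'.2 = 0 ∧ rankOne ℂ t'.2 t.2 ∈ 𝔖 ∧
      ‖x t'.1 t.2‖ ≤ ε / 2 * ‖t.2‖) (fun s hs => by
    have h1 := h (s.image Prod.snd) fun ζ hζ => by
      obtain ⟨t, ht, rfl⟩ := Finset.mem_image.1 hζ
      exact (hs t ht).1
    have h2 : ∀ᶠ n in atTop, ∀ t ∈ s, t.1 < n ∧ ‖x n t.2‖ ≤ ε / 2 * ‖t.2‖ := by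
      refine (Filter.eventually_all_finset s).2 fun t ht => (eventually_gt_atTop _).and ?_
      have hpos : 0 < ‖t.2‖ := norm_pos_iff.2 fun h0 => by
        have := (hs t ht).2.2
        rw [h0, map_zero, norm_zero] at this
        exact absurd this hε.not_gt
      have h3 := (hx t.2).norm
      rw [norm_zero] at h3
      exact h3.eventually_le_const (by positivity)
    obtain ⟨n, ⟨ξ, hξ, hξ1, hxξ, hξS⟩, hn⟩ := (h1.and_eventually h2).exists
    exact ⟨(n, ξ), ⟨hξ, hξ1, hxξ⟩, fun t ht => ⟨(hn t ht).1,
      (hξS t.2 (Finset.mem_image_of_mem _ ht)).1, (hξS t.2 (Finset.mem_image_of_mem _ ht)).2,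
      (hn t ht).2⟩⟩)
  have horth : ∀ i j, i ≠ j → inner ℂ (f i).2 (f j).2 = 0 := fun i j hij => by
    rcases lt_or_gt_of_ne hij with h' | h'
    · exact (hff i j h').2.1
    · exact inner_eq_zero_symm.1 (hff j i h').2.1
  have hne : ∀ i, (f i).2 ≠ 0 := fun i h0 => by
    have := (hf i).2.2
    rw [h0, map_zero, norm_zero] at this
    exact absurd this hε.not_gt
  set e : ℕ → H := fun i => ((‖(f i).2‖⁻¹ : ℝ) : ℂ) • (f i).2 with he
  have heo : Orthonormal ℂ e := ⟨fun i => by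
    rw [he, norm_smul, Complex.norm_real, norm_inv, norm_norm,
      inv_mul_cancel₀ (norm_ne_zero_iff.2 (hne i))], fun i j hij => by
    simp only [he]
    rw [inner_smul_left, inner_smul_right, horth i j hij, mul_zero, mul_zero]⟩
  -- `b` shifts each normalised hump `e j` to the next hump. At stage `j + 1` the operator is at
  -- least `ε` on `b (e j)` but at most `ε / 2` on `e j`, so its commutator with `b` stays above `ε
  -- / 2`.
  obtain ⟨b, hb1, hb, hbe⟩ := exists_tendstoWOT_sum_rankOne (Ultrafilter.of atTop)
    (Ultrafilter.of_le _) (ξ := fun i => (f (i + 1)).2) heo (fun i => (hf _).2.1)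
    (fun i j hij => horth _ _ (by simpa using hij))
  have hb𝔖 : b ∈ 𝔖 := hcl _ _ _ hb fun n => sum_mem fun i _ => by
    have : rankOne ℂ (f (i + 1)).2 (e i)
        = ((‖(f i).2‖⁻¹ : ℝ) : ℂ) • rankOne ℂ (f (i + 1)).2 (f i).2 := by
      ext v
      simp only [he, rankOne_apply, smul_apply, inner_smul_left, Complex.conj_ofReal, smul_smul]
    rw [this]
    exact 𝔖.smul_mem _ (hff i (i + 1) (Nat.lt_succ_self i)).2.2.1
  have hlim : Tendsto (fun j => (f (j + 1)).1) atTop atTop :=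
    (strictMono_nat_of_lt_succ fun j => (hff _ _ (Nat.lt_succ_self (j + 1))).1).tendsto_atTop
  obtain ⟨j, hj⟩ := (hlim.eventually ((hcomm b hb𝔖).eventually_lt_const (half_pos hε))).exists
  set n := (f (j + 1)).1 with hn
  have h1 : ‖x n (e j)‖ ≤ ε / 2 := by
    rw [he, map_smul, norm_smul, Complex.norm_real, norm_inv, norm_norm,
      inv_mul_le_iff₀ (norm_pos_iff.2 (hne j)), mul_comm]
    exact (hff j (j + 1) (Nat.lt_succ_self j)).2.2.2
  have h2 : (x n * b - b * x n) (e j) = x n (f (j + 1)).2 - b (x n (e j)) := by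
    rw [sub_apply, mul_apply_eq_comp, mul_apply_eq_comp, hbe]
  have h3 : ‖(x n * b - b * x n) (e j)‖ ≤ ‖x n * b - b * x n‖ := by
    simpa [heo.norm_eq_one] using (x n * b - b * x n).le_opNorm (e j)
  have h4 : ‖b (x n (e j))‖ ≤ ε / 2 := by
    refine (b.le_of_opNorm_le hb1 _).trans ?_
    rwa [one_mul]
  have h5 := norm_sub_norm_le (x n (f (j + 1)).2) (b (x n (e j)))
  rw [← h2] at h5
  linarith [(hf (j + 1)).2.2]

/-- A strongly convergent sequence of operators converges in norm on finite-dimensional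
subspaces. -/
theorem tendsto_norm_mul_starProjection {x : ℕ → H →L[ℂ] H}
    (hx : ∀ v, Tendsto (fun n => x n v) atTop (𝓝 0)) (V : Submodule ℂ H) [FiniteDimensional ℂ V] :
    Tendsto (fun n => ‖x n * V.starProjection‖) atTop (𝓝 0) := by
  have h1 : ∀ n, x n * V.starProjection
      = ∑ i, rankOne ℂ (x n (stdOrthonormalBasis ℂ V i)) (stdOrthonormalBasis ℂ V i : H) := by
    intro n
    rw [(stdOrthonormalBasis ℂ V).starProjection_eq_sum_rankOne, Finset.mul_sum]
    exact Finset.sum_congr rfl fun i _ => ContinuousLinearMap.ext fun v => by simp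
  have h2 : Tendsto (fun n => ∑ i, ‖x n (stdOrthonormalBasis ℂ V i)‖ *
      ‖(stdOrthonormalBasis ℂ V i : H)‖) atTop (𝓝 0) := by
    rw [← Finset.sum_const_zero (s := (Finset.univ : Finset (Fin (Module.finrank ℂ V))))]
    refine tendsto_finsetSum _ fun i _ => ?_
    simpa using (hx (stdOrthonormalBasis ℂ V i)).norm.mul_const ‖(stdOrthonormalBasis ℂ V i : H)‖
  refine squeeze_zero (fun n => norm_nonneg _) (fun n => ?_) h2
  rw [h1]
  refine (norm_sum_le _ _).trans_eq (Finset.sum_congr rfl fun i _ => norm_rankOne _ _)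

end GlidingHump

/-! ### Strong-* null sequences commuting asymptotically with a nest algebra -/

section AsymptoticCommutant

variable {H : Type*} [NormedAddCommGroup H] [InnerProductSpace ℂ H] {N : Set (Submodule ℂ H)}

open InnerProductSpace ContinuousLinearMap

variable [CompleteSpace H]

theorem TendstoWOT.adjoint {ι : Type*} {l : Filter ι} {f : ι → H →L[ℂ] H} {T : H →L[ℂ] H}
    (h : TendstoWOT f l T) :
    TendstoWOT (fun i => ContinuousLinearMap.adjoint (f i)) l (ContinuousLinearMap.adjoint T) := by
  intro x y
  have h1 := (Complex.continuous_conj.tendsto _).comp (h y x)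
  simp only [adjoint_inner_left]
  rw [inner_conj_symm] at h1
  exact h1.congr fun i => inner_conj_symm _ _

/-- The adjoints of the operators in a nest algebra. -/
noncomputable def adjointNestAlgebra (N : Set (Submodule ℂ H)) : Submodule ℂ (H →L[ℂ] H) where
  carrier := {b | adjoint b ∈ nestAlgebra N}
  add_mem' {a b} ha hb := by
    change adjoint (a + b) ∈ nestAlgebra N
    rw [map_add]
    exact add_mem ha hb
  zero_mem' := by
    change adjoint (0 : H →L[ℂ] H) ∈ nestAlgebra N
    rw [map_zero]
    exact zero_mem _
  smul_mem' c b hb := by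
    change adjoint (c • b) ∈ nestAlgebra N
    rw [LinearIsometryEquiv.map_smulₛₗ]
    exact Subalgebra.smul_mem _ hb _

theorem mem_adjointNestAlgebra {b : H →L[ℂ] H} :
    b ∈ adjointNestAlgebra N ↔ adjoint b ∈ nestAlgebra N := Iff.rfl

theorem norm_adjoint_commutator (x b : H →L[ℂ] H) :
    ‖adjoint x * b - b * adjoint x‖ = ‖x * adjoint b - adjoint b * x‖ := by
  rw [← LinearIsometryEquiv.norm_map adjoint (x * adjoint b - adjoint b * x), map_sub]
  change _ = ‖adjoint (x.comp (adjoint b)) - adjoint ((adjoint b).comp x)‖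
  rw [adjoint_comp, adjoint_comp, adjoint_adjoint, norm_sub_rev]
  rfl

namespace IsNest

variable {x : ℕ → H →L[ℂ] H}

/-- The algebra contains every `ξ ⊗ ζ` with `ξ`, `ζ` in the gap `q ⊖ p`, so any hump can be carried
to any other one. -/
theorem tendsto_norm_mul_atom (hN : IsNest N) (hx : ∀ v, Tendsto (fun n => x n v) atTop (𝓝 0))
    (hcomm : ∀ b ∈ nestAlgebra N, Tendsto (fun n => ‖x n * b - b * x n‖) atTop (𝓝 0))
    {p q : Submodule ℂ H} (hp : p ∈ N) (hq : q ∈ N) (hpq : p ≤ q)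
    (hgap : ∀ M ∈ N, M ≤ p ∨ q ≤ M) {ε : ℝ} (hε : 0 < ε) :
    ∀ᶠ n in atTop, ‖x n * (closureProj q - closureProj p)‖ ≤ ε := by
  by_contra hcon
  have hfr : ∃ᶠ n in atTop, ε < ‖x n * (closureProj q - closureProj p)‖ :=
    (Filter.not_eventually.1 hcon).mono fun _ => lt_of_not_ge
  set E := closureProj q - closureProj p with hE
  have hEE : E * E = E := closureProj_sub_mul_self hpq
  have hEv : ∀ v, E (E v) = E v := fun v => congrArg (fun S : H →L[ℂ] H => S v) hEE
  refine false_of_gliding_hump hx (𝔖 := Subalgebra.toSubmodule (nestAlgebra N))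
    (fun U f T h hf => hN.mem_nestAlgebra_of_tendstoWOT h (Eventually.of_forall hf)) hcomm
    (𝒱 := {v | E v = v}) (half_pos hε) fun S hS => ?_
  -- The new hump must be orthogonal to the old ones. Removing its component in `V` is harmless,
  -- since `x n` tends to zero in norm on a finite-dimensional space.
  set V := Submodule.span ℂ (S : Set H) with hV
  have : FiniteDimensional ℂ V := FiniteDimensional.span_finset ℂ S
  have h1 := (tendsto_norm_mul_starProjection hx V).eventually_le_const (half_pos hε)
  refine (hfr.and_eventually h1).mono fun n ⟨hn1, hn2⟩ => ?_
  obtain ⟨v, hv1, hv2⟩ := (x n * E).exists_lt_apply_of_lt_opNorm hn1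
  have hEn : ‖E v‖ ≤ 1 := by
    have := E.le_of_opNorm_le (norm_closureProj_sub_le hpq) v
    linarith
  have hVE : ∀ w ∈ V, E w = w := fun w hw => by
    induction hw using Submodule.span_induction with
    | mem w hw => exact hS w hw
    | zero => exact map_zero E
    | add w w' _ _ h h' => rw [map_add, h, h']
    | smul c w _ h => rw [map_smul, h]
  refine ⟨E v - V.starProjection (E v), ?_, ?_, ?_, fun ζ hζ => ⟨?_, ?_⟩⟩
  · change E _ = _
    rw [map_sub, hEv, hVE _ (V.starProjection_apply_mem _)]
  · have e : E v - V.starProjection (E v) = Vᗮ.starProjection (E v) := by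
      rw [Submodule.starProjection_orthogonal_val]
    rw [e]
    exact ((Vᗮ.starProjection).le_of_opNorm_le (Submodule.starProjection_norm_le _) _).trans
      (by linarith)
  · rw [map_sub]
    have h3 : ‖x n (V.starProjection (E v))‖ ≤ ε / 2 := by
      refine ((x n * V.starProjection).le_of_opNorm_le hn2 (E v)).trans ?_
      exact mul_le_of_le_one_right (half_pos hε).le hEn
    have h4 := norm_sub_norm_le (x n (E v)) (x n (V.starProjection (E v)))
    rw [mul_apply_eq_comp] at hv2
    linarith
  · exact V.sub_starProjection_mem_orthogonal (E v) ζ (Submodule.subset_span hζ)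
  · refine rankOne_mem_nestAlgebra fun M hM => ?_
    have hmemq : ∀ w, E w = w → w ∈ q := fun w hw => by
      rw [← hw, hE, sub_apply]
      exact q.sub_mem (closureProj_apply_mem (hN.isClosed q hq) w)
        (hpq (closureProj_apply_mem (hN.isClosed p hp) w))
    rcases hgap M hM with h | h
    · right
      have e : ζ = closureProj q ζ - closureProj p (closureProj q ζ) := by
        have := congrArg (fun S : H →L[ℂ] H => S ζ) (closureProj_mul_of_le hpq)
        simp only [mul_apply_eq_comp] at this
        rw [this]
        exact (hS ζ hζ).symm
      rw [e]
      exact Submodule.orthogonal_le h (sub_closureProj_mem_orthogonal p _)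
    · left
      refine h (hmemq _ ?_)
      rw [map_sub, hEv, hVE _ (V.starProjection_apply_mem _)]

/-- At a limit from above, humps descend towards `s`: a new hump `ξ ∈ b` and older ones `ζ ⊥ b` make
`ξ ⊗ ζ` triangular. -/
theorem exists_norm_mul_le_right (hN : IsNest N) (hx : ∀ v, Tendsto (fun n => x n v) atTop (𝓝 0))
    (hcomm : ∀ b ∈ nestAlgebra N, Tendsto (fun n => ‖x n * b - b * x n‖) atTop (𝓝 0))
    {s : Submodule ℂ H} (hs : s ∈ N) (hst : s ≠ ⊤) {ε : ℝ} (hε : 0 < ε) :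
    ∃ b ∈ N, s < b ∧ ∀ᶠ n in atTop, ‖x n * (closureProj b - closureProj s)‖ ≤ ε := by
  rcases hN.exists_succ_or_tendsto s with ⟨p, hp, hsp, hmin⟩ | hlim
  · exact ⟨p, hp, hsp, hN.tendsto_norm_mul_atom hx hcomm hs hp hsp.le (fun M hM => by
      by_cases h : M ≤ s
      · exact .inl h
      · exact .inr (hmin M hM (hN.lt_of_not_le hM hs h))) hε⟩
  · by_contra! hcon
    have := hN.isCodirectedOrder (s < ·)
    have : Nonempty {M // M ∈ N ∧ s < M} := ⟨⊤, hN.top_mem, lt_top_iff_ne_top.2 hst⟩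
    refine false_of_gliding_hump hx (𝔖 := Subalgebra.toSubmodule (nestAlgebra N))
      (fun U f T h hf => hN.mem_nestAlgebra_of_tendstoWOT h (Eventually.of_forall hf)) hcomm
      (𝒱 := {v | ∃ M ∈ N, s < M ∧ v ∈ Mᗮ}) hε fun S hS => ?_
    choose! m hm using hS
    obtain ⟨b, hb, hsb, hbS⟩ := hN.exists_lower_bound hst m S fun ζ hζ =>
      ⟨(hm ζ hζ).1, (hm ζ hζ).2.1⟩
    refine (hcon b hb hsb).mono fun n hn => ?_
    have h2 := eventually_lt_norm_of_tendsto (l := atBot)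
      (A := fun M : {M // M ∈ N ∧ s < M} => x n * (closureProj b - closureProj M.1))
      (B := x n * (closureProj b - closureProj s))
      (fun v => ((x n).continuous.tendsto _).comp (tendsto_const_nhds.sub (hlim v))) hn
    obtain ⟨M, hM, hMb⟩ := (h2.and (eventually_le_atBot ⟨b, hb, hsb⟩)).exists
    have hMb : M.1 ≤ b := hMb
    obtain ⟨v, hv1, hv2⟩ := ContinuousLinearMap.exists_lt_apply_of_lt_opNorm _ hM
    have hζ : ∀ ζ ∈ S, ζ ∈ bᗮ := fun ζ hζ =>
      Submodule.orthogonal_le (hbS ζ hζ) (hm ζ hζ).2.2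
    have hmemb : (closureProj b - closureProj M.1) v ∈ b :=
      b.sub_mem (closureProj_apply_mem (hN.isClosed b hb) v)
        (hMb (closureProj_apply_mem (hN.isClosed _ M.2.1) v))
    refine ⟨(closureProj b - closureProj M.1) v, ⟨M.1, M.2.1, M.2.2, ?_⟩, ?_, hv2,
      fun ζ hζS => ⟨?_, rankOne_mem_nestAlgebra fun M' hM' => ?_⟩⟩
    · have := sub_closureProj_mem_orthogonal M.1 (closureProj b v)
      have e : closureProj M.1 (closureProj b v) = closureProj M.1 v :=
        congrArg (fun S : H →L[ℂ] H => S v) (closureProj_mul_of_le hMb)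
      rwa [e] at this
    · have := ContinuousLinearMap.le_of_opNorm_le _ (norm_closureProj_sub_le hMb) v
      linarith
    · exact inner_eq_zero_symm.1 (hζ ζ hζS _ hmemb)
    · rcases hN.le_total hM' hb with h | h
      · exact .inr (Submodule.orthogonal_le h (hζ ζ hζS))
      · exact .inl (h hmemb)

/-- Approaching `s` from below, the triangular operator is `ζ ⊗ ξ`, from new to old. The hump
argument is therefore run for the adjoints, which is where strong-* convergence enters. -/
theorem exists_norm_mul_le_left (hN : IsNest N) (hx : ∀ v, Tendsto (fun n => x n v) atTop (𝓝 0))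
    (hx' : ∀ v, Tendsto (fun n => adjoint (x n) v) atTop (𝓝 0))
    (hcomm : ∀ b ∈ nestAlgebra N, Tendsto (fun n => ‖x n * b - b * x n‖) atTop (𝓝 0))
    {s : Submodule ℂ H} (hs : s ∈ N) (hsb : s ≠ ⊥) {ε : ℝ} (hε : 0 < ε) :
    ∃ a ∈ N, a < s ∧ ∀ᶠ n in atTop, ‖(closureProj s - closureProj a) * x n *
      (closureProj s - closureProj a)‖ ≤ ε := by
  rcases hN.exists_pred_or_tendsto hs with ⟨p, hp, hps, hmax⟩ | hlim
  · refine ⟨p, hp, hps, (hN.tendsto_norm_mul_atom hx hcomm hp hs hps.le (fun M hM => by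
      by_cases h : s ≤ M
      · exact .inr h
      · exact .inl (hmax M hM (hN.lt_of_not_le hs hM h))) hε).mono fun n hn => ?_⟩
    rw [mul_assoc]
    exact (norm_mul_le _ _).trans ((mul_le_of_le_one_left (norm_nonneg _)
      (norm_closureProj_sub_le hps.le)).trans hn)
  · by_contra! hcon
    have := hN.isDirectedOrder (· < s)
    have : Nonempty {M // M ∈ N ∧ M < s} := ⟨⊥, hN.bot_mem, bot_lt_iff_ne_bot.2 hsb⟩
    refine false_of_gliding_hump hx' (𝔖 := adjointNestAlgebra N)
      (fun U f T h hf => hN.mem_nestAlgebra_of_tendstoWOT h.adjoint (Eventually.of_forall hf))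
      (fun b hb => by simpa only [norm_adjoint_commutator] using hcomm _ hb)
      (𝒱 := {v | ∃ M ∈ N, M < s ∧ v ∈ M}) hε fun S hS => ?_
    choose! m hm using hS
    obtain ⟨a, ha, has, haS⟩ := hN.exists_upper_bound hsb m S fun ζ hζ =>
      ⟨(hm ζ hζ).1, (hm ζ hζ).2.1⟩
    refine (hcon a ha has).mono fun n hn => ?_
    have hn' : ε < ‖adjoint (x n) * (closureProj s - closureProj a)‖ := by
      refine hn.trans_le ?_
      have h3 : ‖(closureProj s - closureProj a) * x n‖
          = ‖adjoint (x n) * (closureProj s - closureProj a)‖ := by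
        rw [← LinearIsometryEquiv.norm_map adjoint]
        change ‖adjoint ((closureProj s - closureProj a).comp (x n))‖ = _
        rw [adjoint_comp, map_sub, adjoint_closureProj, adjoint_closureProj]
        rfl
      rw [← h3]
      exact (norm_mul_le _ _).trans (mul_le_of_le_one_right (norm_nonneg _)
        (norm_closureProj_sub_le has.le))
    have h2 := eventually_lt_norm_of_tendsto (l := atTop)
      (A := fun M : {M // M ∈ N ∧ M < s} => adjoint (x n) * (closureProj M.1 - closureProj a))
      (B := adjoint (x n) * (closureProj s - closureProj a))
      (fun v => ((adjoint (x n)).continuous.tendsto _).comp ((hlim v).sub tendsto_const_nhds)) hn'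
    obtain ⟨M, hM, haM⟩ := (h2.and (eventually_ge_atTop ⟨a, ha, has⟩)).exists
    have haM : a ≤ M.1 := haM
    obtain ⟨v, hv1, hv2⟩ := ContinuousLinearMap.exists_lt_apply_of_lt_opNorm _ hM
    have hζ : ∀ ζ ∈ S, ζ ∈ a := fun ζ hζ => haS ζ hζ (hm ζ hζ).2.2
    have hmemM : (closureProj M.1 - closureProj a) v ∈ M.1 :=
      M.1.sub_mem (closureProj_apply_mem (hN.isClosed _ M.2.1) v)
        (haM (closureProj_apply_mem (hN.isClosed a ha) v))
    have horth : (closureProj M.1 - closureProj a) v ∈ aᗮ := by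
      have := sub_closureProj_mem_orthogonal a (closureProj M.1 v)
      have e : closureProj a (closureProj M.1 v) = closureProj a v :=
        congrArg (fun S : H →L[ℂ] H => S v) (closureProj_mul_of_le haM)
      rwa [e] at this
    refine ⟨(closureProj M.1 - closureProj a) v, ⟨M.1, M.2.1, M.2.2, hmemM⟩, ?_, hv2,
      fun ζ hζS => ⟨horth ζ (hζ ζ hζS), ?_⟩⟩
    · have := ContinuousLinearMap.le_of_opNorm_le _ (norm_closureProj_sub_le haM) v
      linarith
    · rw [mem_adjointNestAlgebra, adjoint_rankOne]
      refine rankOne_mem_nestAlgebra fun M' hM' => ?_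
      rcases hN.le_total hM' ha with h | h
      · exact .inr (Submodule.orthogonal_le h horth)
      · exact .inl (h (hζ ζ hζS))

/-- Both off-diagonal blocks are compressions of `[x n, P_a]` up to sign, hence norm null, and the
diagonal blocks combine as a maximum. Allowing every `r > ε` absorbs the null terms, so the
extension can be repeated without loss. -/
theorem eventually_norm_compress_le (hN : IsNest N)
    (hcomm : ∀ b ∈ nestAlgebra N, Tendsto (fun n => ‖x n * b - b * x n‖) atTop (𝓝 0))
    {a b : Submodule ℂ H} (ha : a ∈ N) (hab : a ≤ b) {ε : ℝ} (hε : 0 ≤ ε)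
    (h : ∀ᶠ n in atTop, ‖(closureProj b - closureProj a) * x n *
      (closureProj b - closureProj a)‖ ≤ ε)
    (hΦ : ∀ r > ε, ∀ᶠ n in atTop, ‖closureProj a * x n * closureProj a‖ ≤ r) (r : ℝ) (hr : ε < r) :
    ∀ᶠ n in atTop, ‖closureProj b * x n * closureProj b‖ ≤ r := by
  set P := closureProj a with hP
  set E := closureProj b - P with hE
  have hPE : P * E = 0 := by
    rw [hE, mul_sub, closureProj_mul_of_le hab, closureProj_mul_self, sub_self]
  have hEP : E * P = 0 := by
    rw [hE, sub_mul, mul_closureProj_of_le hab, closureProj_mul_self, sub_self]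
  have hPP : P * P = P := closureProj_mul_self a
  have hEE : E * E = E := closureProj_sub_mul_self hab
  have hPn : ‖P‖ ≤ 1 := norm_closureProj_le a
  have hEn : ‖E‖ ≤ 1 := norm_closureProj_sub_le hab
  have hmid : ε < (ε + r) / 2 := by linarith
  filter_upwards [h, hΦ _ hmid, (hcomm P (hN.closureProj_mem_nestAlgebra ha)).eventually_le_const
    (show 0 < (r - ε) / 4 by linarith)] with n h1 h2 h3
  have h4 : ‖P * x n * P + E * x n * E‖ ≤ (ε + r) / 2 := by
    refine norm_add_le_of_block hab (by linarith) h2 (h1.trans hmid.le) ?_ ?_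
    · change P * (P * x n * P) * P = _
      rw [← mul_assoc, ← mul_assoc, hPP, mul_assoc, hPP]
    · change E * (E * x n * E) * E = _
      rw [← mul_assoc, ← mul_assoc, hEE, mul_assoc, hEE]
  have h5 : ‖E * x n * P‖ ≤ (r - ε) / 4 := by
    have e : E * x n * P = E * (x n * P - P * x n) := by
      rw [mul_sub, ← mul_assoc, ← mul_assoc, hEP, zero_mul, sub_zero]
    rw [e]
    exact (norm_mul_le _ _).trans ((mul_le_of_le_one_left (norm_nonneg _) hEn).trans h3)
  have h6 : ‖P * x n * E‖ ≤ (r - ε) / 4 := by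
    have e : P * x n * E = -((x n * P - P * x n) * E) := by
      rw [sub_mul, mul_assoc (x n), hPE, mul_zero, zero_sub, neg_neg]
    rw [e, norm_neg]
    exact (norm_mul_le _ _).trans ((mul_le_of_le_one_right (norm_nonneg _) hEn).trans h3)
  have e : closureProj b * x n * closureProj b
      = (P * x n * P + E * x n * E) + E * x n * P + P * x n * E := by
    have : closureProj b = P + E := by rw [hE, add_sub_cancel]
    rw [this]
    noncomm_ring
  rw [e]
  have h7 := norm_add_le (P * x n * P + E * x n * E + E * x n * P) (P * x n * E)
  have h8 := norm_add_le (P * x n * P + E * x n * E) (E * x n * P)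
  linarith

/-- A sequence of operators tending to zero in the strong-* topology, and commuting asymptotically
with every operator in a nest algebra, tends to zero in norm. -/
theorem tendsto_norm_zero_of_commutator (hN : IsNest N)
    (hx : ∀ v, Tendsto (fun n => x n v) atTop (𝓝 0))
    (hx' : ∀ v, Tendsto (fun n => adjoint (x n) v) atTop (𝓝 0))
    (hcomm : ∀ b ∈ nestAlgebra N, Tendsto (fun n => ‖x n * b - b * x n‖) atTop (𝓝 0)) :
    Tendsto (fun n => ‖x n‖) atTop (𝓝 0) := by
  have key : ∀ ε > 0, ∀ r > ε, ∀ᶠ n in atTop,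
      ‖closureProj (⊤ : Submodule ℂ H) * x n * closureProj ⊤‖ ≤ r := by
    intro ε hε
    refine hN.induction_top (Φ := fun b => ∀ r > ε, ∀ᶠ n in atTop,
      ‖closureProj b * x n * closureProj b‖ ≤ r) (fun r hr => ?_) (fun s hs hs0 => ?_)
      fun s hs hst hΦ => ?_
    · rw [closureProj_bot]
      exact Eventually.of_forall fun n => by simpa using (hε.trans hr).le
    · obtain ⟨a, ha, has, h⟩ := hN.exists_norm_mul_le_left hx hx' hcomm hs hs0 hε
      refine ⟨a, ha, has, fun a' ha' haa has' hΦ =>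
        hN.eventually_norm_compress_le hcomm ha' has'.le hε.le (h.mono fun n hn => ?_) hΦ⟩
      have e1 : (closureProj s - closureProj a') * (closureProj s - closureProj a)
          = closureProj s - closureProj a' := by
        rw [mul_sub, sub_mul, sub_mul, closureProj_mul_self, closureProj_mul_of_le has'.le,
          mul_closureProj_of_le has.le, mul_closureProj_of_le haa, sub_self, sub_zero]
      have e2 : (closureProj s - closureProj a) * (closureProj s - closureProj a')
          = closureProj s - closureProj a' := by
        rw [mul_sub, sub_mul, sub_mul, closureProj_mul_self, mul_closureProj_of_le has'.le,
          closureProj_mul_of_le has.le, closureProj_mul_of_le haa]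
        abel
      have hn1 := norm_closureProj_sub_le has'.le
      calc ‖(closureProj s - closureProj a') * x n * (closureProj s - closureProj a')‖
          = ‖(closureProj s - closureProj a') * ((closureProj s - closureProj a) * x n
            * (closureProj s - closureProj a)) * (closureProj s - closureProj a')‖ := by
            rw [← mul_assoc, ← mul_assoc, e1, mul_assoc _ (closureProj s - closureProj a), e2]
        _ ≤ ‖closureProj s - closureProj a'‖ * ‖(closureProj s - closureProj a) * x n
            * (closureProj s - closureProj a)‖ * ‖closureProj s - closureProj a'‖ :=
            (norm_mul_le _ _).trans (mul_le_mul_of_nonneg_right (norm_mul_le _ _) (norm_nonneg _))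
        _ ≤ 1 * ε * 1 := by gcongr
        _ = ε := by ring
    · obtain ⟨b, hb, hsb, h⟩ := hN.exists_norm_mul_le_right hx hcomm hs hst hε
      refine ⟨b, hb, hsb,
        hN.eventually_norm_compress_le hcomm hs hsb.le hε.le (h.mono fun n hn => ?_) hΦ⟩
      rw [mul_assoc]
      exact (norm_mul_le _ _).trans ((mul_le_of_le_one_left (norm_nonneg _)
        (norm_closureProj_sub_le hsb.le)).trans hn)
  rw [Metric.tendsto_nhds]
  intro ε hε
  filter_upwards [key (ε / 3) (by positivity) (ε / 2) (by linarith)] with n hn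
  rw [closureProj_top, one_mul, mul_one] at hn
  rw [dist_zero_right, norm_norm]
  linarith

end IsNest

end AsymptoticCommutant

/-! ### Norm continuous one-parameter groups -/

section NormContinuousGroup

variable {A : Type*} [NormedRing A] [NormedAlgebra ℂ A] [CompleteSpace A]

/-- A one-parameter group in a Banach algebra which is norm continuous at `0` is differentiable
there. -/
theorem exists_hasDerivAt_zero_of_group {f : ℝ → A} (h0 : f 0 = 1)
    (hadd : ∀ s t, f (s + t) = f s * f t) (hc : ContinuousAt f 0) : ∃ f', HasDerivAt f f' 0 := by
  have hcont : Continuous f := continuous_iff_continuousAt.2 fun t => by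
    have h1 : Tendsto (fun s => f t * f (s - t)) (𝓝 t) (𝓝 (f t * f 0)) := by
      refine tendsto_const_nhds.mul (hc.tendsto.comp ?_)
      have : Tendsto (fun s : ℝ => s - t) (𝓝 t) (𝓝 (t - t)) :=
        (continuous_id.sub continuous_const).tendsto t
      rwa [sub_self] at this
    rw [h0, mul_one] at h1
    refine h1.congr fun s => ?_
    rw [← hadd, add_sub_cancel]
  set F : ℝ → A := fun t => ∫ s in (0 : ℝ)..t, f s with hF
  have hFd : ∀ t, HasDerivAt F (f t) t := fun t =>
    intervalIntegral.integral_hasDerivAt_right (hcont.intervalIntegrable _ _)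
      hcont.aestronglyMeasurable.stronglyMeasurableAtFilter hcont.continuousAt
  have hF0 : F 0 = 0 := intervalIntegral.integral_same
  -- `F τ / τ` is close to `f 0 = 1`. As `f t F(τ) = F(t + τ) - F(t)`, dividing by the unit `F τ`
  -- makes `f` as smooth as `F`.
  obtain ⟨τ, hτ⟩ : ∃ τ, IsUnit (F τ) := by
    have h1 := (hFd 0).tendsto_slope_zero
    simp only [zero_add, hF0, sub_zero, h0] at h1
    obtain ⟨τ, hτ, hτ0⟩ := ((h1.eventually (Metric.ball_mem_nhds 1 one_pos)).and
      self_mem_nhdsWithin).exists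
    rw [dist_comm, dist_eq_norm] at hτ
    have h2 := isUnit_one_sub_of_norm_lt_one hτ
    rw [sub_sub_cancel] at h2
    have hτ0 : τ ≠ 0 := hτ0
    refine ⟨τ, ?_⟩
    have h3 := h2.smul (Units.mk0 τ hτ0)
    rwa [Units.smul_def, Units.val_mk0, smul_smul, mul_inv_cancel₀ hτ0, one_smul] at h3
  obtain ⟨v, hv⟩ := hτ
  have hf : ∀ t, f t = (F (t + τ) - F t) * ((v⁻¹ : Aˣ) : A) := fun t => by
    have h1 : f t * F τ = F (t + τ) - F t := by
      have h2 : f t * F τ = ∫ s in (0 : ℝ)..τ, f t * f s :=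
        ((ContinuousLinearMap.mul ℝ A (f t)).intervalIntegral_comp_comm
          (hcont.intervalIntegrable _ _)).symm
      simp only [← hadd] at h2
      rw [h2, intervalIntegral.integral_comp_add_left, add_zero, hF]
      exact (intervalIntegral.integral_interval_sub_left (hcont.intervalIntegrable _ _)
        (hcont.intervalIntegrable _ _)).symm
    rw [← h1, ← hv, mul_assoc, Units.mul_inv, mul_one]
  refine ⟨(f (0 + τ) - f 0) * ((v⁻¹ : Aˣ) : A), ?_⟩
  have h1 : HasDerivAt (fun t => F (t + τ)) (f (0 + τ)) 0 := (hFd (0 + τ)).comp_add_const 0 τ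
  exact ((h1.sub (hFd 0)).mul_const _).congr_of_eventuallyEq (Eventually.of_forall hf)

end NormContinuousGroup

/-! ### Uniform continuity of flows on quasi-triangular algebras -/

section UniformContinuity

variable {H : Type*} [NormedAddCommGroup H] [InnerProductSpace ℂ H]
  {𝔅 : Subalgebra ℂ (H →L[ℂ] H)}

open InnerProductSpace

namespace AlgFlow

/-- Flows on an operator algebra containing the rank one operators are spatially implemented. -/
theorem exists_intertwiner [Nontrivial H] (hR : ∀ x y : H, rankOne ℂ x y ∈ 𝔅) (α : AlgFlow 𝔅) :
    ∃ U : ℝ → H →L[ℂ] H, (∀ t, ‖U t‖ ≤ ‖α.op t‖) ∧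
      (∀ t (b : 𝔅), (α.aut t b : H →L[ℂ] H) * U t = U t * b) ∧
      ∀ x, Tendsto (fun t => U t x) (𝓝 0) (𝓝 x) := by
  obtain ⟨e, he⟩ := exists_norm_eq H zero_le_one
  let R (x : H) : 𝔅 := ⟨rankOne ℂ x e, hR x e⟩
  have hRn : ∀ x, ‖R x‖ = ‖x‖ := fun x => by
    change ‖rankOne ℂ x e‖ = ‖x‖
    rw [norm_rankOne, he, mul_one]
  let U (t : ℝ) : H →L[ℂ] H := LinearMap.mkContinuous
    { toFun := fun x => (α.aut t (R x) : H →L[ℂ] H) e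
      map_add' := fun x x' => by
        have : R (x + x') = R x + R x' := Subtype.ext (by simp [R])
        rw [this, map_add, Subalgebra.coe_add, add_apply]
      map_smul' := fun c x => by
        have : R (c • x) = c • R x := Subtype.ext (by simp [R])
        rw [this, map_smul, Subalgebra.coe_smul, smul_apply, RingHom.id_apply] }
    ‖α.op t‖ (fun x => by
      refine ((α.aut t (R x) : H →L[ℂ] H).le_opNorm e).trans ?_
      rw [he, mul_one, ← hRn x]
      exact (α.op t).le_opNorm (R x))
  refine ⟨U, fun t => LinearMap.mkContinuous_norm_le _ (norm_nonneg _) _, fun t b => ?_,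
    fun x => ?_⟩
  · ext x
    have h1 : R ((b : H →L[ℂ] H) x) = b * R x := Subtype.ext (by ext z; simp [R])
    change (α.aut t b : H →L[ℂ] H) ((α.aut t (R x) : H →L[ℂ] H) e)
      = (α.aut t (R ((b : H →L[ℂ] H) x)) : H →L[ℂ] H) e
    rw [h1, map_mul]
    rfl
  · have h1 : Tendsto (fun t => (α.aut t (R x) : H →L[ℂ] H) e) (𝓝 0) (𝓝 ((R x : H →L[ℂ] H) e)) :=
      ((ContinuousLinearMap.apply ℂ H e).continuous.tendsto _).comp
        ((continuous_subtype_val.tendsto _).comp (α.tendsto_aut le_rfl (R x)))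
    have h2 : (R x : H →L[ℂ] H) e = x := by
      change rankOne ℂ x e e = x
      rw [rankOne_apply, inner_self_eq_norm_sq_to_K, he]
      simp
    rwa [h2] at h1

/-- Flows on a closed operator algebra which contains the rank one operators and a nest algebra
are uniformly continuous. -/
theorem tendsto_norm_op_sub_one [Nontrivial H] [CompleteSpace H] {N : Set (Submodule ℂ H)}
    (hN : IsNest N) (hcl : IsClosed (𝔅 : Set (H →L[ℂ] H))) (hR : ∀ x y : H, rankOne ℂ x y ∈ 𝔅)
    (hN𝔅 : nestAlgebra N ≤ 𝔅) (α : AlgFlow 𝔅) :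
    Tendsto (fun t => ‖α.op t - 1‖) (𝓝 0) (𝓝 0) := by
  have : CompleteSpace 𝔅 := hcl.completeSpace_coe
  obtain ⟨U, hUn, hU, hU1⟩ := α.exists_intertwiner hR
  obtain ⟨K, hK0, hK⟩ := α.exists_norm_aut_le 1
  have hcomm : ∀ t (b : 𝔅), (U t - 1) * (b : H →L[ℂ] H) - b * (U t - 1)
      = ((α.aut t b - b : 𝔅) : H →L[ℂ] H) * U t := fun t b => by
    rw [Subalgebra.coe_sub, sub_mul, sub_mul, mul_sub, hU, one_mul, mul_one]
    abel
  have h1 : ∀ᶠ t in 𝓝 (0 : ℝ), ‖U t‖ ≤ K := by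
    filter_upwards [Metric.closedBall_mem_nhds (0 : ℝ) one_pos] with t ht
    refine (hUn t).trans (ContinuousLinearMap.opNorm_le_bound _ hK0 (hK t ?_))
    simpa using ht
  have hcomm0 : ∀ b : 𝔅, Tendsto (fun t => ‖(U t - 1) * (b : H →L[ℂ] H) - b * (U t - 1)‖)
      (𝓝 0) (𝓝 0) := fun b => by
    have h2 : Tendsto (fun t => ‖α.aut t b - b‖ * K) (𝓝 0) (𝓝 0) := by
      simpa using (tendsto_iff_norm_sub_tendsto_zero.1 (α.tendsto_aut le_rfl b)).mul_const K
    refine squeeze_zero' (Eventually.of_forall fun t => norm_nonneg _) (h1.mono fun t ht => ?_) h2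
    rw [hcomm]
    exact (norm_mul_le _ _).trans (mul_le_mul_of_nonneg_left ht (norm_nonneg _))
  have hx : ∀ v, Tendsto (fun t => (U t - 1) v) (𝓝 0) (𝓝 0) := fun v => by
    have := (hU1 v).sub_const v
    rwa [sub_self] at this
  have hx' : ∀ v, Tendsto (fun t => ContinuousLinearMap.adjoint (U t - 1) v) (𝓝 0) (𝓝 0) := by
    obtain ⟨e, he⟩ := exists_norm_eq H zero_le_one
    intro v
    -- The commutator of `U t - 1` with `e ⊗ v` is `(U t - 1) e ⊗ v - e ⊗ (U t - 1)* v`. It and its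
    -- first term tend to zero, hence so does `(U t - 1)* v`.
    have h2 := (hcomm0 ⟨rankOne ℂ e v, hR e v⟩).add ((hx e).norm.mul_const ‖v‖)
    rw [norm_zero, zero_mul, add_zero] at h2
    refine squeeze_zero_norm (fun t => ?_) h2
    have e1 : (U t - 1) * rankOne ℂ e v = rankOne ℂ ((U t - 1) e) v := by
      ext w
      simp [smul_sub]
    have e2 : rankOne ℂ e v * (U t - 1)
        = rankOne ℂ e (ContinuousLinearMap.adjoint (U t - 1) v) := by
      ext w
      rw [mul_apply_eq_comp, rankOne_apply, rankOne_apply, ContinuousLinearMap.adjoint_inner_left]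
    have e3 := norm_sub_rev ((U t - 1) * rankOne ℂ e v) (rankOne ℂ e v * (U t - 1))
    have e4 := norm_sub_norm_le (rankOne ℂ e v * (U t - 1)) ((U t - 1) * rankOne ℂ e v)
    rw [← e3, e1, e2, norm_rankOne, norm_rankOne, he, one_mul, ← e1, ← e2] at e4
    change _ ≤ ‖(U t - 1) * rankOne ℂ e v - rankOne ℂ e v * (U t - 1)‖ + _
    linarith
  have hnorm : Tendsto (fun t => ‖U t - 1‖) (𝓝 0) (𝓝 0) := by
    refine tendsto_of_seq_tendsto fun τ hτ => ?_
    exact hN.tendsto_norm_zero_of_commutator (fun v => (hx v).comp hτ) (fun v => (hx' v).comp hτ)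
      fun b hb => (hcomm0 ⟨b, hN𝔅 hb⟩).comp hτ
  have h4 : Tendsto (fun t => 4 * ‖U t - 1‖) (𝓝 0) (𝓝 0) := by simpa using hnorm.const_mul 4
  refine squeeze_zero' (Eventually.of_forall fun t => norm_nonneg _) ?_ h4
  filter_upwards [hnorm.eventually_le_const (show (0 : ℝ) < 1 / 2 by norm_num)] with t ht
  refine ContinuousLinearMap.opNorm_le_bound _ (by positivity) fun b => ?_
  change ‖((α.aut t b - b : 𝔅) : H →L[ℂ] H)‖ ≤ 4 * ‖U t - 1‖ * ‖(b : H →L[ℂ] H)‖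
  set c := ((α.aut t b - b : 𝔅) : H →L[ℂ] H) with hc
  -- Once `‖U t - 1‖ ≤ 1/2`, the last term is absorbed into the left side: `‖c‖ ≤ 2 ‖U t - 1‖ ‖b‖ +
  -- ‖c‖ / 2`, whence the factor `4`.
  have e1 : c = ((U t - 1) * (b : H →L[ℂ] H) - b * (U t - 1)) - c * (U t - 1) := by
    rw [hcomm, ← hc]
    noncomm_ring
  have e2 := norm_sub_le ((U t - 1) * (b : H →L[ℂ] H) - b * (U t - 1)) (c * (U t - 1))
  rw [← e1] at e2
  have e3 := norm_sub_le ((U t - 1) * (b : H →L[ℂ] H)) (b * (U t - 1))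
  have e4 := norm_mul_le (U t - 1) (b : H →L[ℂ] H)
  have e5 := norm_mul_le (b : H →L[ℂ] H) (U t - 1)
  have e6 : ‖c * (U t - 1)‖ ≤ ‖c‖ * (1 / 2) :=
    (norm_mul_le _ _).trans (mul_le_mul_of_nonneg_left ht (norm_nonneg _))
  linarith

/-- Uniformly continuous flows are differentiable. -/
theorem exists_hasGen_of_tendsto {A : Type*} [NormedRing A] [NormedAlgebra ℂ A] [CompleteSpace A]
    (α : AlgFlow A) (h : Tendsto (fun t => ‖α.op t - 1‖) (𝓝 0) (𝓝 0)) (b : A) :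
    ∃ a, α.HasGen b a := by
  have h0 : α.op 0 = 1 := ContinuousLinearMap.ext fun b => α.aut_zero_apply b
  obtain ⟨f', hf'⟩ := exists_hasDerivAt_zero_of_group h0 α.op_add (by
    rw [ContinuousAt, h0]
    exact tendsto_iff_norm_sub_tendsto_zero.2 h)
  refine ⟨f' b, ?_⟩
  have h1 := ((ContinuousLinearMap.apply ℂ A b).continuous.tendsto f').comp
    (tendsto_slope_zero_complex hf')
  refine h1.congr fun t => ?_
  simp [h0]

end AlgFlow

end UniformContinuity

/-! ### The two algebras and the conclusion -/

section Main

variable {H : Type*} [NormedAddCommGroup H] [InnerProductSpace ℂ H] [CompleteSpace H]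
  {N : Set (Submodule ℂ H)}

theorem IsNest.isInnerPerturbation_nestAlgebra [Nontrivial H] (hN : IsNest N)
    (α β : AlgFlow (nestAlgebra N))
    (hαβ : (fun t : ℝ => ‖α.op t - β.op t‖) =O[𝓝 0] (fun t : ℝ => t)) :
    α.IsInnerPerturbation β ∧
      ∃ (h : nestAlgebra N) (u : ℝ → (nestAlgebra N)ˣ), α.IsInnerPerturbationBy β h ∧
        β.IsCocycle u ∧ AlgFlow.IsDifferentiableFamily u (Complex.I • h) ∧
        α.IsAdPerturbationBy β u := by
  obtain ⟨𝓜, h𝓜⟩ := hN.exists_hasRankOnes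
  exact h𝓜.isInnerPerturbation hN.isClosed_nestAlgebra α β hαβ
    (fun U _ b T hT => hN.mem_nestAlgebra_of_tendstoWOT hT
      (Eventually.of_forall fun s => (AlgFlow.diffQuot α β s b).2))
    fun k hk => hN.mem_nestAlgebra_of_commutator hk

/-- Uniform continuity makes both generators everywhere defined. The difference quotients then
converge in norm to an element of the algebra, which must be their weak limit. -/
theorem IsNest.isInnerPerturbation_quasiTriangularAlgebra [Nontrivial H] (hN : IsNest N)
    (α β : AlgFlow (quasiTriangularAlgebra N))
    (hαβ : (fun t : ℝ => ‖α.op t - β.op t‖) =O[𝓝 0] (fun t : ℝ => t)) :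
    α.IsInnerPerturbation β ∧
      ∃ (h : quasiTriangularAlgebra N) (u : ℝ → (quasiTriangularAlgebra N)ˣ),
        α.IsInnerPerturbationBy β h ∧ β.IsCocycle u ∧
        AlgFlow.IsDifferentiableFamily u (Complex.I • h) ∧ α.IsAdPerturbationBy β u := by
  have hcl := hN.isClosed_quasiTriangularAlgebra
  have : CompleteSpace (quasiTriangularAlgebra N) := hcl.completeSpace_coe
  have hgen : ∀ (γ : AlgFlow (quasiTriangularAlgebra N)) b, ∃ a, γ.HasGen b a := fun γ =>
    γ.exists_hasGen_of_tendsto (γ.tendsto_norm_op_sub_one hN hcl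
      (fun x y => (isCompactOperator_rankOne x y).mem_quasiTriangularAlgebra)
      nestAlgebra_le_quasiTriangularAlgebra)
  refine hasRankOnes_quasiTriangularAlgebra.isInnerPerturbation hcl α β hαβ
    (fun U hU b T hT => ?_) fun k hk => hN.mem_quasiTriangularAlgebra_of_commutator
      fun D hD => hk D (nestAlgebra_le_quasiTriangularAlgebra hD)
  obtain ⟨a, ha⟩ := hgen α b
  obtain ⟨a', ha'⟩ := hgen β b
  have h1 : Tendsto (fun s => AlgFlow.diffQuot α β s b) (𝓝[≠] 0) (𝓝 (a - a')) := by
    refine (Tendsto.sub ha ha').congr fun s => ?_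
    rw [AlgFlow.diffQuot, ← smul_sub, sub_sub_sub_cancel_right]
  have h2 : Tendsto (fun s => (AlgFlow.diffQuot α β s b : H →L[ℂ] H)) U
      (𝓝 ((a - a' : quasiTriangularAlgebra N) : H →L[ℂ] H)) :=
    (continuous_subtype_val.tendsto _).comp (h1.mono_left (hU.trans (nhdsGT_le_nhdsNE 0)))
  rw [hT.unique (.of_tendsto h2)]
  exact (a - a').2

end Main

theorem proposition3p3 {H : Type*} [NormedAddCommGroup H] [InnerProductSpace ℂ H]
    [CompleteSpace H] (N : Set (Submodule ℂ H)) (hN : IsNest N)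
    (𝔅 : Subalgebra ℂ (H →L[ℂ] H))
    (h𝔅 : 𝔅 = nestAlgebra N ∨ 𝔅 = quasiTriangularAlgebra N)
    (α β : AlgFlow 𝔅)
    (hαβ : (fun t : ℝ => ‖α.op t - β.op t‖) =O[𝓝 0] (fun t : ℝ => t)) :
    α.IsInnerPerturbation β ∧
      ∃ (h : 𝔅) (u : ℝ → 𝔅ˣ), α.IsInnerPerturbationBy β h ∧ β.IsCocycle u ∧
        AlgFlow.IsDifferentiableFamily u (Complex.I • h) ∧ α.IsAdPerturbationBy β u := by
  -- The rank one arguments need a unit vector; on the zero space every claim is trivial.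
  rcases subsingleton_or_nontrivial H with hH | hH
  · have hs : Subsingleton 𝔅 := ⟨fun a b => Subtype.ext
      (ContinuousLinearMap.ext fun x => Subsingleton.elim _ _)⟩
    have hgen : ∀ (γ : AlgFlow 𝔅) b, b ∈ γ.generator.domain := fun γ b =>
      Subsingleton.elim 0 b ▸ zero_mem _
    have hinner : α.IsInnerPerturbationBy β 0 :=
      ⟨le_antisymm (fun b _ => hgen β b) fun b _ => hgen α b,
        fun b _ _ => Subsingleton.elim _ _⟩
    refine ⟨⟨0, hinner⟩, 0, fun _ => 1, hinner,
      ⟨continuous_const, fun s t => Subsingleton.elim _ _⟩, ⟨differentiable_const _, ?_⟩,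
      fun t b => Subsingleton.elim _ _⟩
    rw [Subsingleton.elim (Complex.I • (0 : 𝔅)) 0]
    exact hasDerivAt_const _ _
  · rcases h𝔅 with rfl | rfl
    · exact hN.isInnerPerturbation_nestAlgebra α β hαβ
    · exact hN.isInnerPerturbation_quasiTriangularAlgebra α β hαβ
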